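/- Let $E_{32}$ be the elliptic curve $y^2=x^3+4x$ over $\mathbb{Q}$, and let $$L(E_{32},s)=\sum_{n\ge1}\frac{a_n}{n^s}=\prod_{p\ne 2}\frac{1}{1-a_p\,p^{-s}+p^{1-2s}},\qquad a_p=p+1-\#E_{32}(\mathbb{F}_p),$$ be its Hasse–Weil $L$-function (the reduction at $p=2$ is additive, so the Euler factor there is $1$). Let $${}_3F_2\left[\left.\begin{matrix}a,b,c\\ e,f\end{matrix}\right|z\right]=\sum_{n=0}^{\infty}\frac{(a)_n(b)_n(c)_n}{(e)_n(f)_n}\frac{z^n}{n!},\qquad (a)_n=\frac{\Gamma(a+n)}{\Gamma(a)}.$$ Then the Dirichlet series $L(E_{32},s)$ converges absolutely at $s=2$, the two hypergeometric series below converge, and $$L(E_{32},2)=\frac{\sqrt{\pi}\,\Gamma\left(\tfrac14\right)^2}{32\sqrt2}\;{}_3F_2\left[\left.\begin{matrix}\tfrac12,\tfrac12,1\\ \tfrac32,\tfrac34\end{matrix}\right|1\right]-\frac{\sqrt{\pi}\,\Gamma\left(\tfrac34\right)^2}{8\sqrt2}\;{}_3F_2\left[\left.\begin{matrix}\tfrac12,\tfrac12,1\\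 \tfrac32,\tfrac54\end{matrix}\right|1\right].$$ -/

import Mathlib

/-- The elliptic curve `E₃₂ : y² = x³ + 4x` over `ℚ`. -/
def curveE32 : WeierstrassCurve ℚ := ⟨0, 0, 0, 4, 0⟩

instance : curveE32.IsElliptic :=
  ⟨isUnit_iff_ne_zero.mpr (by
    norm_num [curveE32, WeierstrassCurve.Δ, WeierstrassCurve.b₂, WeierstrassCurve.b₄,
      WeierstrassCurve.b₆, WeierstrassCurve.b₈])⟩

/-- The `n`-th term `(a)ₙ (b)ₙ (c)ₙ / ((e)ₙ (f)ₙ) · zⁿ / n!` of the hypergeometric series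
`₃F₂[a, b, c; e, f | z]`, where `(a)ₙ = a (a + 1) ⋯ (a + n - 1)` is the Pochhammer symbol. -/
noncomputable def hypergeometricTerm32 (a b c e f z : ℝ) (n : ℕ) : ℝ :=
  (ascPochhammer ℝ n).eval a * (ascPochhammer ℝ n).eval b * (ascPochhammer ℝ n).eval c /
    ((ascPochhammer ℝ n).eval e * (ascPochhammer ℝ n).eval f) * (z ^ n / (n.factorial : ℝ))

/-- The generalized hypergeometric function `₃F₂[a, b, c; e, f | z]`, as the sum of its series. -/
noncomputable def hypergeometric32 (a b c e f z : ℝ) : ℝ :=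
  ∑' n : ℕ, hypergeometricTerm32 a b c e f z n

/-- The Pochhammer symbol is the quotient `Γ(a + n) / Γ(a)`, for positive parameters. -/
theorem ascPochhammer_eval_eq_Gamma_div {a : ℝ} (ha : 0 < a) (n : ℕ) :
    (ascPochhammer ℝ n).eval a = Real.Gamma (a + n) / Real.Gamma a := by
  have h0 : Real.Gamma a ≠ 0 := (Real.Gamma_pos_of_pos ha).ne'
  induction n with
  | zero => simp [h0]
  | succ k ih =>
    have hk : a + (k : ℝ) ≠ 0 := by positivity
    rw [ascPochhammer_succ_eval, ih, Nat.cast_succ, ← add_assoc, Real.Gamma_add_one hk]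
    ring

/-! Both sides are evaluated as one hyperbolic series: with S the sum of sech(πx)·tanh(πx)/x over
all half-integers x, each side equals π²S/16.

Arithmetic side. The curve has complex multiplication by ℤ[i]. For p ≡ 1 mod 4 the Frobenius trace
is π + π̄, where π = -J(χ, χ²) is a quartic Jacobi sum of norm p, congruent to 1 modulo 2 + 2i; for
p ≡ 3 mod 4 it is zero. The Hecke recurrences then agree with those of sums over primary Gaussian
integers of given norm (`LFunction_curveE32_eq_sum_primary`), so L(E₃₂, 2) = ∑ α / N(α)² over
primary α. In coordinates c, d ≡ 1 mod 4 this is 4 ∑ d / (c² + d²)², and the sum over d is the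
imaginary part of a Lipschitz formula (`tsum_int_lattice_row`), which leaves π²S/16.

Hypergeometric side. Since (1/2)ₙ/(3/2)ₙ = 1/(2n + 1), Euler's beta integral gives each ₃F₂ as an
integral of y^(f - 3/2) · artanh √(1 - y) / (1 - y). In the combination at hand the kernel (y^(-3/4)
- y^(-1/4)) / (1 - y) is the derivative of 4 arctan(y^(1/4)). Integration by parts and y = w⁴, with
w the lemniscate sine, lead to the integral of arctan(w)/w over a quarter period, up to constants.

The lemniscate sine is built from bilateral sums of hyperbolic functions. Products of two such sums
are computed by grouping terms by index difference and using that a product of two sech is a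
multiple of a difference of tanh (`sechPi_mul_sechPi`). This yields the algebraic relation
`altSechSum_curve`, the differential equation `hasDerivAt_lemniscate` and the fact that 1/w is a
multiple of `altCschSum`. Moreover arctan w has derivative π · `altSechSum`; Poisson summation and
the self-duality of sech give its Fourier sine series. Each sine integrates against `altCschSum` to
a tanh by unfolding to the real line (`integral_sin_mul_altCschSum`), so S appears again. -/

open WeierstrassCurve

/-! ### Point counts under changes of variables -/

section VariableChangeCount

variable {F : Type*} [Field F]

/-- The bijection between affine solutions induced by an admissible change of variables. -/
theorem WeierstrassCurve.equation_variableChange_iff (W : WeierstrassCurve F) (C : VariableChange F)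
    (x y : F) : (C • W).toAffine.Equation x y ↔
      W.toAffine.Equation (C.u ^ 2 * x + C.r) (C.u ^ 3 * y + C.u ^ 2 * C.s * x + C.t) := by
  have hu : (C.u : F) ≠ 0 := C.u.ne_zero
  rw [Affine.equation_iff, Affine.equation_iff, variableChange_a₁, variableChange_a₂,
    variableChange_a₃, variableChange_a₄, variableChange_a₆]
  simp only [Units.val_inv_eq_inv_val]
  rw [← sub_eq_zero, ← sub_eq_zero (b := _ + _ + _ + W.a₆), ← mul_right_inj' (pow_ne_zero 6 hu),
    mul_zero]
  refine Eq.congr_left ?_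
  field_simp
  ring

/-- The affine solutions of a Weierstrass equation, with a point at infinity, are the points of an
elliptic curve. -/
noncomputable def WeierstrassCurve.pointEquivOption (W : WeierstrassCurve F) (hΔ : W.Δ ≠ 0) :
    W.toAffine.Point ≃ Option {xy : F × F // W.toAffine.Equation xy.1 xy.2} where
  toFun
    | .zero => none
    | .some x y h => some ⟨(x, y), h.1⟩
  invFun
    | none => .zero
    | some xy => .some xy.1.1 xy.1.2
        ((Affine.equation_iff_nonsingular_of_Δ_ne_zero hΔ).mp xy.2)
  left_inv P := by cases P <;> rfl
  right_inv P := by rcases P with _ | ⟨⟨x, y⟩, h⟩ <;> rfl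

/-- The bijection between the affine solutions of two Weierstrass equations related by a change of
variables. -/
noncomputable def WeierstrassCurve.variableChangeEquiv (W : WeierstrassCurve F)
    (C : VariableChange F) :
    {xy : F × F // (C • W).toAffine.Equation xy.1 xy.2} ≃
      {xy : F × F // W.toAffine.Equation xy.1 xy.2} :=
  have hu : (C.u : F) ≠ 0 := C.u.ne_zero
  Equiv.subtypeEquiv
    { toFun := fun xy => (C.u ^ 2 * xy.1 + C.r, C.u ^ 3 * xy.2 + C.u ^ 2 * C.s * xy.1 + C.t)
      invFun := fun xy => ((xy.1 - C.r) / C.u ^ 2,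
        (xy.2 - C.u ^ 2 * C.s * ((xy.1 - C.r) / C.u ^ 2) - C.t) / C.u ^ 3)
      left_inv := fun xy => by ext <;> field_simp <;> ring
      right_inv := fun xy => by ext <;> field_simp <;> ring }
    fun xy => W.equation_variableChange_iff C xy.1 xy.2

theorem WeierstrassCurve.card_point_variableChange (W : WeierstrassCurve F) (C : VariableChange F)
    (hΔ : W.Δ ≠ 0) :
    Nat.card (C • W).toAffine.Point = Nat.card W.toAffine.Point := by
  have hΔ' : (C • W).Δ ≠ 0 := by
    rw [variableChange_Δ]; exact mul_ne_zero (pow_ne_zero _ (Units.ne_zero _)) hΔ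
  exact Nat.card_congr (((C • W).pointEquivOption hΔ').trans
    ((W.variableChangeEquiv C).optionCongr.trans (W.pointEquivOption hΔ).symm))

/-- Transport of the number of points along a field isomorphism. -/
theorem WeierstrassCurve.card_point_map_ringEquiv {F' : Type*} [Field F'] (W : WeierstrassCurve F)
    (e : F ≃+* F') (hΔ : W.Δ ≠ 0) :
    Nat.card (W.map (e : F →+* F')).toAffine.Point = Nat.card W.toAffine.Point := by
  have hΔ' : (W.map (e : F →+* F')).Δ ≠ 0 := by
    rw [map_Δ]; simpa using hΔ
  refine Nat.card_congr (((W.map (e : F →+* F')).pointEquivOption hΔ').trans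
    ((Equiv.optionCongr (Equiv.subtypeEquiv (e.toEquiv.prodCongr e.toEquiv) ?_)).symm.trans
      (W.pointEquivOption hΔ).symm))
  intro xy
  exact (Affine.map_equation W.toAffine (f := (e : F →+* F')) e.injective xy.1 xy.2).symm

end VariableChangeCount

/-! ### Minimal models of equations with unit discriminant -/

section Minimal

open IsDiscreteValuationRing IsDedekindDomain.HeightOneSpectrum IsLocalRing

theorem WeierstrassCurve.isIntegral_baseChange (R : Type*) [CommRing R] {K : Type*} [Field K]
    [Algebra R K] (W₀ : WeierstrassCurve R) :
    WeierstrassCurve.IsIntegral R (W₀.map (algebraMap R K)) := ⟨⟨W₀, rfl⟩⟩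

variable (R : Type*) [CommRing R] [IsDomain R] [IsDiscreteValuationRing R]
variable {K : Type*} [Field K] [Algebra R K] [IsFractionRing R K]

theorem valuation_algebraMap_unit {x : R} (hx : IsUnit x) :
    IsDedekindDomain.HeightOneSpectrum.valuation K (IsDiscreteValuationRing.maximalIdeal R)
      (algebraMap R K x) = 1 := by
  rw [valuation_eq_one_iff_notMem]
  exact fun h => (IsLocalRing.mem_maximalIdeal x).mp h hx

theorem isUnit_of_valuation_eq_one {x : R} (hx :
    IsDedekindDomain.HeightOneSpectrum.valuation K (IsDiscreteValuationRing.maximalIdeal R)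
      (algebraMap R K x) = 1) : IsUnit x := by
  rw [valuation_eq_one_iff_notMem] at hx
  by_contra h
  exact hx ((IsLocalRing.mem_maximalIdeal x).mpr h)

/-- A minimal model of a Weierstrass equation with unit discriminant has good reduction. -/
theorem WeierstrassCurve.minimal_hasGoodReduction (W₀ : WeierstrassCurve R) (hΔ : IsUnit W₀.Δ) :
    ((W₀.map (algebraMap R K)).minimal R).HasGoodReduction R := by
  set W := W₀.map (algebraMap R K) with hW
  have hint : WeierstrassCurve.IsIntegral R W := W₀.isIntegral_baseChange R
  have hmin : WeierstrassCurve.IsMinimal R (W.minimal R) := inferInstance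
  obtain ⟨C, hC⟩ : ∃ C : VariableChange K, W.minimal R = C • W := ⟨_, rfl⟩
  have hback : C⁻¹ • (W.minimal R) = W := by rw [hC, inv_smul_smul]
  have hint' : WeierstrassCurve.IsIntegral R (C⁻¹ • (W.minimal R)) := by rw [hback]; exact hint
  -- Minimality compares with every integral equation in the orbit. Here `C⁻¹` leads back to the
  -- original equation, whose discriminant has the largest possible valuation `1`.
  have hmax := hmin.val_Δ_maximal.2 (j := C⁻¹) hint'
  have hval : (valuation_Δ_aux R (C⁻¹ • (W.minimal R)) : WithZero (Multiplicative ℤ)) = 1 := by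
    rw [valuation_Δ_aux_eq_of_isIntegral, hback, hW, map_Δ]
    exact valuation_algebraMap_unit R hΔ
  have hle : valuation_Δ_aux R ((1 : VariableChange K) • (W.minimal R)) ≤
      valuation_Δ_aux R (C⁻¹ • (W.minimal R)) := by
    rw [← Subtype.coe_le_coe, hval]
    exact (valuation_Δ_aux R ((1 : VariableChange K) • (W.minimal R))).2
  have h1 := hmax hle
  rw [← Subtype.coe_le_coe, hval] at h1
  beta_reduce at h1
  rw [one_smul, valuation_Δ_aux_eq_of_isIntegral] at h1
  refine ⟨le_antisymm ?_ h1⟩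
  obtain ⟨r, hr⟩ := Δ_integral_of_isIntegral R (W.minimal R)
  rw [← hr]
  exact valuation_le_one _ r

/-- A change of variables between Weierstrass equations with unit discriminant is integral, if `2`
is a unit. -/
theorem WeierstrassCurve.exists_integral_variableChange (W₀ W₁ : WeierstrassCurve R)
    (hΔ₀ : IsUnit W₀.Δ) (hΔ₁ : IsUnit W₁.Δ) (h2 : IsUnit (2 : R)) (C : VariableChange K)
    (hC : C • W₀.map (algebraMap R K) = W₁.map (algebraMap R K)) :
    ∃ C₀ : VariableChange R, C₀.map (algebraMap R K) = C := by
  obtain ⟨h, hh⟩ := h2.exists_right_inv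
  have hhK : (2 : K) * algebraMap R K h = 1 := by
    rw [← map_ofNat (algebraMap R K) 2, ← map_mul, hh, map_one]
  have hu0 : (C.u : K) ≠ 0 := C.u.ne_zero
  have hΔ : (C.u : K) ^ 12 * algebraMap R K W₁.Δ = algebraMap R K W₀.Δ := by
    have := congrArg WeierstrassCurve.Δ hC
    rw [variableChange_Δ, map_Δ, map_Δ, Units.val_inv_eq_inv_val] at this
    rw [← this]; field_simp
  obtain ⟨d₀, hd₀⟩ := hΔ₀.exists_right_inv
  obtain ⟨d₁, hd₁⟩ := hΔ₁.exists_right_inv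
  have hd₀K : algebraMap R K W₀.Δ * algebraMap R K d₀ = 1 := by rw [← map_mul, hd₀, map_one]
  have hd₁K : algebraMap R K W₁.Δ * algebraMap R K d₁ = 1 := by rw [← map_mul, hd₁, map_one]
  have hu12 : (C.u : K) ^ 12 = algebraMap R K (W₀.Δ * d₁) := by
    rw [map_mul, ← hΔ, mul_assoc, hd₁K, mul_one]
  have hv12 : ((C.u : K)⁻¹) ^ 12 = algebraMap R K (W₁.Δ * d₀) := by
    rw [map_mul, inv_pow]
    refine inv_eq_of_mul_eq_one_right ?_
    rw [← mul_assoc, hΔ, hd₀K]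
  -- The twelfth powers of `u` and of `u⁻¹` are quotients of unit discriminants, so both elements
  -- lie in the integrally closed ring `R`.
  obtain ⟨u, hu⟩ := IsIntegrallyClosed.exists_algebraMap_eq_of_isIntegral_pow (R := R) (K := K)
    (x := C.u) (n := 12) (by norm_num) (by rw [hu12]; exact isIntegral_algebraMap)
  obtain ⟨v, hv⟩ := IsIntegrallyClosed.exists_algebraMap_eq_of_isIntegral_pow (R := R) (K := K)
    (x := (C.u : K)⁻¹) (n := 12) (by norm_num) (by rw [hv12]; exact isIntegral_algebraMap)
  have huv : u * v = 1 := by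
    apply IsFractionRing.injective R K
    rw [map_mul, hu, hv, map_one, mul_inv_cancel₀ hu0]
  have e₁ := congrArg WeierstrassCurve.a₁ hC
  have e₃ := congrArg WeierstrassCurve.a₃ hC
  have e₆ := congrArg WeierstrassCurve.b₆ hC
  rw [variableChange_a₁, map_a₁, map_a₁, Units.val_inv_eq_inv_val, inv_mul_eq_iff_eq_mul₀ hu0,
    ← hu] at e₁
  rw [variableChange_a₃, map_a₁, map_a₃, map_a₃, Units.val_inv_eq_inv_val, inv_pow,
    inv_mul_eq_iff_eq_mul₀ (pow_ne_zero _ hu0), ← hu] at e₃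
  rw [variableChange_b₆, map_b₂, map_b₄, map_b₆, map_b₆, Units.val_inv_eq_inv_val, inv_pow,
    inv_mul_eq_iff_eq_mul₀ (pow_ne_zero _ hu0), ← hu] at e₆
  -- The transformation law of `b₆` is a cubic in `r` with leading coefficient 4; multiplying it by
  -- `h ^ 2`, with `h` the inverse of 2, makes it monic over `R`.
  obtain ⟨r, hr⟩ : ∃ r : R, algebraMap R K r = C.r := by
    apply IsIntegrallyClosed.algebraMap_eq_of_integral (R := R) (K := K)
    refine ⟨Polynomial.X ^ 3 + Polynomial.C (h ^ 2 * W₀.b₂) * Polynomial.X ^ 2 +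
      Polynomial.C (h * W₀.b₄) * Polynomial.X +
      Polynomial.C (h ^ 2 * (W₀.b₆ - u ^ 6 * W₁.b₆)), by monicity!, ?_⟩
    simp only [Polynomial.eval₂_add, Polynomial.eval₂_mul, Polynomial.eval₂_pow,
      Polynomial.eval₂_X, Polynomial.eval₂_C, map_mul, map_sub, map_pow, Polynomial.eval₂_sub]
    linear_combination (algebraMap R K h) ^ 2 * e₆ -
      (C.r ^ 3 * (2 * algebraMap R K h + 1) + algebraMap R K h * C.r * algebraMap R K W₀.b₄) * hhK
  have hs : algebraMap R K (h * (u * W₁.a₁ - W₀.a₁)) = C.s := by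
    simp only [map_mul, map_sub]
    linear_combination -(algebraMap R K h) * e₁ + C.s * hhK
  have ht : algebraMap R K (h * (u ^ 3 * W₁.a₃ - W₀.a₃ - r * W₀.a₁)) = C.t := by
    simp only [map_mul, map_sub, map_pow, hr]
    linear_combination -(algebraMap R K h) * e₃ + C.t * hhK
  refine ⟨⟨⟨u, v, huv, by rw [mul_comm]; exact huv⟩, r, h * (u * W₁.a₁ - W₀.a₁),
    h * (u ^ 3 * W₁.a₃ - W₀.a₃ - r * W₀.a₁)⟩, ?_⟩
  ext
  · exact hu
  · exact hr
  · exact hs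
  · exact ht

/-- The number of points on the reduction of the minimal model of a Weierstrass equation with unit
discriminant, if `2` is a unit. -/
theorem WeierstrassCurve.card_point_reduction_minimal (W₀ : WeierstrassCurve R)
    (hΔ : IsUnit W₀.Δ) (h2 : IsUnit (2 : R)) :
    Nat.card (((W₀.map (algebraMap R K)).minimal R).reduction R).toAffine.Point =
      Nat.card (W₀.map (residue R)).toAffine.Point := by
  set W := W₀.map (algebraMap R K) with hW
  set W₁ := integralModel R (W.minimal R) with hW₁
  have hmap : W₁.map (algebraMap R K) = W.minimal R := baseChange_integralModel_eq R (W.minimal R)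
  have hΔ₁ : IsUnit W₁.Δ := by
    apply isUnit_of_valuation_eq_one R (K := K)
    rw [← map_Δ, hmap]
    exact (W₀.minimal_hasGoodReduction R (K := K) hΔ).goodReduction
  obtain ⟨C, hC⟩ : ∃ C : VariableChange K, W.minimal R = C • W := ⟨_, rfl⟩
  obtain ⟨C₀, hC₀⟩ := W₀.exists_integral_variableChange R W₁ hΔ hΔ₁ h2 C (by rw [hmap, hC])
  have hW₁' : W₁ = C₀ • W₀ := by
    apply WeierstrassCurve.map_injective (IsFractionRing.injective R K)
    beta_reduce
    rw [hmap, hC, ← hC₀, hW, map_variableChange]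
  have hred : (W.minimal R).reduction R = (C₀.map (residue R)) • (W₀.map (residue R)) := by
    rw [map_variableChange, ← hW₁']; rfl
  rw [hred]
  apply card_point_variableChange
  rw [map_Δ]
  exact (hΔ.map (residue R)).ne_zero

end Minimal

/-! ### Local polynomials at good and at additive places -/

section LocalPolynomial

open IsDiscreteValuationRing IsDedekindDomain.HeightOneSpectrum IsLocalRing Polynomial

variable (R : Type*) [CommRing R] [IsDomain R] [IsDiscreteValuationRing R]
variable {K : Type*} [Field K] [Algebra R K] [IsFractionRing R K]

/-- The local polynomial of a Weierstrass equation with unit discriminant. -/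
theorem WeierstrassCurve.localPolynomial_of_isUnit_Δ (W₀ : WeierstrassCurve R)
    (hΔ : IsUnit W₀.Δ) (h2 : IsUnit (2 : R)) :
    (W₀.map (algebraMap R K)).localPolynomial R =
      1 - C ((Nat.card (ResidueField R) : ℤ) + 1 -
        (Nat.card (W₀.map (residue R)).toAffine.Point : ℤ)) * X +
        C (Nat.card (ResidueField R) : ℤ) * X ^ 2 := by
  rw [localPolynomial, if_pos (W₀.minimal_hasGoodReduction R hΔ)]
  simp only [W₀.card_point_reduction_minimal R hΔ h2]

/-- A Weierstrass equation with `j = 1728` has additive reduction at an unramified place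
above `2`. -/
theorem WeierstrassCurve.localPolynomial_eq_one (W₀ : WeierstrassCurve R)
    (hj : W₀.c₄ ^ 3 = 1728 * W₀.Δ) (h2 : Prime (2 : R)) :
    (W₀.map (algebraMap R K)).localPolynomial R = 1 := by
  set W := W₀.map (algebraMap R K) with hW
  set W₁ := integralModel R (W.minimal R) with hW₁
  have hmap : W₁.map (algebraMap R K) = W.minimal R := baseChange_integralModel_eq R (W.minimal R)
  obtain ⟨C, hC⟩ : ∃ C : VariableChange K, W.minimal R = C • W := ⟨_, rfl⟩
  have hj₁ : W₁.c₄ ^ 3 = 1728 * W₁.Δ := by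
    apply IsFractionRing.injective R K
    have hjK := congrArg (algebraMap R K) hj
    rw [map_mul, map_pow, map_ofNat] at hjK ⊢
    rw [← map_c₄, ← map_Δ, hmap, hC, variableChange_c₄, variableChange_Δ, hW, map_c₄, map_Δ,
      mul_pow, hjK]
    ring
  have hc₄ : ¬ IsUnit W₁.c₄ := fun h => by
    have h3 := h.pow 3
    rw [hj₁, show (1728 : R) = 2 * 864 by norm_num, mul_assoc] at h3
    exact h2.not_isUnit (isUnit_of_mul_isUnit_left h3)
  have hmult : ¬ (W.minimal R).HasMultiplicativeReduction R := fun h => by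
    refine hc₄ (isUnit_of_valuation_eq_one R (K := K) ?_)
    rw [← map_c₄, hmap]
    exact h.multiplicativeReduction
  -- With a unit discriminant, `c₄` even forces `a₁` even, hence 16 divides `c₄`. Cancelling 2⁶ in
  -- `c₄ ^ 3 = 1728 * Δ` would then make `27 * Δ` even.
  have hgood : ¬ (W.minimal R).HasGoodReduction R := fun h => by
    have hΔ₁ : IsUnit W₁.Δ := by
      refine isUnit_of_valuation_eq_one R (K := K) ?_
      rw [← map_Δ, hmap]
      exact h.goodReduction
    have hc₄2 : (2 : R) ∣ W₁.c₄ :=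
      h2.dvd_of_dvd_pow (n := 3) (by rw [hj₁]; exact ⟨864 * W₁.Δ, by ring⟩)
    obtain ⟨a, ha⟩ : (2 : R) ∣ W₁.a₁ := by
      refine h2.dvd_of_dvd_pow (n := 4) ?_
      have h4 : W₁.a₁ ^ 4 =
          W₁.c₄ - 2 * (4 * W₁.a₁ ^ 2 * W₁.a₂ + 8 * W₁.a₂ ^ 2 - 12 * W₁.b₄) := by
        simp only [c₄, b₂]; ring
      rw [h4]
      exact dvd_sub hc₄2 (dvd_mul_right _ _)
    obtain ⟨z, hz⟩ : (16 : R) ∣ W₁.c₄ :=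
      ⟨(a ^ 2 + W₁.a₂) ^ 2 - 3 * (a * W₁.a₃ + W₁.a₄), by
        simp only [c₄, b₂, b₄, ha]; ring⟩
    have hz3 : 2 * (32 * z ^ 3) = 27 * W₁.Δ := by
      refine mul_left_cancel₀ (pow_ne_zero 6 h2.ne_zero) ?_
      rw [hz] at hj₁
      linear_combination hj₁
    have h27 : (2 : R) ∣ 27 :=
      (h2.dvd_or_dvd ⟨_, hz3.symm⟩).resolve_right fun hd => h2.not_isUnit (isUnit_of_dvd_unit hd hΔ₁)
    refine h2.not_isUnit (isUnit_of_dvd_one ?_)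
    have := dvd_sub h27 (dvd_mul_right (2 : R) 13)
    rwa [show (27 : R) - 2 * 13 = 1 by norm_num] at this
  have hsplit : ¬ (W.minimal R).HasSplitMultiplicativeReduction R := fun h => hmult h.1
  rw [localPolynomial, if_neg hgood, if_neg hsplit, if_neg hmult]

end LocalPolynomial

/-! ### The local factors of the curve over ℚ -/

section LocalRat

open IsDedekindDomain NumberField IsLocalRing Rat.HeightOneSpectrum Polynomial

local instance (p : Nat.Primes) : Fact p.1.Prime := ⟨p.2⟩

/-- The residue field of the completion of `ℚ` at a prime `p` is `ℤ/p`. -/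
noncomputable def residueFieldRatEquiv (v : HeightOneSpectrum (𝓞 ℚ)) :
    ResidueField (v.adicCompletionIntegers ℚ) ≃+* ZMod (primesEquiv v).1 :=
  (ResidueField.mapEquiv
    ((adicCompletionIntegers.padicIntEquiv v : v.adicCompletionIntegers ℚ ≃A[ℤ] _) :
      v.adicCompletionIntegers ℚ ≃+* ℤ_[primesEquiv v])).trans PadicInt.residueField

/-- The integral model `y² = x³ + 4x`. -/
def curveModel (R : Type*) [CommRing R] : WeierstrassCurve R := ⟨0, 0, 0, 4, 0⟩

theorem curveModel_map {R S : Type*} [CommRing R] [CommRing S] (f : R →+* S) :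
    (curveModel R).map f = curveModel S := by
  ext <;> simp [curveModel, map_ofNat f 4]

theorem curveModel_Δ (R : Type*) [CommRing R] : (curveModel R).Δ = - 2 ^ 12 := by
  simp only [curveModel, Δ, b₂, b₄, b₆, b₈]; ring

theorem curveModel_j (R : Type*) [CommRing R] :
    (curveModel R).c₄ ^ 3 = 1728 * (curveModel R).Δ := by
  rw [curveModel_Δ]; simp only [curveModel, c₄, b₂, b₄]; ring

theorem curveE32_baseChange (v : HeightOneSpectrum (𝓞 ℚ)) :
    curveE32.baseChange (v.adicCompletion ℚ) =
      (curveModel (v.adicCompletionIntegers ℚ)).map (algebraMap _ (v.adicCompletion ℚ)) := by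
  rw [curveModel_map, WeierstrassCurve.baseChange, show curveE32 = curveModel ℚ from rfl,
    curveModel_map]

/-- The trace of Frobenius `p + 1 - #E₃₂(𝔽_p)`. -/
noncomputable def frobeniusTrace (p : ℕ) : ℤ :=
  p + 1 - Nat.card (curveModel (ZMod p)).toAffine.Point

theorem card_residueFieldRat (v : HeightOneSpectrum (𝓞 ℚ)) :
    Nat.card (ResidueField (v.adicCompletionIntegers ℚ)) = (primesEquiv v).1 := by
  rw [Nat.card_congr (residueFieldRatEquiv v).toEquiv, Nat.card_zmod]

theorem isUnit_two_padicInt {p : ℕ} [Fact p.Prime] (hp : p ≠ 2) : IsUnit (2 : ℤ_[p]) := by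
  rw [PadicInt.isUnit_iff]
  simpa using PadicInt.norm_natCast_eq_one_iff.mpr
    ((Nat.coprime_primes (Fact.out : p.Prime) Nat.prime_two).mpr hp)

theorem localPolynomial_curveE32_of_ne_two (v : HeightOneSpectrum (𝓞 ℚ))
    (hv : (primesEquiv v).1 ≠ 2) :
    (curveE32.baseChange (v.adicCompletion ℚ)).localPolynomial (v.adicCompletionIntegers ℚ) =
      1 - C (frobeniusTrace (primesEquiv v).1) * X + C ((primesEquiv v).1 : ℤ) * X ^ 2 := by
  have h2 : IsUnit (2 : v.adicCompletionIntegers ℚ) := by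
    have h := (isUnit_two_padicInt hv).map (adicCompletionIntegers.padicIntEquiv v).symm
    rwa [map_ofNat (adicCompletionIntegers.padicIntEquiv v).symm 2] at h
  have hΔ : IsUnit (curveModel (v.adicCompletionIntegers ℚ)).Δ := by
    rw [curveModel_Δ]; exact (h2.pow 12).neg
  have hΔ' : (curveModel (ResidueField (v.adicCompletionIntegers ℚ))).Δ ≠ 0 := by
    rw [← curveModel_map (residue _), map_Δ]; exact (hΔ.map _).ne_zero
  rw [curveE32_baseChange, localPolynomial_of_isUnit_Δ _ _ hΔ h2, curveModel_map,
    card_residueFieldRat, frobeniusTrace,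
    ← card_point_map_ringEquiv _ (residueFieldRatEquiv v) hΔ', curveModel_map]

theorem localPolynomial_curveE32_of_eq_two (v : HeightOneSpectrum (𝓞 ℚ))
    (hv : (primesEquiv v).1 = 2) :
    (curveE32.baseChange (v.adicCompletion ℚ)).localPolynomial (v.adicCompletionIntegers ℚ) = 1 := by
  have h2 : Prime (2 : v.adicCompletionIntegers ℚ) := by
    have hp := PadicInt.prime_p (p := (primesEquiv v).1)
    rw [← MulEquiv.prime_iff (adicCompletionIntegers.padicIntEquiv v).symm] at hp
    rw [map_natCast, hv] at hp
    exact_mod_cast hp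
  rw [curveE32_baseChange, localPolynomial_eq_one _ _ (curveModel_j _) h2]

end LocalRat

/-! ### Coefficients of an Euler product at prime powers -/

section EulerProductCoefficients

open ArithmeticFunction

/-- Allows the Euler factors at other primes to be discarded when a product is evaluated at a prime
power. -/
theorem ArithmeticFunction.mul_apply_of_forall_dvd {R : Type*} [CommSemiring R]
    (f g : ArithmeticFunction R) (n : ℕ) (h1 : f 1 = 1) (h : ∀ a, a ∣ n → a ≠ 1 → f a = 0) :
    (f * g) n = g n := by
  rcases eq_or_ne n 0 with rfl | hn
  · simp
  rw [mul_apply, Finset.sum_eq_single (1, n)]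
  · rw [h1, one_mul]
  · rintro ⟨a, b⟩ hab hne
    obtain ⟨rfl, -⟩ := Nat.mem_divisorsAntidiagonal.mp hab
    have ha : a ≠ 1 := by rintro rfl; simp at hne
    rw [h a (dvd_mul_right a b) ha, zero_mul]
  · intro h'
    exact absurd (Nat.mem_divisorsAntidiagonal.mpr ⟨one_mul n, hn⟩) h'

/-- The value of an Euler product at a prime power. -/
theorem ArithmeticFunction.eulerProduct_apply_prime_pow {ι R : Type*} [CommSemiring R]
    (q : ι → ℕ) (hq : ∀ i, (q i).Prime) (hinj : Function.Injective q) (f : ι → PowerSeries R)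
    (hf : ∀ i, (f i).constantCoeff = 1) (i : ι) (k : ℕ) :
    eulerProduct (fun i => ofPowerSeries (q i) (f i)) (q i ^ k) = (f i).coeff k := by
  classical
  have hN : Northcott q := ⟨fun b => Set.Finite.of_finite_image
    ((Set.finite_Iic b).subset (by rintro _ ⟨j, hj, rfl⟩; exact hj)) hinj.injOn⟩
  have hF : ∀ j, j ≠ i → ∀ a, a ∣ q i ^ k → a ≠ 1 → ofPowerSeries (q j) (f j) a = 0 := by
    intro j hj a ha ha1
    rw [ofPowerSeries_apply (hq j).one_lt, Function.extend_apply', Pi.zero_apply]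
    rintro ⟨m, rfl⟩
    have hm : m ≠ 0 := by rintro rfl; exact ha1 (pow_zero _)
    have hd : q j ∣ q i := (hq j).dvd_of_dvd_pow ((dvd_pow_self _ hm).trans ha)
    exact hj (hinj ((Nat.prime_dvd_prime_iff_eq (hq j) (hq i)).mp hd))
  have key : ∀ (s : Finset ι), i ∉ s → ∀ G : ArithmeticFunction R,
      ((∏ j ∈ s, ofPowerSeries (q j) (f j)) * G) (q i ^ k) = G (q i ^ k) := by
    intro s
    induction s using Finset.induction_on with
    | empty => intro _ G; simp
    | insert j s hjs ih =>
      intro hi G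
      rw [Finset.mem_insert, not_or] at hi
      rw [Finset.prod_insert hjs, mul_assoc, mul_apply_of_forall_dvd, ih hi.2]
      · rw [ofPowerSeries_apply_one, hf]
      · exact hF j (Ne.symm hi.1)
  -- At a fixed argument the finite partial products are eventually constant; a large enough finite
  -- set containing `i` is reduced by `key` to the single factor at `i`.
  obtain ⟨s, hs⟩ := Filter.eventually_atTop.mp
    (tendsTo_eulerProduct_ofPowerSeries q f hf (q i ^ k))
  have h := hs (insert i s) (Finset.subset_insert i s)
  rw [← h, ← Finset.prod_erase_mul _ _ (Finset.mem_insert_self i s),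
    key _ (Finset.notMem_erase i _), ofPowerSeries_apply_pow (hq i).one_lt]

end EulerProductCoefficients

/-! ### Hecke recurrences for the L-function coefficients -/

section Recurrence

open IsDedekindDomain NumberField IsLocalRing Rat.HeightOneSpectrum ArithmeticFunction

/-- The local power series of the curve at a place of `ℚ`. -/
noncomputable def eulerSeriesE32 (v : HeightOneSpectrum (𝓞 ℚ)) : PowerSeries ℤ :=
  (curveE32.baseChange (v.adicCompletion ℚ)).localPowerSeries (v.adicCompletionIntegers ℚ)

theorem constantCoeff_eulerSeriesE32 (v : HeightOneSpectrum (𝓞 ℚ)) :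
    (eulerSeriesE32 v).constantCoeff = 1 := by
  simp [eulerSeriesE32, localPowerSeries, PowerSeries.constantCoeff_invOfUnit]

theorem LFunction_curveE32_eq :
    curveE32.LFunction =
      eulerProduct (fun v => ofPowerSeries ((primesEquiv (R := 𝓞 ℚ) v).1) (eulerSeriesE32 v)) := by
  rw [LFunction]
  congr 1
  ext1 v
  rw [localEulerFactor, card_residueFieldRat, eulerSeriesE32]

theorem LFunction_curveE32_prime_pow (v : HeightOneSpectrum (𝓞 ℚ)) (k : ℕ) :
    curveE32.LFunction ((primesEquiv v).1 ^ k) = (eulerSeriesE32 v).coeff k := by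
  rw [LFunction_curveE32_eq]
  exact eulerProduct_apply_prime_pow (fun v => (primesEquiv (R := 𝓞 ℚ) v).1)
    (fun v => (primesEquiv v).2) (Subtype.val_injective.comp primesEquiv.injective) eulerSeriesE32
    constantCoeff_eulerSeriesE32 v k

theorem isMultiplicative_LFunction_curveE32 : IsMultiplicative curveE32.LFunction := by
  rw [LFunction_curveE32_eq]
  exact isMultiplicative_eulerProduct _ fun v => isMultiplicative_ofPowerSeries_of_isPrimePow _
    (primesEquiv v).2.isPrimePow _ (constantCoeff_eulerSeriesE32 v)

theorem coeff_eulerSeriesE32_of_eq_two (v : HeightOneSpectrum (𝓞 ℚ)) (hv : (primesEquiv v).1 = 2)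
    (k : ℕ) : (eulerSeriesE32 v).coeff (k + 1) = 0 := by
  have h : eulerSeriesE32 v = 1 := by
    have := PowerSeries.mul_invOfUnit (1 : PowerSeries ℤ) 1 (by simp)
    rw [one_mul] at this
    rw [eulerSeriesE32, localPowerSeries, localPolynomial_curveE32_of_eq_two v hv,
      Polynomial.coe_one, this]
  rw [h, PowerSeries.coeff_one, if_neg (Nat.succ_ne_zero k)]

/-- The series is the inverse of 1 - aX + pX², so the recurrence is read off by comparing
coefficients in the product, which is 1. -/
theorem coeff_eulerSeriesE32_of_ne_two (v : HeightOneSpectrum (𝓞 ℚ)) (hv : (primesEquiv v).1 ≠ 2) :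
    (eulerSeriesE32 v).coeff 1 = frobeniusTrace (primesEquiv v).1 ∧
      ∀ k, (eulerSeriesE32 v).coeff (k + 2) =
        frobeniusTrace (primesEquiv v).1 * (eulerSeriesE32 v).coeff (k + 1) -
          (primesEquiv v).1 * (eulerSeriesE32 v).coeff k := by
  set a := frobeniusTrace (primesEquiv v).1
  set p : ℤ := ((primesEquiv v).1 : ℤ)
  have h0 := constantCoeff_eulerSeriesE32 v
  have h : (1 - PowerSeries.C a * PowerSeries.X + PowerSeries.C p * PowerSeries.X ^ 2) *
      eulerSeriesE32 v = 1 := by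
    have h1 := PowerSeries.mul_invOfUnit
      ((1 - Polynomial.C a * Polynomial.X + Polynomial.C p * Polynomial.X ^ 2 : Polynomial ℤ) :
        PowerSeries ℤ) 1 (by simp)
    refine Eq.trans ?_ h1
    rw [eulerSeriesE32, localPowerSeries, localPolynomial_curveE32_of_ne_two v hv]
    congr 1
    simp only [Polynomial.coe_add, Polynomial.coe_sub, Polynomial.coe_mul, Polynomial.coe_pow,
      Polynomial.coe_X, Polynomial.coe_C, Polynomial.coe_one]
  have h' : eulerSeriesE32 v = 1 + PowerSeries.X * (PowerSeries.C a * eulerSeriesE32 v) -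
      PowerSeries.X ^ 2 * (PowerSeries.C p * eulerSeriesE32 v) := by
    linear_combination h
  constructor
  · have := congrArg (PowerSeries.coeff 1) h'
    rw [map_sub, map_add, PowerSeries.coeff_one, PowerSeries.coeff_X_pow_mul',
      show (1 : ℕ) = 0 + 1 from rfl, PowerSeries.coeff_succ_X_mul, PowerSeries.coeff_C_mul] at this
    simpa [h0] using this
  · intro k
    have := congrArg (PowerSeries.coeff (k + 2)) h'
    rw [map_sub, map_add, PowerSeries.coeff_one, PowerSeries.coeff_X_pow_mul,
      PowerSeries.coeff_C_mul, show k + 2 = (k + 1) + 1 from rfl, PowerSeries.coeff_succ_X_mul,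
      PowerSeries.coeff_C_mul] at this
    simpa using this

theorem LFunction_curveE32_two_mul (n : ℕ) : curveE32.LFunction (2 * n) = 0 := by
  rcases eq_or_ne n 0 with rfl | hn
  · simp
  obtain ⟨k, m, hm, rfl⟩ := Nat.exists_eq_pow_mul_and_not_dvd hn 2 (by norm_num)
  set v := (primesEquiv (R := 𝓞 ℚ)).symm ⟨2, Nat.prime_two⟩ with hv
  have hv2 : (primesEquiv v).1 = 2 :=
    congrArg Subtype.val (primesEquiv.apply_symm_apply _)
  have h := LFunction_curveE32_prime_pow v (k + 1)
  rw [hv2, coeff_eulerSeriesE32_of_eq_two v hv2] at h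
  rw [← mul_assoc, ← pow_succ', isMultiplicative_LFunction_curveE32.map_mul_of_coprime, h, zero_mul]
  exact Nat.Coprime.pow_left _ ((Nat.Prime.coprime_iff_not_dvd Nat.prime_two).mpr hm)

/-- The Hecke recurrence for the coefficients of the `L`-function at odd primes. -/
theorem LFunction_curveE32_prime_mul {p : ℕ} (hp : p.Prime) (hp2 : p ≠ 2) (n : ℕ) :
    curveE32.LFunction (p * n) = frobeniusTrace p * curveE32.LFunction n -
      p * (if p ∣ n then curveE32.LFunction (n / p) else 0) := by
  rcases eq_or_ne n 0 with rfl | hn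
  · simp
  obtain ⟨k, m, hm, rfl⟩ := Nat.exists_eq_pow_mul_and_not_dvd hn p hp.ne_one
  set v := (primesEquiv (R := 𝓞 ℚ)).symm ⟨p, hp⟩ with hv
  have hvp : (primesEquiv v).1 = p :=
    congrArg Subtype.val (primesEquiv.apply_symm_apply _)
  have hpow := LFunction_curveE32_prime_pow v
  obtain ⟨h1, hrec⟩ := coeff_eulerSeriesE32_of_ne_two v (by rwa [hvp])
  rw [hvp] at hpow h1 hrec
  have hcop : ∀ j, curveE32.LFunction (p ^ j * m) =
      (eulerSeriesE32 v).coeff j * curveE32.LFunction m := fun j => by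
    rw [isMultiplicative_LFunction_curveE32.map_mul_of_coprime, hpow]
    exact Nat.Coprime.pow_left _ ((Nat.Prime.coprime_iff_not_dvd hp).mpr hm)
  rw [← mul_assoc, ← pow_succ', hcop, hcop]
  rcases k with _ | k
  · rw [pow_zero, one_mul, if_neg hm, h1, PowerSeries.coeff_zero_eq_constantCoeff,
      constantCoeff_eulerSeriesE32]
    ring
  · rw [if_pos (Dvd.dvd.mul_right (dvd_pow_self p (Nat.succ_ne_zero k)) m), pow_succ', mul_assoc,
      Nat.mul_div_cancel_left _ hp.pos, hcop, hrec]
    ring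

end Recurrence

/-! ### Frobenius traces as quadratic character sums -/

section FrobeniusTrace

variable {p : ℕ} [Fact p.Prime]

theorem ringChar_zmod_ne_two (hp : p ≠ 2) : ringChar (ZMod p) ≠ 2 := by
  rwa [ZMod.ringChar_zmod_n]

/-- The trace of Frobenius as a character sum. -/
theorem frobeniusTrace_eq_neg_sum (hp : p ≠ 2) :
    frobeniusTrace p = -∑ x : ZMod p, quadraticChar (ZMod p) (x ^ 3 + 4 * x) := by
  have hF := ringChar_zmod_ne_two hp
  have h2 : (2 : ZMod p) ≠ 0 := Ring.two_ne_zero hF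
  have hΔ : (curveModel (ZMod p)).Δ ≠ 0 := by
    rw [curveModel_Δ]; exact neg_ne_zero.mpr (pow_ne_zero _ h2)
  have hcard : Nat.card (curveModel (ZMod p)).toAffine.Point =
      (∑ x : ZMod p, ({y | y ^ 2 = x ^ 3 + 4 * x} : Set (ZMod p)).toFinset.card) + 1 := by
    rw [Nat.card_congr ((curveModel (ZMod p)).pointEquivOption hΔ), Finite.card_option]
    congr 1
    have e : {xy : ZMod p × ZMod p // (curveModel (ZMod p)).toAffine.Equation xy.1 xy.2} ≃
        Σ x : ZMod p, ({y | y ^ 2 = x ^ 3 + 4 * x} : Set (ZMod p)) :=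
      { toFun := fun xy => ⟨xy.1.1, xy.1.2, by
          simpa [Affine.equation_iff, curveModel] using xy.2⟩
        invFun := fun s => ⟨(s.1, s.2.1), by
          have h : (s.2 : ZMod p) ^ 2 = s.1 ^ 3 + 4 * s.1 := s.2.2
          simpa [Affine.equation_iff, curveModel] using h⟩
        left_inv := fun _ => rfl
        right_inv := fun _ => rfl }
    rw [Nat.card_congr e, Nat.card_sigma]
    refine Finset.sum_congr rfl fun x _ => ?_
    rw [Set.toFinset_card, Nat.card_eq_fintype_card]
  have hsum : ((∑ x : ZMod p, ({y | y ^ 2 = x ^ 3 + 4 * x} : Set (ZMod p)).toFinset.card : ℕ) : ℤ) =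
      ∑ x : ZMod p, quadraticChar (ZMod p) (x ^ 3 + 4 * x) + p := by
    rw [Nat.cast_sum]
    simp_rw [quadraticChar_card_sqrts hF]
    rw [Finset.sum_add_distrib]
    simp
  rw [frobeniusTrace, hcard, Nat.cast_add, hsum]
  push_cast
  ring

/-- The cubic is odd and -1 is a non-residue, so x ↦ -x changes the sign of the character sum. -/
theorem frobeniusTrace_of_mod_four_eq_three (hp : p % 4 = 3) : frobeniusTrace p = 0 := by
  have hp2 : p ≠ 2 := by rintro rfl; norm_num at hp
  have hneg : quadraticChar (ZMod p) (-1) = -1 := by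
    rw [quadraticChar_neg_one_iff_not_isSquare, ZMod.exists_sq_eq_neg_one_iff]
    omega
  rw [frobeniusTrace_eq_neg_sum hp2, neg_eq_zero]
  have h : ∑ x : ZMod p, quadraticChar (ZMod p) (x ^ 3 + 4 * x) =
      -∑ x : ZMod p, quadraticChar (ZMod p) (x ^ 3 + 4 * x) := by
    rw [← Finset.sum_neg_distrib]
    refine Fintype.sum_equiv (Equiv.neg _) _ _ fun x => ?_
    rw [Equiv.neg_apply, show (-x) ^ 3 + 4 * -x = -1 * (x ^ 3 + 4 * x) by ring, map_mul, hneg]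
    ring
  linarith

end FrobeniusTrace

/-! ### Quartic Jacobi sums in ℤ[i] -/

section GaussianCharacter

open GaussianInt

/-- A fourth root of unity has norm 1, so its conjugate is its inverse, which is its cube. -/
theorem GaussianInt.star_eq_pow_three {z : GaussianInt} (hz : z ^ 4 = 1) : star z = z ^ 3 := by
  have hn : z.norm = 1 := by
    have h4 : z.norm ^ 4 = 1 := by
      have := congrArg Zsqrtd.norm hz
      rw [show z ^ 4 = z * z * (z * z) by ring] at this
      simp only [Zsqrtd.norm_mul, Zsqrtd.norm_one] at this
      linarith [this, show z.norm ^ 4 = z.norm * z.norm * (z.norm * z.norm) by ring]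
    exact (pow_eq_one_iff_of_nonneg (GaussianInt.norm_nonneg z) (by norm_num)).mp h4
  have h := Zsqrtd.norm_eq_mul_conj z
  rw [hn, Int.cast_one] at h
  calc star z = star z * z ^ 4 := by rw [hz, mul_one]
    _ = (z * star z) * z ^ 3 := by ring
    _ = z ^ 3 := by rw [← h, one_mul]

theorem GaussianInt.eq_of_pow_four_eq_one {z : GaussianInt} (hz : z ^ 4 = 1) :
    z = 1 ∨ z = -1 ∨ z = ⟨0, 1⟩ ∨ z = ⟨0, -1⟩ := by
  have h : (z - 1) * ((z + 1) * ((z - ⟨0, 1⟩) * (z + ⟨0, 1⟩))) = 0 := by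
    have hI : (⟨0, 1⟩ : GaussianInt) ^ 2 = -1 := by decide
    linear_combination hz + (1 - z ^ 2) * hI
  rcases mul_eq_zero.mp h with h | h
  · exact Or.inl (sub_eq_zero.mp h)
  rcases mul_eq_zero.mp h with h | h
  · exact Or.inr (Or.inl (eq_neg_of_add_eq_zero_left h))
  rcases mul_eq_zero.mp h with h | h
  · exact Or.inr (Or.inr (Or.inl (sub_eq_zero.mp h)))
  · exact Or.inr (Or.inr (Or.inr (eq_neg_of_add_eq_zero_left h)))

variable {p : ℕ} [Fact p.Prime]

theorem exists_quartic_mulChar (hp : p % 4 = 1) :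
    ∃ χ : MulChar (ZMod p) GaussianInt, orderOf χ = 4 := by
  have hI : IsPrimitiveRoot (⟨0, 1⟩ : GaussianInt) 4 := by
    refine IsPrimitiveRoot.mk_of_lt _ (by norm_num) (by decide) fun l h0 h4 => ?_
    interval_cases l <;> decide
  refine MulChar.exists_mulChar_orderOf (ZMod p) ?_ hI
  rw [ZMod.card]
  omega

/-- The square of a quartic character is the quadratic character. -/
theorem sq_quartic_mulChar {χ : MulChar (ZMod p) GaussianInt} (hχ : orderOf χ = 4) (a : ZMod p) :
    (quadraticChar (ZMod p) a : GaussianInt) = χ a ^ 2 := by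
  have h4 : ∀ u : ZMod p, u ≠ 0 → χ u ^ 4 = 1 := fun u hu => by
    rw [← MulChar.pow_apply' χ (by norm_num), ← hχ, pow_orderOf_eq_one,
      MulChar.one_apply hu.isUnit]
  have hsq : ∀ u : ZMod p, u ≠ 0 → IsSquare u → χ u ^ 2 = 1 := by
    rintro _ hu ⟨r, rfl⟩
    rw [map_mul, ← h4 r (left_ne_zero_of_mul hu)]; ring
  rcases eq_or_ne a 0 with rfl | ha
  · rw [MulChar.map_zero χ]; simp
  rcases quadraticChar_dichotomy ha with h | h
  · rw [h, hsq a ha ((quadraticChar_one_iff_isSquare ha).mp h), Int.cast_one]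
  -- If `χ ^ 2` were 1 at one non-residue `a`, it would be 1 at every non-residue `u`, because `a *
  -- u` is a square; then `χ` would have order dividing 2.
  have hne : χ a ^ 2 ≠ 1 := fun h1 => by
    have h2 : χ ^ 2 = 1 := by
      rw [MulChar.eq_one_iff]
      intro u
      rw [MulChar.pow_apply' χ two_ne_zero]
      rcases quadraticChar_dichotomy u.ne_zero with hu | hu
      · exact hsq u u.ne_zero ((quadraticChar_one_iff_isSquare u.ne_zero).mp hu)
      · have hau : IsSquare (a * u) := by
          rw [← quadraticChar_one_iff_isSquare (mul_ne_zero ha u.ne_zero), map_mul, h, hu]; norm_num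
        have := hsq _ (mul_ne_zero ha u.ne_zero) hau
        rwa [map_mul, mul_pow, h1, one_mul] at this
    have := orderOf_dvd_of_pow_eq_one h2
    rw [hχ] at this
    norm_num at this
  have : (χ a ^ 2 - 1) * (χ a ^ 2 + 1) = 0 := by linear_combination h4 a ha
  rw [h, eq_neg_of_add_eq_zero_left
    ((mul_eq_zero.mp this).resolve_left (sub_ne_zero.mpr hne)), Int.cast_neg, Int.cast_one]

/-- Classical: χ, χ² and χ³ are all nontrivial, so J(χ, χ²) · J(χ⁻¹, χ⁻²) = p. After embedding in ℂ
the inverse characters are the conjugates, and the product is the norm. -/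
theorem norm_jacobiSum_quartic {χ : MulChar (ZMod p) GaussianInt} (hχ : orderOf χ = 4) :
    (jacobiSum χ (χ ^ 2)).norm = p := by
  have hinj := GaussianInt.toComplex_injective
  have hχ1 : χ ≠ 1 := by rintro rfl; simp at hχ
  have hχ2 : χ ^ 2 ≠ 1 := pow_ne_one_of_lt_orderOf two_ne_zero (by omega)
  have hχ3 : χ * χ ^ 2 ≠ 1 := by
    rw [← pow_succ']; exact pow_ne_one_of_lt_orderOf three_ne_zero (by omega)
  set c := χ.ringHomComp GaussianInt.toComplex
  set d := (χ ^ 2).ringHomComp GaussianInt.toComplex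
  have hmul := jacobiSum_mul_jacobiSum_inv (F := ZMod p) (F' := ℂ) (χ := c) (φ := d)
    (by rw [ZMod.ringChar_zmod_n, ringChar.eq_zero]; exact (Fact.out : p.Prime).ne_zero.symm)
    ((MulChar.ringHomComp_ne_one_iff hinj).mpr hχ1)
    ((MulChar.ringHomComp_ne_one_iff hinj).mpr hχ2)
    (by rw [← MulChar.ringHomComp_mul]; exact (MulChar.ringHomComp_ne_one_iff hinj).mpr hχ3)
  have hstar : jacobiSum c⁻¹ d⁻¹ = (starRingEnd ℂ) (jacobiSum c d) := by
    simp only [jacobiSum, map_sum, map_mul]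
    refine Finset.sum_congr rfl fun x _ => ?_
    rw [← MulChar.star_apply', ← MulChar.star_apply']; rfl
  rw [hstar, Complex.mul_conj, jacobiSum_ringHomComp, ← GaussianInt.intCast_complex_norm,
    ZMod.card] at hmul
  exact_mod_cast hmul

/-- Expanding ∑ (χ(x) - 1)(χ²(1 - x) - 1) gives J + p, as the character sums vanish. In each term
the first factor is divisible by 1 + i and the second by 2, and p ≡ 1 modulo 4 = (2 + 2i)(1 - i).
The sign of J is thereby fixed. -/
theorem jacobiSum_quartic_add_one {χ : MulChar (ZMod p) GaussianInt} (hp : p % 4 = 1)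
    (hχ : orderOf χ = 4) :
    (⟨2, 2⟩ : GaussianInt) ∣ -jacobiSum χ (χ ^ 2) - 1 := by
  have hχ1 : χ ≠ 1 := by rintro rfl; simp at hχ
  have hχ2 : χ ^ 2 ≠ 1 := pow_ne_one_of_lt_orderOf two_ne_zero (by omega)
  have hsum : ∑ x : ZMod p, (χ x - 1) * ((χ ^ 2) (1 - x) - 1) = jacobiSum χ (χ ^ 2) + p := by
    have h1 : ∑ x : ZMod p, (χ ^ 2) (1 - x) = 0 := by
      rw [← MulChar.sum_eq_zero_of_ne_one hχ2]
      exact Fintype.sum_equiv (Equiv.subLeft 1) _ _ fun x => rfl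
    simp only [sub_mul, mul_sub, Finset.sum_sub_distrib, one_mul, mul_one, h1,
      MulChar.sum_eq_zero_of_ne_one hχ1, jacobiSum]
    simp
  have hdvd : (⟨2, 2⟩ : GaussianInt) ∣ jacobiSum χ (χ ^ 2) + p := by
    rw [← hsum]
    refine Finset.dvd_sum fun x _ => ?_
    rcases eq_or_ne x 0 with rfl | hx
    · simp
    rcases eq_or_ne x 1 with rfl | hx1
    · simp
    have h4 : χ x ^ 4 = 1 := by
      rw [← MulChar.pow_apply' χ (by norm_num), ← hχ, pow_orderOf_eq_one,
        MulChar.one_apply hx.isUnit]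
    have hA : (⟨1, 1⟩ : GaussianInt) ∣ χ x - 1 := by
      rcases GaussianInt.eq_of_pow_four_eq_one h4 with h | h | h | h <;> rw [h]
      · simp
      · exact ⟨⟨-1, 1⟩, by decide⟩
      · exact ⟨⟨0, 1⟩, by decide⟩
      · exact ⟨⟨-1, 0⟩, by decide⟩
    have hB : (2 : GaussianInt) ∣ (χ ^ 2) (1 - x) - 1 := by
      rw [MulChar.pow_apply' χ two_ne_zero, ← sq_quartic_mulChar hχ]
      rcases quadraticChar_dichotomy (sub_ne_zero.mpr hx1.symm) with h | h <;> rw [h]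
      · simp
      · exact ⟨-1, by norm_num⟩
    rw [show (⟨2, 2⟩ : GaussianInt) = ⟨1, 1⟩ * 2 by decide]
    exact mul_dvd_mul hA hB
  obtain ⟨k, hk⟩ : ∃ k : ℕ, p = 4 * k + 1 := ⟨p / 4, by omega⟩
  have h4 : (⟨2, 2⟩ : GaussianInt) ∣ (p : GaussianInt) - 1 := by
    rw [hk]
    push_cast
    rw [add_sub_cancel_right, show (4 : GaussianInt) = ⟨2, 2⟩ * ⟨1, -1⟩ by decide, mul_assoc]
    exact dvd_mul_right _ _
  have := dvd_sub h4 hdvd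
  rwa [show (p : GaussianInt) - 1 - (jacobiSum χ (χ ^ 2) + p) = -jacobiSum χ (χ ^ 2) - 1 by ring]
    at this

/-- The Frobenius trace at a prime `p ≡ 1 mod 4` is the trace of a primary Gaussian prime. -/
theorem sum_quadraticChar_eq_jacobiSum {χ : MulChar (ZMod p) GaussianInt} (hp : p % 4 = 1)
    (hχ : orderOf χ = 4) :
    ((∑ x : ZMod p, quadraticChar (ZMod p) (x ^ 3 + 4 * x) : ℤ) : GaussianInt) =
      jacobiSum χ (χ ^ 2) + star (jacobiSum χ (χ ^ 2)) := by
  have hp2 : p ≠ 2 := by rintro rfl; norm_num at hp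
  have hF := ringChar_zmod_ne_two hp2
  have h20 : (2 : ZMod p) ≠ 0 := Ring.two_ne_zero hF
  have h4 : ∀ u : ZMod p, u ≠ 0 → χ u ^ 4 = 1 := fun u hu => by
    rw [← MulChar.pow_apply' χ (by norm_num), ← hχ, pow_orderOf_eq_one,
      MulChar.one_apply hu.isUnit]
  -- With `i` a square root of -1 modulo p, -4 = (1 + i)⁴ is a fourth power.
  have hneg4 : χ (-4) = 1 := by
    obtain ⟨i, hi⟩ := (ZMod.exists_sq_eq_neg_one_iff (p := p)).mpr (by omega)
    have h : (-4 : ZMod p) = (1 + i) ^ 4 := by linear_combination (i * i + 4 * i + 5) * hi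
    have h0 : (1 + i : ZMod p) ≠ 0 := fun h0 => by
      rw [h0] at h
      have : (2 : ZMod p) * 2 = 0 := by linear_combination -h
      exact h20 (mul_self_eq_zero.mp this)
    rw [h, map_pow, h4 _ h0]
  -- The substitution u = -4v introduces only the factors χ(-4) = 1 and χ(4)² = χ(16) = 1.
  have hscale : ∀ k : ℕ, ∑ u : ZMod p, χ u ^ k * χ (u + 4) ^ 2 =
      ∑ v : ZMod p, χ v ^ k * χ (1 - v) ^ 2 := fun k => by
    have h40 : (-4 : ZMod p) ≠ 0 := by
      rw [show (-4 : ZMod p) = -(2 * 2) by ring]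
      exact neg_ne_zero.mpr (mul_ne_zero h20 h20)
    symm
    refine Fintype.sum_equiv (Equiv.mulLeft₀ (-4) h40) _ _ fun v => ?_
    have h41 : χ 4 ^ 2 = 1 := by
      rw [← map_pow, show (4 : ZMod p) ^ 2 = -4 * -4 by ring, map_mul, hneg4, one_mul]
    rw [Equiv.mulLeft₀_apply, show -4 * v + 4 = 4 * (1 - v) by ring, map_mul, map_mul, hneg4,
      one_mul, mul_pow, h41, one_mul]
  -- Sum over the fibres of squaring: `u` has 1 + χ(u)² square roots. The two summands become J and,
  -- since conjugation cubes the values of χ, its conjugate.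
  have hfib : ∑ x : ZMod p, χ (x ^ 2) * χ (x ^ 2 + 4) ^ 2 =
      ∑ u : ZMod p, (1 + χ u ^ 2) * (χ u * χ (u + 4) ^ 2) := by
    rw [← Finset.sum_fiberwise (s := Finset.univ) (g := fun x : ZMod p => x ^ 2)]
    refine Finset.sum_congr rfl fun u _ => ?_
    have hc : ((Finset.univ.filter fun x : ZMod p => x ^ 2 = u).card : ℤ) =
        quadraticChar (ZMod p) u + 1 := by
      rw [← quadraticChar_card_sqrts hF]
      congr 2
      ext x
      simp
    rw [Finset.sum_congr rfl (g := fun _ => χ u * χ (u + 4) ^ 2) (fun x hx => by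
      rw [(Finset.mem_filter.mp hx).2]), Finset.sum_const, nsmul_eq_mul]
    congr 1
    rw [← sq_quartic_mulChar hχ, add_comm]
    exact_mod_cast congrArg (Int.cast : ℤ → GaussianInt) hc
  have hstar : star (jacobiSum χ (χ ^ 2)) = ∑ v : ZMod p, χ v ^ 3 * χ (1 - v) ^ 2 := by
    rw [jacobiSum, star_sum]
    refine Finset.sum_congr rfl fun v _ => ?_
    have hs : ∀ u : ZMod p, star (χ u) = χ u ^ 3 := fun u => by
      rcases eq_or_ne u 0 with rfl | hu
      · rw [MulChar.map_zero]; simp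
      · exact GaussianInt.star_eq_pow_three (h4 u hu)
    rw [star_mul', hs, MulChar.pow_apply' χ two_ne_zero, ← sq_quartic_mulChar hχ, star_intCast]
  rw [hstar, Int.cast_sum]
  have hJ : jacobiSum χ (χ ^ 2) = ∑ v : ZMod p, χ v ^ 1 * χ (1 - v) ^ 2 := by
    rw [jacobiSum]
    refine Finset.sum_congr rfl fun v _ => ?_
    rw [MulChar.pow_apply' χ two_ne_zero, pow_one]
  rw [hJ, ← hscale 1, ← hscale 3, ← Finset.sum_add_distrib]
  calc ∑ x : ZMod p, (quadraticChar (ZMod p) (x ^ 3 + 4 * x) : GaussianInt)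
      = ∑ x : ZMod p, χ (x ^ 2) * χ (x ^ 2 + 4) ^ 2 := by
        refine Finset.sum_congr rfl fun x _ => ?_
        rw [sq_quartic_mulChar hχ, show x ^ 3 + 4 * x = x * (x ^ 2 + 4) by ring, map_mul, mul_pow,
          map_pow]
    _ = _ := by
        rw [hfib]
        exact Finset.sum_congr rfl fun u _ => by ring

theorem exists_primary_of_mod_four_eq_one (hp : p % 4 = 1) :
    ∃ π : GaussianInt, π.norm = p ∧ (⟨2, 2⟩ : GaussianInt) ∣ π - 1 ∧
      (frobeniusTrace p : GaussianInt) = π + star π := by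
  obtain ⟨χ, hχ⟩ := exists_quartic_mulChar hp
  refine ⟨-jacobiSum χ (χ ^ 2), ?_, jacobiSum_quartic_add_one hp hχ, ?_⟩
  · rw [Zsqrtd.norm_neg, norm_jacobiSum_quartic hχ]
  · have hp2 : p ≠ 2 := by rintro rfl; norm_num at hp
    rw [frobeniusTrace_eq_neg_sum hp2, Int.cast_neg, sum_quadraticChar_eq_jacobiSum hp hχ, star_neg]
    ring

end GaussianCharacter

/-! ### Primary Gaussian integers and sums over a given norm -/

section PrimaryGaussian

open scoped Classical

namespace GaussianInt

/-- A Gaussian integer is primary if it is congruent to `1` modulo `2 + 2i`. -/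
def IsPrimary (α : GaussianInt) : Prop := (⟨2, 2⟩ : GaussianInt) ∣ α - 1

/-- These coordinates are chosen for the lattice sum: with c = 4j + 1 and d = 4l + 1 one has α = ((c
+ d) + (d - c)i)/2, of norm (c² + d²)/2. -/
theorem isPrimary_iff {α : GaussianInt} :
    α.IsPrimary ↔ ∃ j l : ℤ, α = ⟨2 * (j + l) + 1, 2 * (l - j)⟩ := by
  constructor
  · rintro ⟨⟨u, v⟩, h⟩
    rw [Zsqrtd.ext_iff] at h
    simp at h
    refine ⟨-v, u, Zsqrtd.ext ?_ ?_⟩ <;> simp <;> linarith [h.1, h.2]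
  · rintro ⟨j, l, rfl⟩
    refine ⟨⟨l, -j⟩, Zsqrtd.ext ?_ ?_⟩ <;> simp <;> ring

theorem isPrimary_one : IsPrimary 1 := by simp [IsPrimary]

theorem norm_eq (α : GaussianInt) : α.norm = α.re ^ 2 + α.im ^ 2 := by
  rw [Zsqrtd.norm_def]; ring

theorem norm_nonneg' (α : GaussianInt) : 0 ≤ α.norm := by rw [norm_eq]; positivity

theorem IsPrimary.mul {α β : GaussianInt} (hα : α.IsPrimary) (hβ : β.IsPrimary) :
    (α * β).IsPrimary := by
  have := dvd_add (hα.mul_right β) hβ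
  rwa [show (α - 1) * β + (β - 1) = α * β - 1 by ring] at this

theorem IsPrimary.of_mul_left {α β : GaussianInt} (hα : α.IsPrimary) (h : (α * β).IsPrimary) :
    β.IsPrimary := by
  have := dvd_sub h (hα.mul_right β)
  rwa [show (α * β - 1) - (α - 1) * β = β - 1 by ring] at this

theorem IsPrimary.star {α : GaussianInt} (hα : α.IsPrimary) : (star α).IsPrimary := by
  rw [isPrimary_iff] at hα ⊢
  obtain ⟨j, l, rfl⟩ := hα
  exact ⟨l, j, Zsqrtd.ext (by simp; ring) (by simp; ring)⟩

theorem IsPrimary.norm_odd {α : GaussianInt} (hα : α.IsPrimary) : Odd α.norm := by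
  obtain ⟨j, l, rfl⟩ := isPrimary_iff.mp hα
  exact ⟨2 * (j + l) ^ 2 + 2 * (j + l) + 2 * (l - j) ^ 2, by rw [norm_eq]; ring⟩

/-- Only one of the four units is primary, so primary representatives of associate classes are
unique. -/
theorem IsPrimary.eq_one_of_norm {α : GaussianInt} (hα : α.IsPrimary) (h : α.norm = 1) :
    α = 1 := by
  obtain ⟨j, l, rfl⟩ := isPrimary_iff.mp hα
  rw [norm_eq] at h
  simp only at h
  have h1 : (2 * (l - j)) ^ 2 ≤ 1 := by nlinarith [sq_nonneg (2 * (j + l) + 1)]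
  have h2 : (2 * (j + l) + 1) ^ 2 ≤ 1 := by nlinarith [sq_nonneg (2 * (l - j))]
  have h3 := abs_le.mp ((sq_le_one_iff_abs_le_one _).mp h1)
  have h4 := abs_le.mp ((sq_le_one_iff_abs_le_one _).mp h2)
  obtain rfl : j = 0 := by omega
  obtain rfl : l = 0 := by omega
  rfl

theorem prime_of_norm_prime {π : GaussianInt} {p : ℕ} (hp : p.Prime) (h : π.norm = p) :
    Prime π := by
  rw [← irreducible_iff_prime, irreducible_iff]
  constructor
  · rw [Zsqrtd.norm_eq_one_iff.symm, h]
    exact hp.ne_one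
  · rintro a b rfl
    rw [Zsqrtd.norm_mul] at h
    have h' : a.norm.natAbs * b.norm.natAbs = p := by
      rw [← Int.natAbs_mul, h]; rfl
    rw [← Zsqrtd.norm_eq_one_iff, ← Zsqrtd.norm_eq_one_iff]
    rcases (Nat.prime_mul_iff.mp (h' ▸ hp)) with h1 | h1
    · exact Or.inr h1.2
    · exact Or.inl h1.2

theorem star_dvd_star {a b : GaussianInt} (h : a ∣ b) : star a ∣ star b := by
  obtain ⟨c, rfl⟩ := h
  exact ⟨star c, by rw [star_mul, mul_comm]⟩

theorem finite_setOf_norm_eq (n : ℕ) : {α : GaussianInt | α.norm = n}.Finite := by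
  have hf : ((Set.Icc (-(n : ℤ)) n) ×ˢ (Set.Icc (-(n : ℤ)) n)).Finite :=
    (Set.finite_Icc _ _).prod (Set.finite_Icc _ _)
  refine (hf.image fun xy => (⟨xy.1, xy.2⟩ : GaussianInt)).subset fun α hα => ?_
  have h : α.re ^ 2 + α.im ^ 2 = n := by rw [← norm_eq]; exact hα
  refine ⟨(α.re, α.im), ⟨⟨?_, ?_⟩, ?_, ?_⟩, rfl⟩ <;> simp only <;>
    nlinarith [sq_nonneg α.re, sq_nonneg α.im, Int.le_self_sq α.re, Int.le_self_sq α.im,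
      Int.le_self_sq (-α.re), Int.le_self_sq (-α.im)]

/-- The primary Gaussian integers of norm `n`. -/
noncomputable def primaryOfNorm (n : ℕ) : Finset GaussianInt :=
  ((finite_setOf_norm_eq n).subset (t := {α : GaussianInt | α.norm = n ∧ α.IsPrimary}) fun _ h => h.1).toFinset

@[simp]
theorem mem_primaryOfNorm {n : ℕ} {α : GaussianInt} :
    α ∈ primaryOfNorm n ↔ α.norm = n ∧ α.IsPrimary := by
  simp [primaryOfNorm]

theorem primaryOfNorm_one : primaryOfNorm 1 = {1} := by
  ext α
  rw [mem_primaryOfNorm, Finset.mem_singleton]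
  constructor
  · rintro ⟨h, h'⟩; exact h'.eq_one_of_norm (by simpa using h)
  · rintro rfl; exact ⟨by simp, isPrimary_one⟩

theorem primaryOfNorm_two_mul (n : ℕ) : primaryOfNorm (2 * n) = ∅ := by
  refine Finset.eq_empty_of_forall_notMem fun α hα => ?_
  rw [mem_primaryOfNorm] at hα
  have := hα.2.norm_odd
  rw [hα.1, Nat.cast_mul, Nat.cast_two, ← Int.not_even_iff_odd] at this
  exact this (even_two_mul _)

/-- For an inert prime the primary associate is -p rather than p; this is the source of the minus
sign in the recurrence at such primes. -/
theorem isPrimary_neg_natCast {p : ℕ} (hp : p % 4 = 3) : IsPrimary (-p : GaussianInt) := by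
  rw [isPrimary_iff]
  exact ⟨-(p / 4 + 1), -(p / 4 + 1), Zsqrtd.ext (by simp; omega) (by simp)⟩

theorem norm_natCast' (p : ℕ) : (p : GaussianInt).norm = p * p := Zsqrtd.norm_natCast p

theorem sum_image_mul_left {q : GaussianInt} (hq : q ≠ 0) (s : Finset GaussianInt) :
    ∑ α ∈ s.image (q * ·), α = q * ∑ α ∈ s, α := by
  rw [Finset.sum_image fun _ _ _ _ h => mul_left_cancel₀ hq h, Finset.mul_sum]

/-- The elements of norm `p n` divisible by `q = ± p`. -/
theorem filter_dvd_primaryOfNorm_mul {p : ℕ} (hp : p ≠ 0) {q : GaussianInt} (hq : q.IsPrimary)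
    (hqp : q.norm = p * p) (n : ℕ) :
    (primaryOfNorm (p * n)).filter (q ∣ ·) =
      if p ∣ n then (primaryOfNorm (n / p)).image (q * ·) else ∅ := by
  have hp' : (p : ℤ) ≠ 0 := by exact_mod_cast hp
  ext α
  rw [Finset.mem_filter, mem_primaryOfNorm]
  split_ifs with hn
  · obtain ⟨m, rfl⟩ := hn
    rw [Nat.mul_div_cancel_left m (Nat.pos_of_ne_zero hp), Finset.mem_image]
    constructor
    · rintro ⟨⟨h1, h2⟩, β, rfl⟩
      refine ⟨β, mem_primaryOfNorm.mpr ⟨?_, hq.of_mul_left h2⟩, rfl⟩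
      rw [Zsqrtd.norm_mul, hqp] at h1
      refine mul_left_cancel₀ (mul_ne_zero hp' hp') ?_
      rw [h1]; push_cast; ring
    · rintro ⟨β, hβ, rfl⟩
      rw [mem_primaryOfNorm] at hβ
      refine ⟨⟨?_, hq.mul hβ.2⟩, dvd_mul_right _ _⟩
      rw [Zsqrtd.norm_mul, hqp, hβ.1]; push_cast; ring
  · simp only [Finset.notMem_empty, iff_false]
    rintro ⟨⟨h1, h2⟩, β, rfl⟩
    rw [Zsqrtd.norm_mul, hqp, Nat.cast_mul, mul_assoc] at h1
    exact hn (Int.natCast_dvd_natCast.mp ⟨_, (mul_left_cancel₀ hp' h1).symm⟩)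

theorem filter_dvd_primaryOfNorm_mul' {p : ℕ} (hp : p ≠ 0) {q : GaussianInt} (hq : q.IsPrimary)
    (hqp : q.norm = p) (n : ℕ) :
    (primaryOfNorm (p * n)).filter (q ∣ ·) = (primaryOfNorm n).image (q * ·) := by
  have hp' : (p : ℤ) ≠ 0 := by exact_mod_cast hp
  ext α
  rw [Finset.mem_filter, mem_primaryOfNorm, Finset.mem_image]
  constructor
  · rintro ⟨⟨h1, h2⟩, β, rfl⟩
    refine ⟨β, mem_primaryOfNorm.mpr ⟨?_, hq.of_mul_left h2⟩, rfl⟩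
    rw [Zsqrtd.norm_mul, hqp, Nat.cast_mul] at h1
    exact mul_left_cancel₀ hp' h1
  · rintro ⟨β, hβ, rfl⟩
    rw [mem_primaryOfNorm] at hβ
    refine ⟨⟨?_, hq.mul hβ.2⟩, dvd_mul_right _ _⟩
    rw [Zsqrtd.norm_mul, hqp, hβ.1]; push_cast; ring

/-- Since p stays prime in ℤ[i] and divides αᾱ, it divides α or ᾱ, hence α. Every element of the sum
is therefore -p times a primary element. -/
theorem sum_primaryOfNorm_of_mod_four_eq_three {p : ℕ} [Fact p.Prime] (hp : p % 4 = 3) (n : ℕ) :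
    ∑ α ∈ primaryOfNorm (p * n), α =
      -p * (if p ∣ n then ∑ α ∈ primaryOfNorm (n / p), α else 0) := by
  have hpp := prime_of_nat_prime_of_mod_four_eq_three p hp
  have hp0 : p ≠ 0 := (Fact.out : p.Prime).ne_zero
  have hall : (primaryOfNorm (p * n)).filter ((-p : GaussianInt) ∣ ·) = primaryOfNorm (p * n) := by
    refine Finset.filter_true_of_mem fun α hα => ?_
    rw [mem_primaryOfNorm] at hα
    have hd : (p : GaussianInt) ∣ α * star α := by
      rw [← Zsqrtd.norm_eq_mul_conj, hα.1]
      exact ⟨n, by push_cast; ring⟩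
    rw [neg_dvd]
    rcases hpp.dvd_or_dvd hd with h | h
    · exact h
    · simpa using star_dvd_star h
  rw [← hall, filter_dvd_primaryOfNorm_mul hp0 (isPrimary_neg_natCast hp)
    (by rw [Zsqrtd.norm_neg, norm_natCast'])]
  split_ifs
  · rw [sum_image_mul_left (neg_ne_zero.mpr (Nat.cast_ne_zero.mpr hp0))]
  · simp

/-- Inclusion-exclusion: p divides the norm of α, so π or π̄ divides α, and both do exactly when p
does, because π and π̄ are non-associate primes. -/
theorem sum_primaryOfNorm_of_norm_eq {p : ℕ} (hp : p.Prime) {π : GaussianInt}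
    (hπ : π.norm = p) (hπ' : π.IsPrimary) (n : ℕ) :
    ∑ α ∈ primaryOfNorm (p * n), α = (π + star π) * ∑ α ∈ primaryOfNorm n, α -
      p * (if p ∣ n then ∑ α ∈ primaryOfNorm (n / p), α else 0) := by
  have hp0 : p ≠ 0 := hp.ne_zero
  have hpr := prime_of_norm_prime hp hπ
  have hsn : (star π).norm = p := by rw [Zsqrtd.norm_conj, hπ]
  have hprs := prime_of_norm_prime hp hsn
  have hpp : π * star π = p := by rw [← Zsqrtd.norm_eq_mul_conj, hπ]; simp
  have hP : IsPrimary (p : GaussianInt) := by rw [← hpp]; exact hπ'.mul hπ'.star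
  -- The cofactor would be primary of norm 1, hence 1; then π would be a rational integer and p a
  -- square.
  have hndvd : ¬ star π ∣ π := by
    rintro ⟨u, hu⟩
    have hu1 : u.IsPrimary := hπ'.star.of_mul_left (hu ▸ hπ')
    have hun : u.norm = 1 := by
      have := congrArg Zsqrtd.norm hu
      rw [Zsqrtd.norm_mul, hsn, hπ] at this
      exact (mul_eq_left₀ (by exact_mod_cast hp0)).mp this.symm
    rw [hu1.eq_one_of_norm hun, mul_one] at hu
    have him : π.im = 0 := by
      have := congrArg Zsqrtd.im hu
      simp at this
      omega
    rw [norm_eq, him] at hπ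
    have : IsSquare (p : ℤ) := ⟨π.re, by rw [← hπ]; ring⟩
    exact hp.prime.irreducible.not_isSquare (Int.isSquare_natCast_iff.mp this)
  set s := primaryOfNorm (p * n)
  have hunion : s.filter (π ∣ ·) ∪ s.filter (star π ∣ ·) = s := by
    rw [← Finset.filter_or]
    refine Finset.filter_true_of_mem fun α hα => ?_
    rw [mem_primaryOfNorm] at hα
    have hd : π ∣ α * star α := by
      rw [← Zsqrtd.norm_eq_mul_conj, hα.1]
      exact ⟨star π * n, by rw [← mul_assoc, hpp]; push_cast; ring⟩
    rcases hpr.dvd_or_dvd hd with h | h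
    · exact Or.inl h
    · exact Or.inr (by simpa using star_dvd_star h)
  have hinter : s.filter (π ∣ ·) ∩ s.filter (star π ∣ ·) = s.filter ((p : GaussianInt) ∣ ·) := by
    rw [← Finset.filter_and]
    refine Finset.filter_congr fun α _ => ⟨?_, fun h => ?_⟩
    · rintro ⟨⟨β, rfl⟩, h⟩
      rw [← hpp]
      exact mul_dvd_mul_left _ ((hprs.dvd_or_dvd h).resolve_left hndvd)
    · rw [← hpp] at h
      exact ⟨(dvd_mul_right _ _).trans h, (dvd_mul_left _ _).trans h⟩
  have key := Finset.sum_union_inter (s₁ := s.filter (π ∣ ·)) (s₂ := s.filter (star π ∣ ·))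
    (f := fun α => α)
  rw [hunion, hinter, filter_dvd_primaryOfNorm_mul hp0 hP (norm_natCast' p),
    filter_dvd_primaryOfNorm_mul' hp0 hπ' hπ, filter_dvd_primaryOfNorm_mul' hp0 hπ'.star hsn,
    sum_image_mul_left hpr.ne_zero, sum_image_mul_left hprs.ne_zero] at key
  rw [eq_sub_iff_add_eq, add_mul, ← key]
  split_ifs
  · rw [sum_image_mul_left (Nat.cast_ne_zero.mpr hp0)]
  · simp

end GaussianInt

open GaussianInt

/-- The coefficients of `L(E₃₂, s)` are sums of primary Gaussian integers. -/
theorem LFunction_curveE32_eq_sum_primary (n : ℕ) :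
    (curveE32.LFunction n : GaussianInt) = ∑ α ∈ primaryOfNorm n, α := by
  induction n using Nat.strong_induction_on with
  | _ n ih =>
  rcases Nat.lt_or_ge n 2 with hn | hn
  · interval_cases n
    · rw [ArithmeticFunction.map_zero, Int.cast_zero, ← Nat.mul_zero 2, primaryOfNorm_two_mul,
        Finset.sum_empty]
    · rw [isMultiplicative_LFunction_curveE32.map_one, primaryOfNorm_one, Finset.sum_singleton,
        Int.cast_one]
  -- Both sides vanish at even arguments and obey the same recurrence at each odd prime p, so the
  -- values at m and m / p determine the value at p * m.
  obtain ⟨p, hp, m, rfl⟩ := Nat.exists_prime_and_dvd (n := n) (by omega)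
  have := Fact.mk hp
  have hm : 0 < m := Nat.pos_of_ne_zero fun h => by simp [h] at hn
  have hlt : m < p * m := lt_mul_of_one_lt_left hm hp.one_lt
  rcases hp.eq_two_or_odd with rfl | hodd
  · rw [LFunction_curveE32_two_mul, primaryOfNorm_two_mul, Int.cast_zero, Finset.sum_empty]
  have hp2 : p ≠ 2 := by rintro rfl; norm_num at hodd
  have hdiv : ((if p ∣ m then curveE32.LFunction (m / p) else 0 : ℤ) : GaussianInt) =
      if p ∣ m then ∑ α ∈ primaryOfNorm (m / p), α else 0 := by
    split_ifs
    · exact ih _ ((Nat.div_le_self m p).trans_lt hlt)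
    · exact Int.cast_zero
  rw [LFunction_curveE32_prime_mul hp hp2, Int.cast_sub, Int.cast_mul, Int.cast_mul, hdiv,
    ih m hlt, Int.cast_natCast]
  rcases (show p % 4 = 1 ∨ p % 4 = 3 by omega) with h4 | h4
  · obtain ⟨π, h1, h2, h3⟩ := exists_primary_of_mod_four_eq_one h4
    rw [h3, sum_primaryOfNorm_of_norm_eq hp h1 h2]
  · rw [frobeniusTrace_of_mod_four_eq_three h4, sum_primaryOfNorm_of_mod_four_eq_three h4]
    rw [Int.cast_zero, zero_mul, zero_sub, neg_mul]

end PrimaryGaussian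

/-! ### The L-value as a lattice sum -/

section LatticeSum

open GaussianInt

/-- The lattice summand `d / (c² + d²)²` with `c = 4 j + 1`, `d = 4 l + 1`. -/
noncomputable def latticeTerm (x : ℤ × ℤ) : ℝ :=
  (4 * x.2 + 1) / ((4 * x.1 + 1 : ℝ) ^ 2 + (4 * x.2 + 1) ^ 2) ^ 2

theorem four_mul_add_one_ne_zero (j : ℤ) : (4 * j + 1 : ℝ) ≠ 0 := by
  have : (4 * j + 1 : ℤ) ≠ 0 := by omega
  exact_mod_cast this

/-- The terms are at most the inverse cube of the sup norm of the vector (4j + 1, 4l + 1), and the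
sum of these over a two-dimensional lattice converges. -/
theorem summable_latticeTerm : Summable latticeTerm := by
  have hinj : Function.Injective fun x : ℤ × ℤ => ![4 * x.1 + 1, 4 * x.2 + 1] := by
    intro x y h
    have h0 := congrFun h 0
    have h1 := congrFun h 1
    simp at h0 h1
    exact Prod.ext h0 h1
  have hs := (EisensteinSeries.summable_one_div_norm_rpow (k := 3) (by norm_num)).comp_injective hinj
  refine Summable.of_norm_bounded hs fun x => ?_
  set v : Fin 2 → ℤ := ![4 * x.1 + 1, 4 * x.2 + 1] with hv
  have e0 : ‖((4 * x.1 + 1 : ℤ))‖ ≤ ‖v‖ := norm_le_pi_norm v 0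
  have e1 : ‖((4 * x.2 + 1 : ℤ))‖ ≤ ‖v‖ := norm_le_pi_norm v 1
  have e2 : ‖v‖ ^ 2 ≤ (4 * x.1 + 1 : ℝ) ^ 2 + (4 * x.2 + 1) ^ 2 := by
    have h : ‖v‖ ≤ √((4 * x.1 + 1 : ℝ) ^ 2 + (4 * x.2 + 1) ^ 2) := by
      refine (pi_norm_le_iff_of_nonneg (Real.sqrt_nonneg _)).mpr fun i => ?_
      fin_cases i
      · simp only [hv, Fin.zero_eta, Matrix.cons_val_zero, Int.norm_eq_abs]
        push_cast
        exact Real.abs_le_sqrt (by nlinarith [sq_nonneg (4 * x.2 + 1 : ℝ)])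
      · simp only [hv, Fin.mk_one, Matrix.cons_val_one, Matrix.cons_val_fin_one, Int.norm_eq_abs]
        push_cast
        exact Real.abs_le_sqrt (by nlinarith [sq_nonneg (4 * x.1 + 1 : ℝ)])
    calc ‖v‖ ^ 2 ≤ √((4 * x.1 + 1 : ℝ) ^ 2 + (4 * x.2 + 1) ^ 2) ^ 2 := by gcongr
      _ = _ := Real.sq_sqrt (by positivity)
  have hpos : 0 < ‖v‖ := by
    refine lt_of_lt_of_le ?_ e0
    rw [norm_pos_iff]; omega
  simp only [Function.comp_apply]
  rw [latticeTerm, norm_div, norm_pow, Real.norm_of_nonneg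
    (show (0 : ℝ) ≤ (4 * x.1 + 1 : ℝ) ^ 2 + (4 * x.2 + 1) ^ 2 by positivity)]
  have e1' : ‖(4 * x.2 + 1 : ℝ)‖ ≤ ‖v‖ := by
    rw [Int.norm_eq_abs] at e1
    push_cast at e1
    exact e1
  calc ‖(4 * x.2 + 1 : ℝ)‖ / ((4 * x.1 + 1 : ℝ) ^ 2 + (4 * x.2 + 1) ^ 2) ^ 2
      ≤ ‖v‖ / (‖v‖ ^ 2) ^ 2 := by gcongr
    _ = ‖v‖ ^ (-3 : ℝ) := by
        rw [Real.rpow_neg hpos.le, show (3 : ℝ) = (3 : ℕ) by norm_num, Real.rpow_natCast]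
        field_simp

/-- The parametrization of primary Gaussian integers by pairs of integers. -/
def primaryOfPair (x : ℤ × ℤ) : GaussianInt := ⟨2 * (x.1 + x.2) + 1, 2 * (x.2 - x.1)⟩

theorem primaryOfPair_injective : Function.Injective primaryOfPair := by
  intro x y h
  rw [primaryOfPair, primaryOfPair, Zsqrtd.ext_iff] at h
  simp only at h
  exact Prod.ext (by omega) (by omega)

theorem primaryOfPair_isPrimary (x : ℤ × ℤ) : (primaryOfPair x).IsPrimary :=
  isPrimary_iff.mpr ⟨x.1, x.2, rfl⟩

theorem norm_primaryOfPair (x : ℤ × ℤ) :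
    ((primaryOfPair x).norm : ℝ) = ((4 * x.1 + 1 : ℝ) ^ 2 + (4 * x.2 + 1) ^ 2) / 2 := by
  rw [norm_eq, primaryOfPair]; push_cast; ring

/-- Exchanging the two coordinates swaps the two terms, so after summation the coefficients add up
to 4 and the imaginary parts cancel. -/
theorem toComplex_primaryOfPair_div (x : ℤ × ℤ) :
    ((primaryOfPair x : GaussianInt) : ℂ) / ((primaryOfPair x).norm : ℂ) ^ 2 =
      (2 - 2 * Complex.I) * (latticeTerm x.swap : ℂ) +
        (2 + 2 * Complex.I) * (latticeTerm x : ℂ) := by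
  have hn : ((primaryOfPair x).norm : ℂ) =
      ((((4 * x.1 + 1 : ℝ) ^ 2 + (4 * x.2 + 1) ^ 2) / 2 : ℝ) : ℂ) := by
    rw [← norm_primaryOfPair]; norm_cast
  have h0 : (((4 * x.1 + 1 : ℂ) ^ 2 + (4 * x.2 + 1) ^ 2)) ≠ 0 := by
    have : ((4 * x.1 + 1 : ℝ) ^ 2 + (4 * x.2 + 1) ^ 2) ≠ 0 := by
      have := four_mul_add_one_ne_zero x.1
      positivity
    exact_mod_cast this
  rw [hn, latticeTerm, latticeTerm, toComplex_def, primaryOfPair, Prod.fst_swap, Prod.snd_swap,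
    add_comm ((4 * (x.2 : ℝ) + 1) ^ 2)]
  push_cast
  field_simp
  ring

theorem hasSum_toComplex_primaryOfPair :
    HasSum (fun x => ((primaryOfPair x : GaussianInt) : ℂ) / ((primaryOfPair x).norm : ℂ) ^ 2)
      ((4 * ∑' x, latticeTerm x : ℝ) : ℂ) := by
  have h1 : HasSum (fun x => (latticeTerm x : ℂ)) ((∑' x, latticeTerm x : ℝ) : ℂ) :=
    Complex.hasSum_ofReal.mpr summable_latticeTerm.hasSum
  have h2 : HasSum (fun x : ℤ × ℤ => (latticeTerm x.swap : ℂ)) ((∑' x, latticeTerm x : ℝ) : ℂ) :=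
    (Equiv.prodComm ℤ ℤ).hasSum_iff.mpr h1
  simp_rw [toComplex_primaryOfPair_div]
  have h := (h2.mul_left (2 - 2 * Complex.I)).add (h1.mul_left (2 + 2 * Complex.I))
  rwa [← add_mul, show 2 - 2 * Complex.I + (2 + 2 * Complex.I) = ((4 : ℝ) : ℂ) by push_cast; ring,
    ← Complex.ofReal_mul] at h

/-- The absolutely convergent lattice sum is regrouped by norm; each finite fibre contributes one
term of the Dirichlet series. This gives its convergence together with its value. -/
theorem hasSum_LSeries_term_curveE32 :
    HasSum (LSeries.term (fun n : ℕ => (curveE32.LFunction n : ℂ)) 2)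
      ((4 * ∑' x, latticeTerm x : ℝ) : ℂ) := by
  have h := hasSum_toComplex_primaryOfPair.tsum_fiberwise fun x => (primaryOfPair x).norm.natAbs
  refine (congrArg (HasSum · _) (funext fun n => ?_)).mpr h
  have hset : (fun x => (primaryOfPair x).norm.natAbs) ⁻¹' {n} =
      ((primaryOfNorm n).preimage primaryOfPair primaryOfPair_injective.injOn : Set (ℤ × ℤ)) := by
    ext x
    simp only [Set.mem_preimage, Set.mem_singleton_iff, Finset.coe_preimage, Finset.mem_coe,
      mem_primaryOfNorm, primaryOfPair_isPrimary, and_true]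
    have := norm_nonneg' (primaryOfPair x)
    omega
  rw [hset, Finset.tsum_subtype' _ fun x : ℤ × ℤ =>
    ((primaryOfPair x : GaussianInt) : ℂ) / ((primaryOfPair x).norm : ℂ) ^ 2,
    Finset.sum_preimage primaryOfPair (primaryOfNorm n) primaryOfPair_injective.injOn
      (fun α : GaussianInt => (α : ℂ) / (α.norm : ℂ) ^ 2)
      (fun α hα h => absurd (by
        obtain ⟨j, l, hjl⟩ := isPrimary_iff.mp (mem_primaryOfNorm.mp hα).2
        exact ⟨(j, l), hjl.symm⟩) h)]
  rw [Finset.sum_congr rfl (g := fun α : GaussianInt => (α : ℂ) / (n : ℂ) ^ 2) fun α hα => by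
    rw [(mem_primaryOfNorm.mp hα).1, Int.cast_natCast], ← Finset.sum_div, ← map_sum,
    ← LFunction_curveE32_eq_sum_primary, map_intCast]
  rcases eq_or_ne n 0 with rfl | hn
  · simp
  · rw [LSeries.term_of_ne_zero hn]
    norm_cast

theorem lseriesSummable_curveE32 :
    LSeriesSummable (fun n : ℕ => (curveE32.LFunction n : ℂ)) 2 :=
  hasSum_LSeries_term_curveE32.summable

theorem lseries_curveE32_two : curveE32.LSeries 2 = ((4 * ∑' x, latticeTerm x : ℝ) : ℂ) :=
  hasSum_LSeries_term_curveE32.tsum_eq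

end LatticeSum

/-! ### Hyperbolic functions and telescoping bilateral sums -/

section HyperbolicSums

open Real

/-- `x ↦ 1 / cosh (π x)`. -/
noncomputable def sechPi (x : ℝ) : ℝ := (cosh (π * x))⁻¹

/-- `x ↦ 1 / sinh (π x)`. -/
noncomputable def cschPi (x : ℝ) : ℝ := (sinh (π * x))⁻¹

/-- `x ↦ tanh (π x)`. -/
noncomputable def tanhPi (x : ℝ) : ℝ := sinh (π * x) / cosh (π * x)

theorem sechPi_pos (x : ℝ) : 0 < sechPi x := inv_pos.mpr (cosh_pos _)

theorem sechPi_neg (x : ℝ) : sechPi (-x) = sechPi x := by simp [sechPi]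

theorem cschPi_neg (x : ℝ) : cschPi (-x) = -cschPi x := by simp [cschPi, inv_neg]

theorem sinh_pi_mul_ne_zero {x : ℝ} (hx : x ≠ 0) : sinh (π * x) ≠ 0 := by
  rw [Ne, sinh_eq_zero]; exact mul_ne_zero pi_ne_zero hx

theorem cschPi_mul_sinh {x : ℝ} (hx : x ≠ 0) : cschPi x * sinh (π * x) = 1 :=
  inv_mul_cancel₀ (sinh_pi_mul_ne_zero hx)

theorem sechPi_le (x : ℝ) : sechPi x ≤ 2 * exp (-(π * |x|)) := by
  have h : exp (π * |x|) / 2 ≤ cosh (π * x) := by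
    rw [← cosh_abs, abs_mul, abs_of_pos pi_pos, cosh_eq]
    linarith [exp_pos (-(π * |x|))]
  rw [sechPi, exp_neg]
  calc (cosh (π * x))⁻¹ ≤ (exp (π * |x|) / 2)⁻¹ := inv_anti₀ (by positivity) h
    _ = _ := by field_simp

theorem sechPi_add_le {R t : ℝ} (ht : |t| ≤ R) (k : ℤ) :
    sechPi (t + k) ≤ 2 * exp (π * R) * exp (-(π * |(k : ℝ)|)) := by
  refine (sechPi_le _).trans ?_
  rw [mul_assoc, ← exp_add]
  have h1 : |(k : ℝ)| ≤ |t + k| + |t| := by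
    calc |(k : ℝ)| = |(t + k) - t| := by ring_nf
      _ ≤ _ := abs_sub _ _
  have := pi_pos
  gcongr
  nlinarith

theorem summable_abs_mul_exp_neg_pi_abs :
    Summable fun k : ℤ => (1 + |(k : ℝ)|) * exp (-(π * |(k : ℝ)|)) := by
  have hr : ‖exp (-π)‖ < 1 := by
    rw [norm_of_nonneg (exp_pos _).le, exp_lt_one_iff]; linarith [pi_pos]
  have h : Summable fun n : ℕ => (1 + (n : ℝ)) * exp (-(π * n)) := by
    have h0 := summable_geometric_of_norm_lt_one hr
    have h1 := summable_pow_mul_geometric_of_norm_lt_one 1 hr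
    refine (h0.add h1).congr fun n => ?_
    rw [← exp_nat_mul, show (n : ℝ) * -π = -(π * n) by ring]
    ring
  refine Summable.of_nat_of_neg ?_ ?_ <;> simpa using h

theorem summable_exp_neg_pi_abs : Summable fun k : ℤ => exp (-(π * |(k : ℝ)|)) :=
  Summable.of_nonneg_of_le (fun _ => (exp_pos _).le)
    (fun k => le_mul_of_one_le_left (exp_pos _).le (by linarith [abs_nonneg (k : ℝ)]))
    summable_abs_mul_exp_neg_pi_abs

theorem summable_sechPi (t : ℝ) : Summable fun k : ℤ => sechPi (t + k) :=
  Summable.of_nonneg_of_le (fun _ => (sechPi_pos _).le) (sechPi_add_le le_rfl)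
    (summable_exp_neg_pi_abs.mul_left _)

theorem summable_mul_sechPi (t : ℝ) : Summable fun k : ℤ => (k : ℝ) * sechPi (t + k) := by
  refine Summable.of_norm_bounded (summable_abs_mul_exp_neg_pi_abs.mul_left (2 * exp (π * |t|)))
    fun k => ?_
  rw [norm_mul, norm_eq_abs, norm_of_nonneg (sechPi_pos _).le]
  calc |(k : ℝ)| * sechPi (t + k)
      ≤ (1 + |(k : ℝ)|) * (2 * exp (π * |t|) * exp (-(π * |(k : ℝ)|))) :=
        mul_le_mul (by linarith) (sechPi_add_le le_rfl k) (sechPi_pos _).le (by positivity)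
    _ = _ := by ring

/-- Away from its pole csch is comparable to sech, so summability of the csch series follows after
discarding finitely many terms. -/
theorem abs_cschPi_le {x : ℝ} (hx : 1 / 2 ≤ |x|) : |cschPi x| ≤ 2 * sechPi x := by
  have key : ∀ y : ℝ, 1 / 2 ≤ y → cosh (π * y) ≤ 2 * sinh (π * y) := fun y hy => by
    rw [cosh_eq, sinh_eq, exp_neg]
    have h1 : 2 ≤ exp (π * y) := by
      have := add_one_le_exp (π * y)
      nlinarith [pi_gt_three]
    have h2 : (exp (π * y))⁻¹ ≤ 2⁻¹ := inv_anti₀ two_pos h1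
    linarith
  have h := key |x| hx
  have hc : cosh (π * |x|) = cosh (π * x) := by
    rw [← cosh_abs (π * x), abs_mul, abs_of_pos pi_pos]
  have hs : |sinh (π * x)| = sinh (π * |x|) := by
    rw [abs_sinh, abs_mul, abs_of_pos pi_pos]
  rw [hc, ← hs] at h
  rw [cschPi, sechPi, abs_inv]
  have hc0 := cosh_pos (π * x)
  have hs0 : 0 < |sinh (π * x)| := by linarith
  calc |sinh (π * x)|⁻¹ ≤ (cosh (π * x) / 2)⁻¹ := inv_anti₀ (by positivity) (by linarith)
    _ = _ := by rw [inv_div, div_eq_mul_inv]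

theorem eventually_half_le_abs_add (t : ℝ) :
    ∀ᶠ k : ℤ in Filter.cofinite, 1 / 2 ≤ |t + k| := by
  rw [Filter.eventually_cofinite]
  refine (Set.finite_Icc ⌊-t - 1⌋ ⌈-t + 1⌉).subset fun k hk => ?_
  rw [Set.mem_ofPred_eq, not_le, abs_lt] at hk
  constructor
  · have := Int.floor_le (-t - 1)
    have h : (⌊-t - 1⌋ : ℝ) ≤ k := by linarith [hk.1]
    exact_mod_cast h
  · have := Int.le_ceil (-t + 1)
    have h : (k : ℝ) ≤ ⌈-t + 1⌉ := by linarith [hk.2]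
    exact_mod_cast h

theorem summable_cschPi (t : ℝ) : Summable fun k : ℤ => cschPi (t + k) :=
  Summable.of_norm_bounded_eventually ((summable_sechPi t).mul_left 2)
    ((eventually_half_le_abs_add t).mono fun _ hk => abs_cschPi_le hk)

theorem summable_mul_cschPi (t : ℝ) : Summable fun k : ℤ => (k : ℝ) * cschPi (t + k) := by
  refine Summable.of_norm_bounded_eventually ((summable_mul_sechPi t).norm.mul_left 2)
    ((eventually_half_le_abs_add t).mono fun k hk => ?_)
  rw [norm_mul, norm_mul, norm_of_nonneg (sechPi_pos _).le]
  calc ‖(k : ℝ)‖ * ‖cschPi (t + k)‖ ≤ ‖(k : ℝ)‖ * (2 * sechPi (t + k)) := by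
        gcongr
        exact abs_cschPi_le hk
    _ = _ := by ring

theorem Summable.neg_one_zpow_mul {f : ℤ → ℝ} (hf : Summable f) :
    Summable fun k => (-1 : ℝ) ^ k * f k :=
  Summable.of_norm_bounded hf.norm fun k => by
    rw [norm_mul, norm_eq_abs, abs_neg_one_zpow, one_mul]

theorem neg_one_zpow_add_one (k : ℤ) : (-1 : ℝ) ^ (k + 1) = -(-1) ^ k := by
  rw [zpow_add_one₀ (by norm_num)]; ring

theorem neg_one_zpow_mul_self (k : ℤ) : (-1 : ℝ) ^ k * (-1) ^ k = 1 := by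
  rw [← mul_zpow]; norm_num

theorem neg_one_zpow_neg (k : ℤ) : (-1 : ℝ) ^ (-k) = (-1) ^ k := by
  rw [zpow_neg, ← inv_zpow]; norm_num

/-- The product of two bilateral sums, arranged by the difference of the indices. -/
theorem hasSum_tsum_mul_shift {f g : ℤ → ℝ} (hf : Summable f) (hg : Summable g) :
    HasSum (fun m => ∑' k, f k * g (k + m)) ((∑' k, f k) * ∑' k, g k) := by
  have hs : Summable fun x : ℤ × ℤ => f x.1 * g x.2 :=
    summable_mul_of_summable_norm hf.norm hg.norm
  have hp : HasSum (fun x : ℤ × ℤ => f x.1 * g x.2) ((∑' k, f k) * ∑' k, g k) := by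
    rw [tsum_mul_tsum_of_summable_norm hf.norm hg.norm]
    exact hs.hasSum
  let e : ℤ × ℤ ≃ ℤ × ℤ :=
    { toFun := fun x => (x.2, x.2 + x.1)
      invFun := fun x => (x.2 - x.1, x.1)
      left_inv := fun x => by simp
      right_inv := fun x => by simp }
  have hp' := e.hasSum_iff.mpr hp
  exact hp'.prod_fiberwise fun m => (hp'.summable.prod_factor m).hasSum

theorem summable_mul_shift {f g : ℤ → ℝ} (hf : Summable f) (hg : Summable g) (m : ℤ) :
    Summable fun k => f k * g (k + m) := by
  have hs : Summable fun x : ℤ × ℤ => f x.1 * g x.2 :=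
    summable_mul_of_summable_norm hf.norm hg.norm
  exact hs.comp_injective (i := fun k : ℤ => (k, k + m)) fun a b h => (Prod.ext_iff.mp h).1

theorem tsum_eq_zero_of_comp_equiv_eq_neg {f : ℤ → ℝ} (e : ℤ ≃ ℤ) (h : ∀ k, f (e k) = -f k) :
    ∑' k, f k = 0 := by
  have h1 : ∑' k, f k = -∑' k, f k := by
    rw [← tsum_neg, ← e.tsum_eq f]
    exact tsum_congr h
  linarith

/-- This is the addition formula for sinh(π(y - x)) divided by cosh · cosh. In a sum over
simultaneous translates y - x is fixed, so only differences of tanh remain to be summed. -/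
theorem sechPi_mul_sechPi {x y : ℝ} (h : y ≠ x) :
    sechPi x * sechPi y = cschPi (y - x) * (tanhPi y - tanhPi x) := by
  have h0 := sinh_pi_mul_ne_zero (sub_ne_zero.mpr h)
  have hx := (cosh_pos (π * x)).ne'
  have hy := (cosh_pos (π * y)).ne'
  rw [sechPi, sechPi, cschPi, tanhPi, tanhPi, div_sub_div _ _ hy hx]
  have : sinh (π * y) * cosh (π * x) - cosh (π * y) * sinh (π * x) = sinh (π * (y - x)) := by
    rw [mul_sub, sinh_sub]
  rw [this]
  field_simp

theorem tanhPi_sub_tanhPi (x y : ℝ) :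
    tanhPi y - tanhPi x = sinh (π * (y - x)) * (sechPi x * sechPi y) := by
  rcases eq_or_ne y x with rfl | h
  · simp
  · rw [sechPi_mul_sechPi h, ← mul_assoc, mul_comm (sinh _), cschPi_mul_sinh (sub_ne_zero.mpr h),
      one_mul]

theorem summable_sechPi_mul_sechPi (x y : ℝ) :
    Summable fun k : ℤ => sechPi (x + k) * sechPi (y + k) := by
  simpa using summable_mul_shift (summable_sechPi x) (summable_sechPi y) 0

theorem summable_tanhPi_sub (x y : ℝ) :
    Summable fun k : ℤ => tanhPi (y + k) - tanhPi (x + k) := by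
  refine ((summable_sechPi_mul_sechPi x y).mul_left (sinh (π * (y - x)))).congr fun k => ?_
  rw [tanhPi_sub_tanhPi, add_sub_add_right_eq_sub]

theorem tanhPi_eq_one_sub (x : ℝ) : tanhPi x = 1 - exp (-(π * x)) * sechPi x := by
  have h := (cosh_pos (π * x)).ne'
  rw [tanhPi, sechPi, ← cosh_sub_sinh]
  field_simp
  ring

theorem tanhPi_neg (x : ℝ) : tanhPi (-x) = -tanhPi x := by
  rw [tanhPi, tanhPi, mul_neg, sinh_neg, cosh_neg, neg_div]

theorem tendsto_tanhPi_atTop : Filter.Tendsto tanhPi Filter.atTop (nhds 1) := by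
  have h1 : Filter.Tendsto (fun x => exp (-(π * x))) Filter.atTop (nhds 0) :=
    tendsto_exp_neg_atTop_nhds_zero.comp (Filter.tendsto_id.const_mul_atTop pi_pos)
  have h2 : Filter.Tendsto (fun x => exp (-(π * x)) * sechPi x) Filter.atTop (nhds 0) := by
    refine squeeze_zero (fun x => mul_nonneg (exp_pos _).le (sechPi_pos _).le) (fun x => ?_) h1
    refine mul_le_of_le_one_right (exp_pos _).le ?_
    exact inv_le_one_of_one_le₀ (one_le_cosh _)
  have h3 := h2.const_sub 1
  rw [sub_zero] at h3
  exact h3.congr fun x => (tanhPi_eq_one_sub x).symm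

/-- The sum telescopes; 2 is the total increase of tanh from -1 to 1. -/
theorem tsum_tanhPi_add_one_sub (x : ℝ) :
    ∑' k : ℤ, (tanhPi (x + 1 + k) - tanhPi (x + k)) = 2 := by
  have hs := summable_tanhPi_sub x (x + 1)
  have hN : Filter.Tendsto (fun n : ℕ => (n : ℝ)) Filter.atTop Filter.atTop :=
    tendsto_natCast_atTop_atTop
  have h1 : HasSum (fun n : ℕ => tanhPi (x + 1 + (n : ℤ)) - tanhPi (x + (n : ℤ)))
      (1 - tanhPi x) := by
    refine (Summable.hasSum_iff_tendsto_nat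
      (hs.comp_injective (i := fun n : ℕ => (n : ℤ)) Nat.cast_injective)).mpr ?_
    have : ∀ n : ℕ, ∑ i ∈ Finset.range n,
        (tanhPi (x + 1 + ((i : ℤ) : ℝ)) - tanhPi (x + ((i : ℤ) : ℝ))) = tanhPi (x + n) - tanhPi x :=
      fun n => by
        have := Finset.sum_range_sub (fun i : ℕ => tanhPi (x + i)) n
        simp only [Nat.cast_add, Nat.cast_one, Nat.cast_zero, add_zero] at this
        rw [← this]
        refine Finset.sum_congr rfl fun i _ => ?_
        push_cast
        rw [add_right_comm, add_assoc x]
    refine (Filter.Tendsto.congr (fun n => (this n).symm) ?_)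
    exact (tendsto_tanhPi_atTop.comp (Filter.tendsto_atTop_add_const_left _ x hN)).sub_const _
  have h2 : HasSum (fun n : ℕ => tanhPi (x + 1 + (-((n : ℤ) + 1) : ℤ)) -
      tanhPi (x + (-((n : ℤ) + 1) : ℤ))) (tanhPi x + 1) := by
    refine (Summable.hasSum_iff_tendsto_nat
      (hs.comp_injective (i := fun n : ℕ => -((n : ℤ) + 1)) fun a b h => by simpa using h)).mpr ?_
    have : ∀ n : ℕ, ∑ i ∈ Finset.range n,
        (tanhPi (x + 1 + ((-((i : ℤ) + 1) : ℤ) : ℝ)) - tanhPi (x + ((-((i : ℤ) + 1) : ℤ) : ℝ))) =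
          tanhPi x + tanhPi (-x + n) :=
      fun n => by
        have := Finset.sum_range_sub (fun i : ℕ => tanhPi (-x + i)) n
        simp only [Nat.cast_add, Nat.cast_one, Nat.cast_zero, add_zero] at this
        rw [tanhPi_neg, sub_neg_eq_add] at this
        rw [add_comm (tanhPi x), ← this]
        refine Finset.sum_congr rfl fun i _ => ?_
        push_cast
        rw [show x + 1 + -((i : ℝ) + 1) = -(-x + i) by ring,
          show x + -((i : ℝ) + 1) = -(-x + (i + 1)) by ring, tanhPi_neg, tanhPi_neg]
        ring
    refine (Filter.Tendsto.congr (fun n => (this n).symm) ?_)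
    exact (tendsto_tanhPi_atTop.comp (Filter.tendsto_atTop_add_const_left _ (-x) hN)).const_add _
  have h3 := HasSum.of_nat_of_neg_add_one (f := fun k : ℤ => tanhPi (x + 1 + k) - tanhPi (x + k))
    h1 h2
  rw [h3.tsum_eq]
  ring

theorem tsum_tanhPi_add_int_sub (x y : ℝ) (m : ℤ) :
    ∑' k : ℤ, (tanhPi (y + m + k) - tanhPi (x + k)) =
      ∑' k : ℤ, (tanhPi (y + k) - tanhPi (x + k)) + 2 * m := by
  have hadd : ∀ u v w : ℝ, ∑' k : ℤ, (tanhPi (w + k) - tanhPi (u + k)) =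
      ∑' k : ℤ, (tanhPi (v + k) - tanhPi (u + k)) + ∑' k : ℤ, (tanhPi (w + k) - tanhPi (v + k)) :=
    fun u v w => by
      rw [← (summable_tanhPi_sub u v).tsum_add (summable_tanhPi_sub v w)]
      exact tsum_congr fun k => by ring
  rw [hadd x y (y + m)]
  congr 1
  induction m using Int.induction_on with
  | zero => simp
  | succ i ih =>
    have := tsum_tanhPi_add_one_sub (y + i)
    push_cast at ih ⊢
    rw [hadd y (y + i), ih, ← add_assoc, this]
    ring
  | pred i ih =>
    have := tsum_tanhPi_add_one_sub (y + (-i - 1))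
    push_cast at ih ⊢
    rw [show y + (-(i : ℝ) - 1) + 1 = y + -i by ring] at this
    rw [hadd y (y + (-i - 1)), this] at ih
    linarith

end HyperbolicSums

/-! ### Product relations between bilateral hyperbolic sums -/

section ThetaQuotients

open Real

/-- `∑ (-1)ᵏ sech π(t + k)`. -/
noncomputable def altSechSum (t : ℝ) : ℝ := ∑' k : ℤ, (-1 : ℝ) ^ k * sechPi (t + k)

/-- `∑ sech π(t + k)`. -/
noncomputable def sechSum (t : ℝ) : ℝ := ∑' k : ℤ, sechPi (t + k)

/-- `∑ (-1)ᵏ csch π(t + k)`. -/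
noncomputable def altCschSum (t : ℝ) : ℝ := ∑' k : ℤ, (-1 : ℝ) ^ k * cschPi (t + k)

/-- Half of `∑ (-1)ᵏ (tanh π(t + k) - tanh π(t + k + 1))`. -/
noncomputable def altTanhSum (t : ℝ) : ℝ :=
  (∑' k : ℤ, (-1 : ℝ) ^ k * (tanhPi (t + k) - tanhPi (t + 1 + k))) / 2

theorem tsum_neg_one_zpow_mul_add_one (f : ℝ → ℝ) (t : ℝ) :
    ∑' k : ℤ, (-1 : ℝ) ^ k * f (t + 1 + k) = -∑' k : ℤ, (-1 : ℝ) ^ k * f (t + k) := by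
  rw [← tsum_neg, ← (Equiv.addRight (1 : ℤ)).tsum_eq fun k : ℤ => -((-1 : ℝ) ^ k * f (t + k))]
  refine tsum_congr fun k => ?_
  rw [Equiv.coe_addRight, neg_one_zpow_add_one]
  push_cast
  rw [add_right_comm, add_assoc t]
  ring

theorem altSechSum_add_one (t : ℝ) : altSechSum (t + 1) = -altSechSum t :=
  tsum_neg_one_zpow_mul_add_one sechPi t

theorem altSechSum_neg (t : ℝ) : altSechSum (-t) = altSechSum t := by
  rw [altSechSum, ← (Equiv.neg ℤ).tsum_eq]
  refine tsum_congr fun k => ?_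
  rw [Equiv.neg_apply, neg_one_zpow_neg, ← sechPi_neg]
  push_cast
  rw [neg_add, neg_neg, neg_neg]

theorem sechSum_neg (t : ℝ) : sechSum (-t) = sechSum t := by
  rw [sechSum, ← (Equiv.neg ℤ).tsum_eq]
  refine tsum_congr fun k => ?_
  rw [Equiv.neg_apply, ← sechPi_neg]
  push_cast
  rw [neg_add, neg_neg, neg_neg]

theorem sechSum_add_one (t : ℝ) : sechSum (t + 1) = sechSum t := by
  rw [sechSum, sechSum, ← (Equiv.addRight (1 : ℤ)).tsum_eq fun k : ℤ => sechPi (t + k)]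
  refine tsum_congr fun k => ?_
  rw [Equiv.coe_addRight]
  push_cast
  rw [add_right_comm, add_assoc t]

theorem sechSum_pos (t : ℝ) : 0 < sechSum t :=
  (summable_sechPi t).tsum_pos (fun _ => (sechPi_pos _).le) 0 (sechPi_pos _)

theorem altSechSum_half : altSechSum (1 / 2) = 0 := by
  have h := altSechSum_add_one (-(1 / 2))
  rw [altSechSum_neg, show -(1 / 2 : ℝ) + 1 = 1 / 2 by norm_num] at h
  linarith

theorem altTanhSum_add_one (t : ℝ) : altTanhSum (t + 1) = -altTanhSum t := by
  have h := tsum_neg_one_zpow_mul_add_one (fun x => tanhPi x - tanhPi (x + 1)) t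
  rw [altTanhSum, altTanhSum, ← neg_div]
  congr 1
  refine Eq.trans (tsum_congr fun k => ?_) (h.trans (congrArg _ (tsum_congr fun k => ?_)))
  · rw [add_right_comm (t + 1)]
  · rw [add_right_comm t]

theorem altTanhSum_add_int (t : ℝ) (m : ℤ) : altTanhSum (t + m) = (-1) ^ m * altTanhSum t := by
  induction m using Int.induction_on with
  | zero => simp
  | succ i ih =>
    push_cast at ih ⊢
    rw [← add_assoc, altTanhSum_add_one, ih, neg_one_zpow_add_one]
    ring
  | pred i ih =>
    have h := altTanhSum_add_one (t + (-i - 1))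
    have h' := neg_one_zpow_add_one (-i - 1)
    rw [add_assoc, sub_add_cancel] at h
    rw [sub_add_cancel] at h'
    push_cast at ih ⊢
    rw [ih, h'] at h
    linarith

/-- The terms of ∑ (-1)ᵏ tanh π(t + k) do not tend to zero; `altTanhSum` is its regularization. The
identity follows by chaining x → x + 1 → y + 1 → y, where the middle leg is minus the original sum.
-/
theorem tsum_neg_one_zpow_mul_tanhPi_sub (x y : ℝ) :
    ∑' k : ℤ, (-1 : ℝ) ^ k * (tanhPi (y + k) - tanhPi (x + k)) =
      altTanhSum y - altTanhSum x := by
  set Q : ℝ → ℝ → ℝ := fun x y => ∑' k : ℤ, (-1 : ℝ) ^ k * (tanhPi (y + k) - tanhPi (x + k))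
    with hQ
  have hs : ∀ u v, Summable fun k : ℤ => (-1 : ℝ) ^ k * (tanhPi (v + k) - tanhPi (u + k)) :=
    fun u v => (summable_tanhPi_sub u v).neg_one_zpow_mul
  have hadd : ∀ u v w, Q u w = Q u v + Q v w := fun u v w => by
    rw [hQ, ← (hs u v).tsum_add (hs v w)]
    exact tsum_congr fun k => by ring
  have hshift : Q (x + 1) (y + 1) = -Q x y := by
    have h := tsum_neg_one_zpow_mul_add_one (fun t => tanhPi (y - x + t) - tanhPi t) x
    refine Eq.trans (tsum_congr fun k => ?_) (h.trans (congrArg _ (tsum_congr fun k => ?_)))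
    · rw [show y - x + (x + 1 + k) = y + 1 + k by ring]
    · rw [show y - x + (x + k) = y + k by ring]
  have h1 : Q x y = Q x (x + 1) + Q (x + 1) (y + 1) + Q (y + 1) y := by
    rw [← hadd, ← hadd]
  have h2 : Q x (x + 1) = -Q (x + 1) x := by
    rw [hQ, ← tsum_neg]
    exact tsum_congr fun k => by ring
  rw [altTanhSum, altTanhSum]
  change Q x y = Q (y + 1) y / 2 - Q (x + 1) x / 2
  linarith

theorem tsum_sechPi_mul_sechPi {x y : ℝ} (h : y ≠ x) :
    ∑' k : ℤ, sechPi (x + k) * sechPi (y + k) =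
      cschPi (y - x) * ∑' k : ℤ, (tanhPi (y + k) - tanhPi (x + k)) := by
  rw [← tsum_mul_left]
  refine tsum_congr fun k => ?_
  rw [sechPi_mul_sechPi (by simpa using h), add_sub_add_right_eq_sub]

theorem tsum_neg_one_zpow_mul_sechPi_mul_sechPi {x y : ℝ} (h : y ≠ x) :
    ∑' k : ℤ, (-1 : ℝ) ^ k * (sechPi (x + k) * sechPi (y + k)) =
      cschPi (y - x) * (altTanhSum y - altTanhSum x) := by
  rw [← tsum_neg_one_zpow_mul_tanhPi_sub, ← tsum_mul_left]
  refine tsum_congr fun k => ?_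
  rw [sechPi_mul_sechPi (by simpa using h), add_sub_add_right_eq_sub]
  ring

theorem int_cast_ne_half (m : ℤ) : (m : ℝ) ≠ 1 / 2 := by
  intro h
  have : (2 * m : ℤ) = 1 := by
    have : (2 * m : ℝ) = 1 := by linarith
    exact_mod_cast this
  omega

theorem tsum_cschPi_sub_half : ∑' m : ℤ, cschPi (-(1 / 2) + m) = 0 := by
  refine tsum_eq_zero_of_comp_equiv_eq_neg (Equiv.subLeft 1) fun m => ?_
  rw [Equiv.subLeft_apply, ← cschPi_neg]
  congr 1
  push_cast
  ring

/-- The product of `sechSum` and its half-period translate is constant. -/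
theorem sechSum_mul_sechSum_sub_half (t : ℝ) :
    sechSum t * sechSum (t - 1 / 2) = ∑' m : ℤ, 2 * (m * cschPi (-(1 / 2) + m)) := by
  have h := hasSum_tsum_mul_shift (summable_sechPi t) (summable_sechPi (t - 1 / 2))
  rw [sechSum, sechSum, ← h.tsum_eq]
  -- All dependence on `t` sits in `D`, which gets multiplied by a csch sum that vanishes by
  -- antisymmetry.
  set D := ∑' k : ℤ, (tanhPi (t - 1 / 2 + k) - tanhPi (t + k))
  have h1 : ∀ m : ℤ, ∑' k : ℤ, sechPi (t + k) * sechPi (t - 1 / 2 + ((k + m : ℤ) : ℝ)) =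
      2 * (m * cschPi (-(1 / 2) + m)) + D * cschPi (-(1 / 2) + m) := fun m => by
    have hne : t - 1 / 2 + m ≠ t := fun h => int_cast_ne_half m (by linarith)
    have h2 := tsum_sechPi_mul_sechPi hne
    rw [tsum_tanhPi_add_int_sub, show t - 1 / 2 + m - t = -(1 / 2) + m by ring] at h2
    refine Eq.trans (tsum_congr fun k => ?_) (h2.trans ?_)
    · push_cast
      rw [add_assoc _ (m : ℝ), add_comm (m : ℝ)]
    · ring
  simp_rw [h1]
  rw [((summable_mul_cschPi _).mul_left 2).tsum_add ((summable_cschPi _).mul_left D),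
    tsum_mul_left, tsum_mul_left, tsum_cschPi_sub_half, mul_zero, add_zero]

/-- Grouped by index difference m, the two squares differ by the factor (-1)^m. The diagonal cancels
and the other inner sums telescope to values free of t; only this independence of t is needed later.
-/
theorem sechSum_sq_sub_altSechSum_sq (t : ℝ) :
    sechSum t ^ 2 - altSechSum t ^ 2 =
      ∑' m : ℤ, (1 - (-1 : ℝ) ^ m) * (2 * (m * cschPi m)) := by
  have hs := summable_sechPi t
  have h := (hasSum_tsum_mul_shift hs hs).sub
    (hasSum_tsum_mul_shift hs.neg_one_zpow_mul hs.neg_one_zpow_mul)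
  rw [sq, sq, sechSum, altSechSum, ← h.tsum_eq]
  refine tsum_congr fun m => ?_
  have h1 : ∑' k : ℤ, (-1 : ℝ) ^ k * sechPi (t + k) *
      ((-1 : ℝ) ^ (k + m) * sechPi (t + ((k + m : ℤ) : ℝ))) =
        (-1 : ℝ) ^ m * ∑' k : ℤ, sechPi (t + k) * sechPi (t + ((k + m : ℤ) : ℝ)) := by
    rw [← tsum_mul_left]
    refine tsum_congr fun k => ?_
    rw [zpow_add₀ (by norm_num)]
    linear_combination ((-1 : ℝ) ^ m * sechPi (t + k) * sechPi (t + ((k + m : ℤ) : ℝ))) *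
      neg_one_zpow_mul_self k
  rw [h1]
  rcases eq_or_ne m 0 with rfl | hm
  · simp
  have hne : t + m ≠ t := by simpa using hm
  have h2 := tsum_sechPi_mul_sechPi hne
  rw [tsum_tanhPi_add_int_sub, add_sub_cancel_left] at h2
  have h3 : ∑' k : ℤ, sechPi (t + k) * sechPi (t + ((k + m : ℤ) : ℝ)) = 2 * (m * cschPi m) := by
    refine Eq.trans (tsum_congr fun k => ?_) (h2.trans ?_)
    · push_cast
      rw [add_assoc _ (m : ℝ), add_comm (m : ℝ)]
    · simp
      ring
  rw [h3]
  ring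

/-- In the inner sums `altTanhSum` at t + m is (-1)^m times its value at t; the contribution of t -
1/2 multiplies the non-alternating csch sum, which is zero. -/
theorem altSechSum_sub_half_mul_sechSum (t : ℝ) :
    altSechSum (t - 1 / 2) * sechSum t = altCschSum (1 / 2) * altTanhSum t := by
  have h := hasSum_tsum_mul_shift (summable_sechPi (t - 1 / 2)).neg_one_zpow_mul (summable_sechPi t)
  rw [altSechSum, sechSum, ← h.tsum_eq]
  have h1 : ∀ m : ℤ, ∑' k : ℤ, (-1 : ℝ) ^ k * sechPi (t - 1 / 2 + k) *
      sechPi (t + ((k + m : ℤ) : ℝ)) =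
        altTanhSum t * ((-1) ^ m * cschPi (1 / 2 + m)) -
          altTanhSum (t - 1 / 2) * cschPi (1 / 2 + m) := fun m => by
    have hne : t + m ≠ t - 1 / 2 := fun h => int_cast_ne_half (-m) (by push_cast; linarith)
    have h2 := tsum_neg_one_zpow_mul_sechPi_mul_sechPi hne
    rw [altTanhSum_add_int, show t + m - (t - 1 / 2) = 1 / 2 + m by ring] at h2
    refine Eq.trans (tsum_congr fun k => ?_) (h2.trans ?_)
    · push_cast
      rw [add_assoc _ (m : ℝ), add_comm (m : ℝ)]
      ring
    · ring
  have h0 : ∑' m : ℤ, cschPi (1 / 2 + m) = 0 := by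
    rw [← tsum_cschPi_sub_half, ← (Equiv.subRight (1 : ℤ)).tsum_eq]
    refine tsum_congr fun m => ?_
    rw [Equiv.subRight_apply]
    congr 1
    push_cast
    ring
  simp_rw [h1]
  rw [((summable_cschPi _).neg_one_zpow_mul.mul_left _).tsum_sub ((summable_cschPi _).mul_left _),
    tsum_mul_left, tsum_mul_left, h0, mul_zero, sub_zero, altCschSum, mul_comm]

/-- Off the diagonal the inner sums are odd in the index difference and cancel. What remains is, up
to π, the termwise derivative of `altTanhSum`. -/
theorem altSechSum_mul_sechSum (t : ℝ) :
    altSechSum t * sechSum t = ∑' k : ℤ, (-1 : ℝ) ^ k * sechPi (t + k) ^ 2 := by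
  have h := hasSum_tsum_mul_shift (summable_sechPi t).neg_one_zpow_mul (summable_sechPi t)
  rw [altSechSum, sechSum, ← h.tsum_eq]
  set F : ℤ → ℝ := fun m => ∑' k : ℤ, (-1 : ℝ) ^ k * sechPi (t + k) *
      sechPi (t + ((k + m : ℤ) : ℝ)) with hF
  have h0 : F 0 = ∑' k : ℤ, (-1 : ℝ) ^ k * sechPi (t + k) ^ 2 :=
    tsum_congr fun k => by rw [add_zero]; ring
  have h1 : ∀ m : ℤ, m ≠ 0 → F m = cschPi m * (((-1) ^ m - 1) * altTanhSum t) := fun m hm => by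
    have hne : t + m ≠ t := by simpa using hm
    have h2 := tsum_neg_one_zpow_mul_sechPi_mul_sechPi hne
    rw [altTanhSum_add_int, add_sub_cancel_left] at h2
    refine Eq.trans (tsum_congr fun k => ?_) (h2.trans ?_)
    · push_cast
      rw [add_assoc _ (m : ℝ), add_comm (m : ℝ)]
      ring
    · ring
  rw [h.summable.tsum_eq_add_tsum_ite 0]
  change F 0 + ∑' m : ℤ, (if m = 0 then 0 else F m) = _
  rw [tsum_eq_zero_of_comp_equiv_eq_neg (Equiv.neg ℤ), h0, add_zero]
  intro m
  rw [Equiv.neg_apply]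
  rcases eq_or_ne m 0 with rfl | hm
  · simp
  · rw [if_neg hm, if_neg (neg_ne_zero.mpr hm), h1 m hm, h1 _ (neg_ne_zero.mpr hm),
      neg_one_zpow_neg, Int.cast_neg, cschPi_neg]
    ring

/-- The product of `altCschSum` and `altSechSum (· - 1/2)` is constant off the integers. -/
theorem altCschSum_mul_altSechSum_sub_half {t : ℝ} (ht : ∀ k : ℤ, t + k ≠ 0) :
    altCschSum t * altSechSum (t - 1 / 2) =
      ∑' m : ℤ, -2 * (m * ((-1 : ℝ) ^ m * sechPi (-(1 / 2) + m))) := by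
  have hf := (summable_cschPi t).neg_one_zpow_mul
  have hg := (summable_sechPi (t - 1 / 2)).neg_one_zpow_mul
  have h := hasSum_tsum_mul_shift hf hg
  rw [altCschSum, altSechSum, ← h.tsum_eq]
  have hterm : ∀ k m : ℤ, (-1 : ℝ) ^ k * cschPi (t + k) *
      ((-1) ^ (k + m) * sechPi (t - 1 / 2 + ((k + m : ℤ) : ℝ))) =
        (-1) ^ m * sechPi (-(1 / 2) + m) *
          (cosh (π * (t + k)) * cschPi (t + k) - tanhPi (t - 1 / 2 + m + k)) := fun k m => by
    have hs := sinh_pi_mul_ne_zero (ht k)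
    have h1 := (cosh_pos (π * (t - 1 / 2 + m + k))).ne'
    have h2 := (cosh_pos (π * (-(1 / 2) + m))).ne'
    have h3 : cosh (π * (-(1 / 2) + m)) =
        cosh (π * (t - 1 / 2 + m + k)) * cosh (π * (t + k)) -
          sinh (π * (t - 1 / 2 + m + k)) * sinh (π * (t + k)) := by
      rw [← cosh_sub]; congr 1; ring
    -- The addition formula for cosh of a difference, divided by sinh · cosh, gives the analogue
    -- with coth minus tanh.
    have h4 : cschPi (t + k) * sechPi (t - 1 / 2 + m + k) = sechPi (-(1 / 2) + m) *
          (cosh (π * (t + k)) * cschPi (t + k) - tanhPi (t - 1 / 2 + m + k)) := by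
      rw [cschPi, sechPi, sechPi, tanhPi]
      generalize cosh (π * (-(1 / 2) + m)) = c at *
      generalize cosh (π * (t - 1 / 2 + m + k)) = c₁ at *
      generalize sinh (π * (t - 1 / 2 + m + k)) = s₁ at *
      generalize cosh (π * (t + k)) = c₂ at *
      generalize sinh (π * (t + k)) = s₂ at *
      subst h3
      field_simp
      rw [mul_comm s₂, div_self h2]
    rw [zpow_add₀ (by norm_num), mul_assoc ((-1 : ℝ) ^ m), ← h4, Int.cast_add, add_comm (k : ℝ),
      ← add_assoc]
    linear_combination ((-1 : ℝ) ^ m * cschPi (t + k) * sechPi (t - 1 / 2 + m + k)) *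
      neg_one_zpow_mul_self k
  have hsum : ∀ m : ℤ, Summable fun k : ℤ =>
      cosh (π * (t + k)) * cschPi (t + k) - tanhPi (t - 1 / 2 + m + k) := fun m => by
    have h1 := summable_mul_shift hf hg m
    simp_rw [hterm] at h1
    exact (summable_mul_left_iff (mul_ne_zero (zpow_ne_zero _ (by norm_num))
      (sechPi_pos _).ne')).mp h1
  set D := ∑' k : ℤ, (cosh (π * (t + k)) * cschPi (t + k) - tanhPi (t - 1 / 2 + ((0 : ℤ) : ℝ) + k))
    with hD
  have hinner : ∀ m : ℤ, ∑' k : ℤ,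
      (cosh (π * (t + k)) * cschPi (t + k) - tanhPi (t - 1 / 2 + m + k)) = D - 2 * m := fun m => by
    have h1 := tsum_tanhPi_add_int_sub (t - 1 / 2 + ((0 : ℤ) : ℝ)) (t - 1 / 2 + ((0 : ℤ) : ℝ)) m
    simp only [sub_self, tsum_zero, zero_add] at h1
    rw [← h1, hD, ← (hsum 0).tsum_sub (summable_tanhPi_sub _ _)]
    refine tsum_congr fun k => ?_
    rw [Int.cast_zero, add_zero]
    ring
  simp_rw [hterm, tsum_mul_left, hinner]
  have hv : ∑' m : ℤ, (-1 : ℝ) ^ m * sechPi (-(1 / 2) + m) = 0 := by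
    have := altSechSum_neg (1 / 2)
    rwa [altSechSum_half] at this
  have hsplit : ∀ m : ℤ, (-1 : ℝ) ^ m * sechPi (-(1 / 2) + m) * (D - 2 * m) =
      D * ((-1 : ℝ) ^ m * sechPi (-(1 / 2) + m)) +
        -2 * (m * ((-1 : ℝ) ^ m * sechPi (-(1 / 2) + m))) := fun m => by ring
  simp_rw [hsplit]
  have hsm : Summable fun m : ℤ => (m : ℝ) * ((-1 : ℝ) ^ m * sechPi (-(1 / 2) + m)) :=
    (summable_mul_sechPi (-(1 / 2))).neg_one_zpow_mul.congr fun m => by ring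
  rw [((summable_sechPi _).neg_one_zpow_mul.mul_left D).tsum_add (hsm.mul_left (-2)),
    tsum_mul_left, hv, mul_zero, zero_add, tsum_mul_left]

end ThetaQuotients

/-! ### Self-duality of sech and Poisson summation -/

section SechFourier

open Complex MeasureTheory

theorem sigmoid_two_pi_mul (u : ℝ) :
    Real.sigmoid (2 * Real.pi * u) = Real.exp (Real.pi * u) * (sechPi u / 2) := by
  rw [Real.sigmoid_def, sechPi, Real.cosh_eq, show -(2 * Real.pi * u) =
    -(Real.pi * u) + -(Real.pi * u) by ring, Real.exp_add, Real.exp_neg]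
  have := Real.exp_pos (Real.pi * u)
  field_simp

/-- The substitution p = 1 / (1 + exp(-2πu)) maps the line onto (0, 1); the logarithms of p and 1 -
p differ by 2πu, which turns the beta integrand into a Fourier integrand with weight sech. -/
theorem ofReal_sigmoid_cpow_mul (ξ u : ℝ) :
    (|2 * Real.pi * (Real.sigmoid (2 * Real.pi * u) * (1 - Real.sigmoid (2 * Real.pi * u)))|) •
      ((Real.sigmoid (2 * Real.pi * u) : ℂ) ^ ((1 / 2 + I * ξ : ℂ) - 1) *
        (1 - (Real.sigmoid (2 * Real.pi * u) : ℂ)) ^ ((1 / 2 - I * ξ : ℂ) - 1)) =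
      Real.pi * (cexp (2 * Real.pi * I * ξ * u) * sechPi u) := by
  have hσ : 0 < sechPi u / 2 := half_pos (sechPi_pos u)
  have hq : 1 - Real.sigmoid (2 * Real.pi * u) = Real.exp (-(Real.pi * u)) * (sechPi u / 2) := by
    rw [← Real.sigmoid_neg, ← mul_neg, sigmoid_two_pi_mul, sechPi_neg, mul_neg]
  have hp := sigmoid_two_pi_mul u
  set p := Real.sigmoid (2 * Real.pi * u)
  have hp0 : 0 < p := Real.sigmoid_pos _
  have hq0 : 0 < 1 - p := by rw [hq]; positivity
  have hlp : Real.log p = Real.pi * u + Real.log (sechPi u / 2) := by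
    rw [hp, Real.log_mul (Real.exp_pos _).ne' hσ.ne', Real.log_exp]
  have hlq : Real.log (1 - p) = -(Real.pi * u) + Real.log (sechPi u / 2) := by
    rw [hq, Real.log_mul (Real.exp_pos _).ne' hσ.ne', Real.log_exp]
  have hpc : (p : ℂ) ≠ 0 := ofReal_ne_zero.mpr hp0.ne'
  have hqc : ((1 - p : ℝ) : ℂ) ≠ 0 := ofReal_ne_zero.mpr hq0.ne'
  rw [abs_of_pos (by have := Real.pi_pos; positivity), real_smul,
    show (1 - (p : ℂ)) = ((1 - p : ℝ) : ℂ) by push_cast; rfl, cpow_sub _ _ hpc,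
    cpow_sub _ _ hqc, cpow_one, cpow_one]
  have hmain : (p : ℂ) ^ (1 / 2 + I * ξ : ℂ) * ((1 - p : ℝ) : ℂ) ^ (1 / 2 - I * ξ : ℂ) =
      cexp (2 * Real.pi * I * ξ * u) * (sechPi u / 2 : ℝ) := by
    rw [cpow_def_of_ne_zero hpc, cpow_def_of_ne_zero hqc, ← ofReal_log hp0.le, ← ofReal_log hq0.le,
      ← Complex.exp_add, hlp, hlq]
    conv_rhs => rw [← Real.exp_log hσ, ofReal_exp, ← Complex.exp_add]
    congr 1
    push_cast
    ring
  calc ((2 * Real.pi * (p * (1 - p)) : ℝ) : ℂ) *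
      ((p : ℂ) ^ (1 / 2 + I * ξ : ℂ) / p * (((1 - p : ℝ) : ℂ) ^ (1 / 2 - I * ξ : ℂ) / (1 - p : ℝ)))
      = 2 * Real.pi * ((p : ℂ) ^ (1 / 2 + I * ξ : ℂ) *
          ((1 - p : ℝ) : ℂ) ^ (1 / 2 - I * ξ : ℂ)) := by
        push_cast at hqc ⊢
        field_simp
    _ = _ := by
        rw [hmain]
        push_cast
        ring

theorem hasDerivAt_sigmoid_two_pi_mul (u : ℝ) :
    HasDerivAt (fun u => Real.sigmoid (2 * Real.pi * u))
      (2 * Real.pi * (Real.sigmoid (2 * Real.pi * u) * (1 - Real.sigmoid (2 * Real.pi * u)))) u := by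
  have h := (Real.hasDerivAt_sigmoid (2 * Real.pi * u)).comp u
    ((hasDerivAt_id' u).const_mul (2 * Real.pi))
  exact h.congr_deriv (by ring)

theorem image_sigmoid_two_pi_mul :
    (fun u => Real.sigmoid (2 * Real.pi * u)) '' Set.univ = Set.Ioo 0 1 := by
  rw [← Real.range_sigmoid, Set.image_univ]
  have h : Function.Surjective fun u : ℝ => 2 * Real.pi * u := fun x =>
    ⟨x / (2 * Real.pi), by have := Real.pi_pos; field_simp⟩
  exact h.range_comp Real.sigmoid

theorem injective_sigmoid_two_pi_mul :
    Function.Injective fun u => Real.sigmoid (2 * Real.pi * u) := fun x y h => by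
  have h' := Real.sigmoid_injective h
  have := Real.pi_pos
  exact mul_left_cancel₀ (by positivity) h'

theorem half_add_I_mul_re_pos (ξ : ℝ) : 0 < (1 / 2 + I * ξ : ℂ).re := by simp

theorem half_sub_I_mul_re_pos (ξ : ℝ) : 0 < (1 / 2 - I * ξ : ℂ).re := by simp

theorem integrable_exp_mul_sechPi (ξ : ℝ) :
    Integrable fun u : ℝ => cexp (2 * Real.pi * I * ξ * u) * sechPi u := by
  have h := betaIntegral_convergent (half_add_I_mul_re_pos ξ) (half_sub_I_mul_re_pos ξ)
  rw [intervalIntegrable_iff_integrableOn_Ioo_of_le zero_le_one, ← image_sigmoid_two_pi_mul,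
    integrableOn_image_iff_integrableOn_abs_deriv_smul MeasurableSet.univ
      (fun u _ => (hasDerivAt_sigmoid_two_pi_mul u).hasDerivWithinAt)
      injective_sigmoid_two_pi_mul.injOn, integrableOn_univ] at h
  simp only [ofReal_sigmoid_cpow_mul] at h
  exact (integrable_const_mul_iff (isUnit_iff_ne_zero.mpr (ofReal_ne_zero.mpr Real.pi_ne_zero))
    _).mp h

/-- The Fourier transform of `1 / cosh (π u)`. -/
theorem integral_exp_mul_sechPi (ξ : ℝ) :
    ∫ u : ℝ, cexp (2 * Real.pi * I * ξ * u) * sechPi u = sechPi ξ := by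
  -- The parameters sum to 1, so the reflection formula evaluates the beta integral as π / sin(π/2 +
  -- iπξ) = π / cosh(πξ).
  have h1 : betaIntegral (1 / 2 + I * ξ) (1 / 2 - I * ξ) = Real.pi * sechPi ξ := by
    have h := Gamma_mul_Gamma_eq_betaIntegral (half_add_I_mul_re_pos ξ) (half_sub_I_mul_re_pos ξ)
    rw [show (1 / 2 + I * ξ : ℂ) + (1 / 2 - I * ξ) = 1 by ring, Gamma_one, one_mul,
      show (1 / 2 - I * ξ : ℂ) = 1 - (1 / 2 + I * ξ) by ring, Gamma_mul_Gamma_one_sub,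
      show (Real.pi : ℂ) * (1 / 2 + I * ξ) = (Real.pi * ξ : ℝ) * I + Real.pi / 2 by
        push_cast; ring, Complex.sin_add_pi_div_two, Complex.cos_mul_I, ← ofReal_cosh] at h
    rw [show (1 / 2 - I * ξ : ℂ) = 1 - (1 / 2 + I * ξ) by ring, ← h, sechPi, ofReal_inv,
      div_eq_mul_inv]
  have h2 := integral_image_eq_integral_abs_deriv_smul MeasurableSet.univ
      (fun u _ => (hasDerivAt_sigmoid_two_pi_mul u).hasDerivWithinAt)
      injective_sigmoid_two_pi_mul.injOn
      (fun x : ℝ => (x : ℂ) ^ ((1 / 2 + I * ξ : ℂ) - 1) * (1 - (x : ℂ)) ^ ((1 / 2 - I * ξ : ℂ) - 1))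
  simp only [ofReal_sigmoid_cpow_mul] at h2
  rw [image_sigmoid_two_pi_mul, Measure.restrict_univ, integral_const_mul,
    ← integral_Ioc_eq_integral_Ioo, ← intervalIntegral.integral_of_le zero_le_one] at h2
  rw [betaIntegral, h2] at h1
  exact mul_left_cancel₀ (ofReal_ne_zero.mpr Real.pi_ne_zero) h1

theorem integrable_sechPi : Integrable sechPi := by
  have h := (integrable_exp_mul_sechPi 0).norm
  refine h.congr (Filter.Eventually.of_forall fun u => ?_)
  simp only [ofReal_zero, mul_zero, zero_mul, Complex.exp_zero, one_mul, norm_real]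
  exact Real.norm_of_nonneg (sechPi_pos u).le

theorem integral_sechPi : ∫ u, sechPi u = 1 := by
  have h := integral_exp_mul_sechPi 0
  simp only [ofReal_zero, mul_zero, zero_mul, Complex.exp_zero, one_mul] at h
  rw [integral_complex_ofReal, sechPi] at h
  simpa using h

theorem continuous_sechPi : Continuous sechPi :=
  (Real.continuous_cosh.comp (continuous_const.mul continuous_id)).inv₀
    fun _ => (Real.cosh_pos _).ne'

theorem sechPi_add_isBigO (t : ℝ) :
    (fun x => sechPi (t + x)) =O[Filter.cocompact ℝ] fun x => |x| ^ (-2 : ℝ) := by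
  refine Asymptotics.IsBigO.of_bound (2 * Real.exp (Real.pi * |t|)) ?_
  filter_upwards [(Filter.hasBasis_cocompact.mem_of_mem (isCompact_singleton (x := (0 : ℝ))))]
    with x hx
  have hx0 : 0 < |x| := abs_pos.mpr hx
  rw [Real.norm_of_nonneg (sechPi_pos _).le, Real.norm_of_nonneg (by positivity),
    Real.rpow_neg hx0.le, Real.rpow_two]
  have h1 : sechPi (t + x) ≤ 2 * Real.exp (Real.pi * |t|) * Real.exp (-(Real.pi * |x|)) := by
    refine (sechPi_le _).trans ?_
    rw [mul_assoc, ← Real.exp_add]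
    have h1 : |x| ≤ |t + x| + |t| := by
      calc |x| = |(t + x) - t| := by ring_nf
        _ ≤ _ := abs_sub _ _
    have := Real.pi_pos
    gcongr
    nlinarith
  refine h1.trans ?_
  gcongr
  rw [Real.exp_neg]
  refine inv_anti₀ (by positivity) ?_
  have h2 := Real.quadratic_le_exp_of_nonneg (x := Real.pi * |x|) (by positivity)
  have h3 : 9 * |x| ^ 2 ≤ (Real.pi * |x|) ^ 2 := by
    rw [mul_pow]
    have := Real.pi_gt_three
    gcongr
    nlinarith
  have : 0 ≤ Real.pi * |x| := by positivity
  nlinarith [sq_nonneg |x|]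

/-- Poisson summation for a twisted translate of `1 / cosh (π x)`. -/
theorem tsum_exp_mul_sechPi (α t : ℝ) :
    ∑' k : ℤ, cexp (2 * Real.pi * I * α * k) * sechPi (t + k) =
      ∑' j : ℤ, cexp (2 * Real.pi * I * (j - α) * t) * sechPi (j - α) := by
  set f : ℝ → ℂ := fun x => cexp (2 * Real.pi * I * α * x) * sechPi (t + x) with hf
  have hc : Continuous f := by
    refine Continuous.mul (by fun_prop) ?_
    exact continuous_ofReal.comp (continuous_sechPi.comp (continuous_const.add continuous_id))
  have hO : f =O[Filter.cocompact ℝ] fun x => |x| ^ (-2 : ℝ) := by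
    refine Asymptotics.IsBigO.trans (Asymptotics.isBigO_of_le _ fun x => ?_) (sechPi_add_isBigO t)
    rw [hf, norm_mul, show (2 * Real.pi * I * α * x : ℂ) = (2 * Real.pi * α * x : ℝ) * I by
      push_cast; ring, norm_exp_ofReal_mul_I, one_mul, norm_real]
  have hF : ∀ w : ℝ, FourierTransform.fourier f w =
      cexp (2 * Real.pi * I * (w - α) * t) * sechPi (w - α) := fun w => by
    rw [Real.fourier_real_eq_integral_exp_smul, ← sechPi_neg, neg_sub, ← integral_exp_mul_sechPi,
      ← integral_const_mul, ← integral_add_right_eq_self _ (-t)]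
    refine integral_congr_ae (Filter.Eventually.of_forall fun v => ?_)
    simp only [hf, smul_eq_mul]
    rw [show t + (v + -t) = v by ring, ← mul_assoc, ← mul_assoc, ← Complex.exp_add, ← Complex.exp_add]
    congr 2
    push_cast
    ring
  have hs : Summable fun n : ℤ => FourierTransform.fourier f (n : ℝ) := by
    simp only [hF]
    refine Summable.of_norm_bounded (summable_sechPi (-α)) fun n => ?_
    rw [norm_mul, show (2 * Real.pi * I * ((n : ℝ) - α) * t : ℂ) =
      (2 * Real.pi * (n - α) * t : ℝ) * I by push_cast; ring, norm_exp_ofReal_mul_I, one_mul,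
      norm_real, Real.norm_of_nonneg (sechPi_pos _).le, neg_add_eq_sub]
  have h := Real.tsum_eq_tsum_fourier_of_rpow_decay_of_summable hc one_lt_two hO hs 0
  simp only [zero_add, hF] at h
  simpa [hf] using h

end SechFourier

/-! ### The lemniscatic differential equation and its normalization -/

section LemniscateODE

open Real MeasureTheory

theorem neg_one_zpow_eq_cexp (k : ℤ) :
    Complex.exp (2 * π * Complex.I * ((1 / 2 : ℝ) : ℂ) * k) = (((-1 : ℝ) ^ k : ℝ) : ℂ) := by
  rw [show (2 * π * Complex.I * ((1 / 2 : ℝ) : ℂ) * k : ℂ) = k * (π * Complex.I) by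
    push_cast; ring, Complex.exp_int_mul, Complex.exp_pi_mul_I]
  push_cast
  rfl

/-- The Fourier expansion of `altSechSum`. -/
theorem altSechSum_eq_tsum_cos (t : ℝ) :
    altSechSum t = ∑' j : ℤ, sechPi (-(1 / 2) + j) * cos (2 * π * (-(1 / 2) + j) * t) := by
  have h := tsum_exp_mul_sechPi (1 / 2) t
  simp only [neg_one_zpow_eq_cexp] at h
  have h1 : (∑' k : ℤ, (((-1 : ℝ) ^ k : ℝ) : ℂ) * sechPi (t + k)) = (altSechSum t : ℂ) := by
    rw [altSechSum, Complex.ofReal_tsum]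
    push_cast
    rfl
  have hs : Summable fun j : ℤ => Complex.exp (2 * π * Complex.I * (j - ((1 / 2 : ℝ) : ℂ)) * t) *
      sechPi (j - 1 / 2) := by
    refine Summable.of_norm_bounded (summable_sechPi (-(1 / 2))) fun n => ?_
    rw [norm_mul, show (2 * π * Complex.I * ((n : ℂ) - ((1 / 2 : ℝ) : ℂ)) * t : ℂ) =
      (2 * π * (n - 1 / 2) * t : ℝ) * Complex.I by push_cast; ring, Complex.norm_exp_ofReal_mul_I,
      one_mul, Complex.norm_real, norm_of_nonneg (sechPi_pos _).le, neg_add_eq_sub]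
  rw [h1] at h
  have h2 := congrArg Complex.re h
  rw [Complex.ofReal_re, Complex.re_tsum hs] at h2
  rw [h2]
  refine tsum_congr fun j => ?_
  rw [show (2 * π * Complex.I * ((j : ℂ) - ((1 / 2 : ℝ) : ℂ)) * t : ℂ) =
      (2 * π * (-(1 / 2) + j) * t : ℝ) * Complex.I by push_cast; ring, Complex.re_mul_ofReal,
      Complex.exp_ofReal_mul_I_re, mul_comm, neg_add_eq_sub]

/-- Poisson summation at the half period turns the plain sum into the alternating one; this also
shows that the alternating sum at 0 is positive. -/
theorem sechSum_half : sechSum (1 / 2) = altSechSum 0 := by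
  have h := tsum_exp_mul_sechPi 0 (1 / 2)
  have h1 : ∀ j : ℤ, Complex.exp (2 * π * Complex.I * (j - ((0 : ℝ) : ℂ)) * ((1 / 2 : ℝ) : ℂ)) =
      (((-1 : ℝ) ^ j : ℝ) : ℂ) := fun j => by
    rw [← neg_one_zpow_eq_cexp]
    congr 1
    push_cast
    ring
  simp only [h1] at h
  simp only [Complex.ofReal_zero, mul_zero, zero_mul, Complex.exp_zero, one_mul, sub_zero] at h
  have h2 : ((sechSum (1 / 2) : ℝ) : ℂ) = (altSechSum 0 : ℂ) := by
    rw [sechSum, altSechSum, Complex.ofReal_tsum, Complex.ofReal_tsum, h]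
    refine tsum_congr fun j => ?_
    rw [zero_add]
    push_cast
    rfl
  exact_mod_cast h2

theorem altSechSum_zero_pos : 0 < altSechSum 0 := by
  rw [← sechSum_half]; exact sechSum_pos _

theorem summable_half_mul_sechPi :
    Summable fun j : ℤ => |(-(1 / 2) + j : ℝ)| * sechPi (-(1 / 2) + j) := by
  have h := ((summable_sechPi (-(1 / 2))).mul_left (-(1 / 2))).add (summable_mul_sechPi (-(1 / 2)))
  refine h.norm.congr fun j => ?_
  rw [← add_mul, norm_mul, norm_eq_abs, norm_of_nonneg (sechPi_pos _).le]

/-- The Fourier series has exponentially small coefficients and may be differentiated term by term.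
-/
theorem differentiable_altSechSum : Differentiable ℝ altSechSum := fun t => by
  have h := hasDerivAt_tsum (summable_half_mul_sechPi.mul_left (2 * π))
    (g := fun (j : ℤ) t => sechPi (-(1 / 2) + j) * cos (2 * π * (-(1 / 2) + j) * t))
    (g' := fun (j : ℤ) t => sechPi (-(1 / 2) + j) * (-sin (2 * π * (-(1 / 2) + j) * t) *
      (2 * π * (-(1 / 2) + j))))
    (fun j y => by
      have h := ((hasDerivAt_id' y).const_mul (2 * π * (-(1 / 2) + (j : ℝ)))).cos
      rw [mul_one] at h
      exact h.const_mul _)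
    (fun j y => by
      rw [norm_mul, norm_mul, norm_neg, norm_of_nonneg (sechPi_pos _).le, norm_eq_abs, norm_eq_abs,
        abs_mul, abs_of_pos two_pi_pos]
      calc sechPi (-(1 / 2) + j) * (|sin (2 * π * (-(1 / 2) + j) * y)| *
            (2 * π * |(-(1 / 2) + j : ℝ)|))
          ≤ sechPi (-(1 / 2) + j) * (1 * (2 * π * |(-(1 / 2) + j : ℝ)|)) := by
            have := (sechPi_pos (-(1 / 2) + j)).le
            gcongr
            exact abs_sin_le_one _
        _ = _ := by ring)
    (y₀ := 0) (by simpa using summable_sechPi (-(1 / 2))) t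
  refine (h.congr_of_eventuallyEq (Filter.Eventually.of_forall fun t => ?_)).differentiableAt
  exact altSechSum_eq_tsum_cos t

theorem sechPi_le_one (x : ℝ) : sechPi x ≤ 1 := inv_le_one_of_one_le₀ (one_le_cosh _)

theorem hasDerivAt_tanhPi (x : ℝ) : HasDerivAt tanhPi (π * sechPi x ^ 2) x := by
  have h := (hasDerivAt_id' x).const_mul π
  have h1 := h.sinh.div h.cosh (cosh_pos _).ne'
  refine h1.congr_deriv ?_
  have hc := (cosh_pos (π * x)).ne'
  rw [sechPi]
  field_simp
  linear_combination cosh_sq_sub_sinh_sq (π * x)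

theorem summable_sechPi_sq (t : ℝ) : Summable fun k : ℤ => sechPi (t + k) ^ 2 :=
  (summable_sechPi_mul_sechPi t t).congr fun _ => (sq _).symm

/-- Term-by-term differentiation with a bound uniform on a bounded interval. Antiperiodicity doubles
the resulting sum, which cancels the half in the definition. -/
theorem hasDerivAt_altTanhSum (t : ℝ) :
    HasDerivAt altTanhSum (π * (altSechSum t * sechSum t)) t := by
  set R := |t| + 1 with hR
  have hbd : ∀ y ∈ Set.Ioo (-R) R, |y| ≤ R + 1 ∧ |y + 1| ≤ R + 1 := fun y hy => by
    have h := abs_lt.mpr hy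
    exact ⟨by linarith, (abs_add_le _ _).trans (by rw [abs_one]; linarith)⟩
  have h := hasDerivAt_tsum_of_isPreconnected
    (summable_exp_neg_pi_abs.mul_left (2 * (π * (2 * exp (π * (R + 1))))))
    (isOpen_Ioo (a := -R) (b := R)) isPreconnected_Ioo
    (g := fun (k : ℤ) t => (-1 : ℝ) ^ k * (tanhPi (t + k) - tanhPi (t + 1 + k)))
    (g' := fun (k : ℤ) t => (-1 : ℝ) ^ k * (π * sechPi (t + k) ^ 2 - π * sechPi (t + 1 + k) ^ 2))
    (fun k y _ => by
      have h1 := (hasDerivAt_tanhPi (y + k)).comp_add_const y k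
      have h2 := (hasDerivAt_tanhPi (y + (1 + k))).comp_add_const y (1 + k)
      simp only [← add_assoc] at h2
      exact (h1.sub h2).const_mul _)
    (fun k y hy => by
      have hsq : ∀ x, |x| ≤ R + 1 → π * sechPi (x + k) ^ 2 ≤
          π * (2 * exp (π * (R + 1)) * exp (-(π * |(k : ℝ)|))) := fun x hx => by
        refine mul_le_mul_of_nonneg_left ?_ pi_pos.le
        calc sechPi (x + k) ^ 2 ≤ sechPi (x + k) := by
              rw [sq]; exact mul_le_of_le_one_left (sechPi_pos _).le (sechPi_le_one _)
          _ ≤ _ := sechPi_add_le hx k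
      rw [norm_mul, norm_eq_abs, abs_neg_one_zpow, one_mul]
      refine (norm_sub_le _ _).trans ?_
      rw [norm_of_nonneg (mul_nonneg pi_pos.le (sq_nonneg _)),
        norm_of_nonneg (mul_nonneg pi_pos.le (sq_nonneg _))]
      linarith [hsq _ (hbd y hy).1, hsq _ (hbd y hy).2])
    (y₀ := t) (abs_lt.mp (by linarith))
    (summable_tanhPi_sub (t + 1) t).neg_one_zpow_mul
    (abs_lt.mp (by linarith : |t| < R))
  refine (h.div_const 2).congr_deriv ?_
  have hs : ∀ t, Summable fun k : ℤ => (-1 : ℝ) ^ k * sechPi (t + k) ^ 2 :=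
    fun t => (summable_sechPi_sq t).neg_one_zpow_mul
  have h1 : ∀ k : ℤ, (-1 : ℝ) ^ k * (π * sechPi (t + k) ^ 2 - π * sechPi (t + 1 + k) ^ 2) =
      π * ((-1 : ℝ) ^ k * sechPi (t + k) ^ 2) - π * ((-1 : ℝ) ^ k * sechPi (t + 1 + k) ^ 2) :=
    fun k => by ring
  simp_rw [h1]
  rw [((hs t).mul_left π).tsum_sub ((hs (t + 1)).mul_left π), tsum_mul_left, tsum_mul_left,
    tsum_neg_one_zpow_mul_add_one fun x => sechPi x ^ 2, ← altSechSum_mul_sechSum]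
  ring

/-- The value at the lattice of half periods, the normalizing constant. -/
theorem sechSum_sq (t : ℝ) : sechSum t ^ 2 = altSechSum t ^ 2 + altSechSum 0 ^ 2 := by
  have h := (sechSum_sq_sub_altSechSum_sq t).trans (sechSum_sq_sub_altSechSum_sq (1 / 2)).symm
  rw [altSechSum_half, sechSum_half] at h
  linarith

theorem altSechSum_add_half (t : ℝ) : altSechSum (t + 1 / 2) = -altSechSum (t - 1 / 2) := by
  rw [← altSechSum_add_one]; congr 1; ring

/-- The constant product of `sechSum` and its half-period translate is squared, and both squares are
rewritten by `sechSum_sq`. With λ the value of `altSechSum` at 0, the factors at t = 1/2 are λ² and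
2λ². The result is the lemniscatic analogue of cos² + sin² = 1. -/
theorem altSechSum_curve (t : ℝ) :
    (altSechSum t ^ 2 + altSechSum 0 ^ 2) * (altSechSum (t - 1 / 2) ^ 2 + altSechSum 0 ^ 2) =
      2 * altSechSum 0 ^ 4 := by
  have h := (sechSum_mul_sechSum_sub_half t).trans (sechSum_mul_sechSum_sub_half (1 / 2)).symm
  rw [sub_self, sechSum_half] at h
  have h0 := sechSum_sq 0
  rw [← sechSum_sq, ← sechSum_sq, ← mul_pow, h, mul_pow, h0]
  ring

theorem differentiable_sechSum : Differentiable ℝ sechSum := by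
  have h : sechSum = fun t => √(altSechSum t ^ 2 + altSechSum 0 ^ 2) := funext fun t => by
    rw [← sechSum_sq, sqrt_sq (sechSum_pos t).le]
  rw [h]
  refine fun t => ((differentiable_altSechSum t).pow 2 |>.add_const _).sqrt ?_
  change altSechSum t ^ 2 + altSechSum 0 ^ 2 ≠ 0
  rw [← sechSum_sq]
  exact (pow_pos (sechSum_pos t) 2).ne'

/-- Differentiating the relations `sechSum_sq`, `altSechSum_sub_half_mul_sechSum` and
`altSechSum_curve` gives equations linear in the three derivatives; solving them yields the formula.
-/
theorem hasDerivAt_altSechSum_sub_half (t : ℝ) :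
    HasDerivAt (fun t => altSechSum (t - 1 / 2))
      (altCschSum (1 / 2) * π / altSechSum 0 ^ 2 *
        (altSechSum t * (altSechSum (t - 1 / 2) ^ 2 + altSechSum 0 ^ 2))) t := by
  set lam := altSechSum 0 with hlam
  set mu := altCschSum (1 / 2)
  have hl : lam ≠ 0 := altSechSum_zero_pos.ne'
  have hc := (differentiable_altSechSum t).hasDerivAt
  have hs := (differentiable_altSechSum (t - 1 / 2)).hasDerivAt.comp_sub_const t (1 / 2)
  have hd := (differentiable_sechSum t).hasDerivAt
  have hA := hasDerivAt_altTanhSum t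
  set c' := deriv altSechSum t
  set s' := deriv altSechSum (t - 1 / 2)
  set d' := deriv sechSum t
  refine hs.congr_deriv ?_
  have e1 : 2 * sechSum t * d' = 2 * altSechSum t * c' := by
    have h1 := (hc.pow 2).add_const (lam ^ 2)
    have h2 := hd.pow 2
    have h3 : (sechSum ^ 2 : ℝ → ℝ) = fun t => (altSechSum ^ 2 : ℝ → ℝ) t + lam ^ 2 :=
      funext fun t => sechSum_sq t
    rw [h3] at h2
    have := h2.unique h1
    simpa using this
  have e2 : s' * sechSum t + altSechSum (t - 1 / 2) * d' =
      mu * (π * (altSechSum t * sechSum t)) := by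
    have h1 := hs.mul hd
    have h2 := hA.const_mul mu
    have h3 : ((fun t => altSechSum (t - 1 / 2)) * sechSum : ℝ → ℝ) =
        fun t => mu * altTanhSum t := funext fun t => altSechSum_sub_half_mul_sechSum t
    rw [h3] at h1
    exact h1.unique h2
  have e3 : 2 * altSechSum t * c' * (altSechSum (t - 1 / 2) ^ 2 + lam ^ 2) +
      (altSechSum t ^ 2 + lam ^ 2) * (2 * altSechSum (t - 1 / 2) * s') = 0 := by
    have h1 := ((hc.pow 2).add_const (lam ^ 2)).mul ((hs.pow 2).add_const (lam ^ 2))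
    have h3 : ((fun t => (altSechSum ^ 2 : ℝ → ℝ) t + lam ^ 2) *
        (fun t => ((fun t => altSechSum (t - 1 / 2)) ^ 2 : ℝ → ℝ) t + lam ^ 2) : ℝ → ℝ) =
        fun _ => 2 * lam ^ 4 := funext fun t => altSechSum_curve t
    rw [h3] at h1
    have := h1.unique (hasDerivAt_const t _)
    simpa using this
  have hd0 : sechSum t ≠ 0 := (sechSum_pos t).ne'
  have e4 := sechSum_sq t
  rw [← hlam] at e4
  rw [div_mul_eq_mul_div, eq_div_iff (pow_ne_zero 2 hl)]
  refine mul_right_cancel₀ (pow_ne_zero 2 hd0) ?_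
  set c := altSechSum t
  set s := altSechSum (t - 1 / 2)
  set d := sechSum t
  linear_combination (d * (s ^ 2 + lam ^ 2)) * e2 - (s * (s ^ 2 + lam ^ 2) / 2) * e1 - s / 2 * e3 -
    s ^ 2 * s' * e4

theorem hasDerivAt_altSechSum (t : ℝ) :
    HasDerivAt altSechSum (-(altCschSum (1 / 2) * π / altSechSum 0 ^ 2 *
        (altSechSum (t - 1 / 2) * sechSum t ^ 2))) t := by
  have h := (hasDerivAt_altSechSum_sub_half (t + 1 / 2)).comp_add_const t (1 / 2)
  simp only [add_sub_cancel_right] at h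
  refine h.congr_deriv ?_
  rw [altSechSum_add_half, sechSum_sq]
  ring

theorem summable_alt_cschPi_nat :
    Summable fun n : ℕ => (-1 : ℝ) ^ n * cschPi (1 / 2 + n) := by
  have hs := (summable_cschPi (1 / 2)).neg_one_zpow_mul
  refine (hs.comp_injective (i := fun n : ℕ => (n : ℤ)) Nat.cast_injective).congr fun n => ?_
  simp

theorem altCschSum_half_eq :
    altCschSum (1 / 2) = 2 * ∑' n : ℕ, (-1 : ℝ) ^ n * cschPi (1 / 2 + n) := by
  have h1 := summable_alt_cschPi_nat
  have hp : HasSum (fun n : ℕ => (-1 : ℝ) ^ (n : ℤ) * cschPi (1 / 2 + ((n : ℤ) : ℝ)))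
      (∑' n : ℕ, (-1 : ℝ) ^ n * cschPi (1 / 2 + n)) := by simpa using h1.hasSum
  have hn : HasSum (fun n : ℕ => (-1 : ℝ) ^ (-((n : ℤ) + 1)) *
      cschPi (1 / 2 + ((-((n : ℤ) + 1) : ℤ) : ℝ)))
      (∑' n : ℕ, (-1 : ℝ) ^ n * cschPi (1 / 2 + n)) := by
    refine (congrArg (HasSum · _) (funext fun n => ?_)).mpr h1.hasSum
    rw [neg_one_zpow_neg, neg_one_zpow_add_one, zpow_natCast]
    push_cast
    rw [show (1 / 2 + -((n : ℝ) + 1)) = -(1 / 2 + n) by ring, cschPi_neg]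
    ring
  have h := HasSum.of_nat_of_neg_add_one
    (f := fun k : ℤ => (-1 : ℝ) ^ k * cschPi (1 / 2 + k)) hp hn
  rw [altCschSum, h.tsum_eq]
  ring

/-- The series is twice an alternating series with decreasing terms, so consecutive terms are
paired. -/
theorem altCschSum_half_pos : 0 < altCschSum (1 / 2) := by
  have h1 := summable_alt_cschPi_nat
  rw [altCschSum_half_eq]
  set f : ℕ → ℝ := fun n => (-1 : ℝ) ^ n * cschPi (1 / 2 + n) with hf
  have he : Summable fun n : ℕ => f (2 * n) :=
    h1.comp_injective (i := fun n : ℕ => 2 * n) fun a b h => by simpa using h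
  have ho : Summable fun n : ℕ => f (2 * n + 1) :=
    h1.comp_injective (i := fun n : ℕ => 2 * n + 1) fun a b h => by simpa using h
  have hpos : ∀ n : ℕ, 0 < f (2 * n) + f (2 * n + 1) := fun n => by
    have h : cschPi (1 / 2 + (2 * (n : ℝ) + 1)) < cschPi (1 / 2 + 2 * n) := by
      have hn : (0 : ℝ) ≤ n := n.cast_nonneg
      have := pi_pos
      refine inv_strictAnti₀ (sinh_pos_iff.mpr (by positivity)) (sinh_lt_sinh.mpr ?_)
      exact mul_lt_mul_of_pos_left (by linarith) pi_pos
    have h1 : f (2 * n) = cschPi (1 / 2 + 2 * n) := by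
      simp only [hf]
      rw [Even.neg_one_pow (even_two_mul n), one_mul]
      push_cast
      rfl
    have h2 : f (2 * n + 1) = -cschPi (1 / 2 + (2 * n + 1)) := by
      simp only [hf]
      rw [Odd.neg_one_pow (odd_two_mul_add_one n), neg_one_mul]
      push_cast
      rfl
    rw [h1, h2]
    linarith
  rw [← tsum_even_add_odd he ho, ← he.tsum_add ho]
  generalize f = g at *
  exact mul_pos two_pos ((he.add ho).tsum_pos (fun n => (hpos n).le) 0 (hpos 0))

theorem add_int_ne_zero_of_mem_Ioo {t : ℝ} (ht : t ∈ Set.Ioo (0 : ℝ) 1) (k : ℤ) : t + k ≠ 0 := by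
  intro h
  have h1 : (-1 : ℝ) < k := by linarith [ht.2]
  have h2 : (k : ℝ) < 0 := by linarith [ht.1]
  have h1' : -1 < k := by exact_mod_cast h1
  have h2' : k < 0 := by exact_mod_cast h2
  omega

theorem altCschSum_mul_of_mem_Ioo {t : ℝ} (ht : t ∈ Set.Ioo (0 : ℝ) 1) :
    altCschSum t * altSechSum (t - 1 / 2) = altCschSum (1 / 2) * altSechSum 0 := by
  have h := altCschSum_mul_altSechSum_sub_half
    (add_int_ne_zero_of_mem_Ioo (t := 1 / 2) ⟨by norm_num, by norm_num⟩)
  rw [sub_self] at h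
  rw [h, altCschSum_mul_altSechSum_sub_half (add_int_ne_zero_of_mem_Ioo ht)]

/-- A sign change on (0, 1) would produce a zero, whereas the product with `altCschSum` is a nonzero
constant there. -/
theorem altSechSum_sub_half_pos {t : ℝ} (ht : t ∈ Set.Ioo (0 : ℝ) 1) :
    0 < altSechSum (t - 1 / 2) := by
  by_contra hneg
  have hcont : ContinuousOn (fun t => altSechSum (t - 1 / 2)) (Set.Ioo 0 1) :=
    (differentiable_altSechSum.continuous.comp (continuous_id.sub continuous_const)).continuousOn
  have hmid : (1 / 2 : ℝ) ∈ Set.Ioo (0 : ℝ) 1 := ⟨by norm_num, by norm_num⟩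
  have h0 : (0 : ℝ) ∈ Set.Icc (altSechSum (t - 1 / 2)) (altSechSum (1 / 2 - 1 / 2)) := by
    rw [sub_self]
    exact ⟨not_lt.mp hneg, altSechSum_zero_pos.le⟩
  obtain ⟨x, hx, hx0⟩ := isPreconnected_Ioo.intermediate_value ht hmid hcont h0
  have h := altCschSum_mul_of_mem_Ioo hx
  simp only at hx0
  rw [hx0, mul_zero] at h
  exact (mul_pos altCschSum_half_pos altSechSum_zero_pos).ne h

theorem altSechSum_nonneg {t : ℝ} (ht : t ∈ Set.Icc (0 : ℝ) (1 / 2)) : 0 ≤ altSechSum t := by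
  rcases ht.2.eq_or_lt with h | h
  · rw [h, altSechSum_half]
  · have := altSechSum_sub_half_pos (t := t + 1 / 2) ⟨by linarith [ht.1], by linarith⟩
    rw [add_sub_cancel_right] at this
    exact this.le

/-- Unfolding: the integral over one period of the sum of translates is the integral of sech(πx)
over the line. -/
theorem integral_sechSum : ∫ t in (0 : ℝ)..1, sechSum t = 1 := by
  have h := integrable_sechPi.hasSum_intervalIntegral_comp_add_int
  rw [integral_sechPi] at h
  have hi : ∀ n : ℤ, Integrable (fun x => sechPi (x + n)) (volume.restrict (Set.Ioc 0 1)) :=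
    fun n => (integrable_sechPi.comp_add_right (n : ℝ)).integrableOn
  simp only [intervalIntegral.integral_of_le zero_le_one] at h ⊢
  have h2 := hasSum_integral_of_summable_integral_norm hi
    (h.summable.congr fun n => integral_congr_ae (Filter.Eventually.of_forall fun x =>
      (norm_of_nonneg (sechPi_pos _).le).symm))
  exact h2.unique h

theorem integral_zero_half_eq {f : ℝ → ℝ} (hf : ∀ t, f (1 - t) = f t)
    (hi : IntervalIntegrable f volume 0 1) :
    ∫ t in (0 : ℝ)..1, f t = 2 * ∫ t in (0 : ℝ)..(1 / 2), f t := by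
  have h1 : IntervalIntegrable f volume 0 (1 / 2) := hi.mono_set (by
    rw [Set.uIcc_of_le (by norm_num), Set.uIcc_of_le (by norm_num)]
    exact Set.Icc_subset_Icc_right (by norm_num))
  have h2 : IntervalIntegrable f volume (1 / 2) 1 := hi.mono_set (by
    rw [Set.uIcc_of_le (by norm_num), Set.uIcc_of_le (by norm_num)]
    exact Set.Icc_subset_Icc_left (by norm_num))
  rw [← intervalIntegral.integral_add_adjacent_intervals h1 h2]
  have h3 := intervalIntegral.integral_comp_sub_left f (a := 0) (b := 1 / 2) 1
  simp only [hf, sub_zero] at h3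
  rw [show (1 - 1 / 2 : ℝ) = 1 / 2 by norm_num] at h3
  rw [← h3]
  ring

/-- The differential equation is so far known only up to the constant μ/λ. With c = `altSechSum` t
and Y = (μ/λ) · `altTanhSum` t, the point (c, Y) lies on the circle of radius λ. Its half-angle
arctan(Y / (λ + c)) has derivative (μ/λ)(π/2) · `sechSum` and runs from 0 to π/4 on [0, 1/2]. Since
`sechSum` has integral 1/2 there, μ = λ. -/
theorem altCschSum_half : altCschSum (1 / 2) = altSechSum 0 := by
  set lam := altSechSum 0 with hlam
  set mu := altCschSum (1 / 2) with hmu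
  have hl : 0 < lam := altSechSum_zero_pos
  have hY : ∀ t, HasDerivAt (fun t => mu / lam * altTanhSum t)
      (mu / lam * (π * (altSechSum t * sechSum t))) t :=
    fun t => (hasDerivAt_altTanhSum t).const_mul _
  have hX : ∀ t, HasDerivAt (fun t => lam + altSechSum t) _ t :=
    fun t => (hasDerivAt_altSechSum t).const_add lam
  have hYe : ∀ t, mu / lam * altTanhSum t = altSechSum (t - 1 / 2) * sechSum t / lam := fun t => by
    rw [altSechSum_sub_half_mul_sechSum]; ring
  have hG : ∀ t ∈ Set.uIcc (0 : ℝ) (1 / 2),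
      HasDerivAt (fun t => arctan (mu / lam * altTanhSum t / (lam + altSechSum t)))
        (mu / lam * π / 2 * sechSum t) t := fun t ht => by
    rw [Set.uIcc_of_le (by norm_num)] at ht
    have hX0 : 0 < lam + altSechSum t := add_pos_of_pos_of_nonneg hl (altSechSum_nonneg ht)
    refine (((hY t).div (hX t) hX0.ne').arctan).congr_deriv ?_
    have e1 := altSechSum_curve t
    have e2 := sechSum_sq t
    rw [← hlam] at e1 e2 ⊢
    rw [← hmu]
    simp only [Pi.div_apply]
    rw [hYe t]
    set c := altSechSum t
    set s := altSechSum (t - 1 / 2)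
    set d := sechSum t
    -- This is the circle equation: s·d/λ and c are the coordinates of a point at distance λ from
    -- the origin.
    have e3 : s ^ 2 * d ^ 2 = lam ^ 2 * (lam ^ 2 - c ^ 2) := by
      rw [e2]; linear_combination e1
    have hden : (1 + (s * d / lam / (lam + c)) ^ 2) = 2 * lam / (lam + c) := by
      field_simp
      linear_combination e3
    rw [hden]
    field_simp
    linear_combination (mu * d) * e3
  have hint := intervalIntegral.integral_eq_sub_of_hasDerivAt hG
    ((continuous_const.mul differentiable_sechSum.continuous).intervalIntegrable _ _)
  have hsym : ∀ t, sechSum (1 - t) = sechSum t := fun t => by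
    rw [← sechSum_neg t, ← sechSum_add_one (-t)]; congr 1; ring
  have hhalf := integral_zero_half_eq hsym (differentiable_sechSum.continuous.intervalIntegrable _ _)
  rw [integral_sechSum] at hhalf
  have h0 : altSechSum (0 - 1 / 2) = 0 := by
    rw [zero_sub, altSechSum_neg, altSechSum_half]
  rw [intervalIntegral.integral_const_mul, hYe, hYe, h0, sub_self, altSechSum_half, sechSum_half,
    ← hlam, zero_mul, zero_div, zero_div, arctan_zero, add_zero,
    mul_div_cancel_right₀ _ hl.ne', div_self hl.ne', arctan_one, sub_zero] at hint
  have : mu / lam = 1 := by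
    have h1 : ∫ t in (0 : ℝ)..(1 / 2), sechSum t = 1 / 2 := by linarith
    rw [h1] at hint
    have := pi_pos
    field_simp at hint ⊢
    linarith
  rwa [div_eq_one_iff_eq hl.ne'] at this

end LemniscateODE

/-! ### The sine transform of csch -/

section SineIntegrals

open Real MeasureTheory

/-- Imaginary part of the partial fraction expansion of π cot(πz) at z = 1/2 + ix. The expansion
pairs n with n + 1, so the sum is recovered from that of `e n + e (n + 1)`. -/
theorem hasSum_div_sq_add_sq (x : ℝ) :
    HasSum (fun n : ℕ => x / ((n + 1 / 2 : ℝ) ^ 2 + x ^ 2)) (π / 2 * tanhPi x) := by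
  rcases eq_or_ne x 0 with rfl | hx
  · simp only [zero_div, tanhPi, mul_zero, sinh_zero]
    exact hasSum_zero
  set z : ℂ := ⟨1 / 2, x⟩ with hz
  have hzc : z ∈ Complex.integerComplement := by
    rintro ⟨k, hk⟩
    exact hx (by simpa [hz] using (congrArg Complex.im hk).symm)
  have hinv : ∀ a : ℝ, (1 / (⟨a, x⟩ : ℂ)).im = -(x / (a ^ 2 + x ^ 2)) := fun a => by
    rw [one_div, Complex.inv_im, Complex.normSq_mk, ← sq, ← sq, neg_div]
  set e : ℕ → ℝ := fun n => x / ((n + 1 / 2 : ℝ) ^ 2 + x ^ 2) with he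
  have hterm : ∀ n : ℕ, (1 / (z - (n + 1)) + 1 / (z + (n + 1))).im = -(e n + e (n + 1)) :=
    fun n => by
      have h1 : z - (n + 1) = ⟨-(n + 1 / 2), x⟩ := Complex.ext (by simp [hz]; ring) (by simp [hz])
      have h2 : z + (n + 1) = ⟨(n + 1 : ℕ) + 1 / 2, x⟩ :=
        Complex.ext (by simp [hz]; ring) (by simp [hz])
      rw [h1, h2, Complex.add_im, hinv, hinv, neg_sq]
      simp only [he]
      ring
  have hcs : Summable fun n : ℕ => 1 / (z - (n + 1)) + 1 / (z + (n + 1)) := summable_cotTerm hzc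
  have hsum := Complex.hasSum_im (cot_series_rep' hzc ▸ hcs.hasSum)
  simp only [hterm] at hsum
  have hcot : (π * Complex.cot (π * z) - 1 / z).im = -(π * tanhPi x) + e 0 := by
    have h1 : (π * z : ℂ) = ((π * x : ℝ) : ℂ) * Complex.I + π / 2 := by
      apply Complex.ext <;> simp [hz]
      ring
    rw [Complex.cot, h1, Complex.cos_add_pi_div_two, Complex.sin_add_pi_div_two, Complex.sin_mul_I,
      Complex.cos_mul_I, ← Complex.ofReal_sinh, ← Complex.ofReal_cosh, Complex.sub_im, hinv,
      show (π : ℂ) * (-((sinh (π * x) : ℝ) * Complex.I) / (cosh (π * x) : ℝ)) =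
        ((-(π * tanhPi x) : ℝ) : ℂ) * Complex.I by rw [tanhPi]; push_cast; ring]
    simp [he]
  rw [hcot] at hsum
  have hsum2 : HasSum (fun n => e n + e (n + 1)) (π * tanhPi x - e 0) := by
    have := hsum.neg
    simpa [sub_eq_add_neg, add_comm] using this
  -- All terms have the sign of `x`, so each is dominated by the corresponding pair.
  have hes : Summable e := by
    refine Summable.of_norm_bounded hsum2.summable.norm fun n => ?_
    have hp : ∀ n : ℕ, 0 < ((n + 1 / 2 : ℝ) ^ 2 + x ^ 2) := fun n => by positivity
    have : ∀ n, e n = x * (((n + 1 / 2 : ℝ) ^ 2 + x ^ 2))⁻¹ := fun n => div_eq_mul_inv _ _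
    rw [this, this, ← mul_add, norm_mul, norm_mul]
    refine mul_le_mul_of_nonneg_left ?_ (norm_nonneg _)
    have h1 := inv_pos.mpr (hp n)
    have h2 := inv_pos.mpr (hp (n + 1))
    rw [norm_of_nonneg h1.le, norm_of_nonneg (by positivity)]
    linarith
  have h1 := hes.tsum_eq_zero_add
  have h2 := hsum2.tsum_eq
  rw [hes.tsum_add ((summable_nat_add_iff 1).mpr hes)] at h2
  have : ∑' n, e n = π / 2 * tanhPi x := by linarith
  exact this ▸ hes.hasSum

theorem cschPi_eq_tsum {t : ℝ} (ht : 0 < t) :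
    HasSum (fun k : ℕ => 2 * exp (-((2 * k + 1) * π * t))) (cschPi t) := by
  have hr : exp (-(2 * π * t)) < 1 := exp_lt_one_iff.mpr (by have := mul_pos pi_pos ht; linarith)
  have h := (hasSum_geometric_of_lt_one (exp_pos _).le hr).mul_left (2 * exp (-(π * t)))
  have h1 : 2 * exp (-(π * t)) * (1 - exp (-(2 * π * t)))⁻¹ = cschPi t := by
    rw [cschPi, sinh_eq, show -(2 * π * t) = -(π * t) + -(π * t) by ring, exp_add] at *
    have h2 : exp (π * t) = (exp (-(π * t)))⁻¹ := by rw [exp_neg, inv_inv]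
    have h3 := exp_pos (-(π * t))
    rw [h2]
    generalize exp (-(π * t)) = q at *
    have : 1 - q * q ≠ 0 := by linarith
    have h4 : q⁻¹ - q ≠ 0 := by
      rw [show q⁻¹ - q = (1 - q * q) / q by field_simp]
      positivity
    field_simp
  rw [h1] at h
  refine (congrArg (HasSum · _) (funext fun k => ?_)).mpr h
  rw [← exp_nat_mul, mul_assoc 2 (exp _), ← exp_add]
  congr 2
  ring

theorem integral_sin_mul_exp {a b : ℝ} (hb : 0 < b) :
    ∫ t in Set.Ioi (0 : ℝ), sin (a * t) * exp (-(b * t)) = a / (a ^ 2 + b ^ 2) := by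
  have hre : (⟨-b, a⟩ : ℂ).re < 0 := by simpa using hb
  have h := integral_exp_mul_complex_Ioi hre 0
  have hi := integrableOn_exp_mul_complex_Ioi hre 0
  have h1 : ∀ t : ℝ, sin (a * t) * exp (-(b * t)) = (Complex.exp ((⟨-b, a⟩ : ℂ) * t)).im :=
    fun t => by
      rw [Complex.exp_im]
      simp
      ring
  simp_rw [h1]
  have h2 := integral_im hi
  simp only [RCLike.im_to_complex] at h2
  rw [h2, h]
  simp only [Complex.ofReal_zero, mul_zero, Complex.exp_zero]
  rw [neg_div, Complex.neg_im, one_div, Complex.inv_im, Complex.normSq_mk]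
  have : 0 < a ^ 2 + b ^ 2 := by positivity
  rw [neg_div, neg_neg]
  congr 1
  ring

theorem integral_mul_exp_neg {b : ℝ} (hb : 0 < b) :
    ∫ t in Set.Ioi (0 : ℝ), t * exp (-(b * t)) = 1 / b ^ 2 := by
  have h := integral_rpow_mul_exp_neg_mul_Ioi two_pos hb
  rw [Gamma_two, mul_one, rpow_two, one_div_pow] at h
  rw [← h]
  refine setIntegral_congr_fun measurableSet_Ioi fun t _ => ?_
  rw [show (2 : ℝ) - 1 = 1 by norm_num, rpow_one]

theorem integrableOn_mul_exp_neg {b : ℝ} (hb : 0 < b) :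
    IntegrableOn (fun t : ℝ => t * exp (-(b * t))) (Set.Ioi 0) :=
  .of_integral_ne_zero (by rw [integral_mul_exp_neg hb]; positivity)

/-- Expand csch in odd exponentials and integrate term by term: the Laplace transforms of the sine
form the partial fraction series of tanh. The bound |sin u| ≤ |u| makes the integrals of the norms
summable despite the pole at 0. -/
theorem integral_Ioi_sin_mul_cschPi (x : ℝ) :
    ∫ t in Set.Ioi (0 : ℝ), sin (2 * π * x * t) * cschPi t = tanhPi x / 2 := by
  set F : ℕ → ℝ → ℝ := fun k t => sin (2 * π * x * t) * (2 * exp (-((2 * k + 1) * π * t))) with hF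
  have hb : ∀ k : ℕ, 0 < (2 * k + 1) * π := fun k => by have := pi_pos; positivity
  have hbound : ∀ k : ℕ, ∀ t ∈ Set.Ioi (0 : ℝ),
      ‖F k t‖ ≤ 4 * π * |x| * (t * exp (-((2 * k + 1) * π * t))) := fun k t ht => by
    have ht' : (0 : ℝ) < t := ht
    rw [hF]
    simp only
    rw [norm_mul, norm_mul, norm_of_nonneg (exp_pos _).le, norm_two, norm_eq_abs]
    have h1 : |sin (2 * π * x * t)| ≤ 2 * π * |x| * t := by
      refine abs_sin_le_abs.trans ?_
      rw [abs_mul, abs_mul, abs_of_pos two_pi_pos, abs_of_pos ht']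
    calc _ ≤ 2 * π * |x| * t * (2 * exp (-((2 * k + 1) * π * t))) := by gcongr
      _ = _ := by ring
  have hFi : ∀ k, IntegrableOn (F k) (Set.Ioi 0) := fun k =>
    ((integrableOn_mul_exp_neg (hb k)).const_mul (4 * π * |x|)).mono'
      (by refine Continuous.aestronglyMeasurable ?_; simp only [hF]; fun_prop)
      (ae_restrict_of_forall_mem measurableSet_Ioi (hbound k))
  have hint : ∀ k, ∫ t in Set.Ioi (0 : ℝ), F k t =
      1 / π * (x / ((k + 1 / 2 : ℝ) ^ 2 + x ^ 2)) := fun k => by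
    simp only [hF]
    have h := integral_sin_mul_exp (a := 2 * π * x) (hb k)
    have h2 : ∀ t : ℝ, sin (2 * π * x * t) * (2 * exp (-((2 * k + 1) * π * t))) =
      2 * (sin (2 * π * x * t) * exp (-((2 * k + 1) * π * t))) := fun t => by ring
    simp_rw [h2]
    rw [integral_const_mul, h]
    have := pi_pos
    have h3 : 0 < (k + 1 / 2 : ℝ) ^ 2 + x ^ 2 := by positivity
    have h4 : 0 < (2 * π * x) ^ 2 + ((2 * k + 1) * π) ^ 2 := by positivity
    field_simp
    ring
  have hsn : Summable fun k => ∫ t in Set.Ioi (0 : ℝ), ‖F k t‖ := by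
    have hs : Summable fun k : ℕ => 4 * |x| / π * (1 / ((k : ℝ) + 1) ^ 2) := by
      refine Summable.mul_left _ ?_
      have := (summable_nat_add_iff 1).mpr (summable_one_div_nat_pow.mpr one_lt_two)
      simpa using this
    refine Summable.of_nonneg_of_le (fun k => integral_nonneg fun _ => norm_nonneg _)
      (fun k => ?_) hs
    calc ∫ t in Set.Ioi (0 : ℝ), ‖F k t‖
        ≤ ∫ t in Set.Ioi (0 : ℝ), 4 * π * |x| * (t * exp (-((2 * k + 1) * π * t))) :=
          setIntegral_mono_on (hFi k).norm ((integrableOn_mul_exp_neg (hb k)).const_mul _)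
            measurableSet_Ioi (hbound k)
      _ = 4 * |x| / π * (1 / (2 * k + 1 : ℝ) ^ 2) := by
          rw [integral_const_mul, integral_mul_exp_neg (hb k)]
          have := pi_pos
          field_simp
      _ ≤ _ := by
          have := pi_pos
          have hk : (0 : ℝ) ≤ k := k.cast_nonneg
          gcongr
          linarith
  have h1 := hasSum_integral_of_summable_integral_norm hFi hsn
  simp only [hint] at h1
  have h2 := h1.unique ((hasSum_div_sq_add_sq x).mul_left (1 / π))
  have h3 : ∫ t in Set.Ioi (0 : ℝ), sin (2 * π * x * t) * cschPi t =
      ∫ t in Set.Ioi (0 : ℝ), ∑' k, F k t :=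
    setIntegral_congr_fun measurableSet_Ioi fun t ht =>
      ((cschPi_eq_tsum ht).mul_left (sin (2 * π * x * t))).tsum_eq.symm
  rw [h3, h2]
  have := pi_pos
  field_simp

theorem sin_mul_cschPi_neg (x t : ℝ) :
    sin (2 * π * x * -t) * cschPi (-t) = sin (2 * π * x * t) * cschPi t := by
  rw [mul_neg, sin_neg, cschPi_neg, neg_mul_neg]

theorem integrable_sin_mul_cschPi (x : ℝ) :
    Integrable fun t : ℝ => sin (2 * π * x * t) * cschPi t := by
  have hmeas : Measurable fun t : ℝ => sin (2 * π * x * t) * cschPi t := by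
    unfold cschPi
    fun_prop
  -- The constant 2 serves for |t| ≥ 1/2. For |t| < 1/2 the sine cancels the pole, and cosh(π/2)
  -- compensates the decay of sech.
  refine (integrable_sechPi.const_mul (2 + 2 * |x| * cosh (π / 2))).mono'
    hmeas.aestronglyMeasurable (Filter.Eventually.of_forall fun t => ?_)
  have hc1 := one_le_cosh (π / 2)
  have hs0 := sechPi_pos t
  rw [norm_mul, norm_eq_abs, norm_eq_abs]
  rcases le_or_gt (1 / 2) |t| with h | h
  · calc |sin (2 * π * x * t)| * |cschPi t| ≤ 1 * (2 * sechPi t) := by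
          gcongr
          · exact abs_sin_le_one _
          · exact abs_cschPi_le h
      _ ≤ _ := by
          have : 0 ≤ 2 * |x| * cosh (π / 2) * sechPi t := by positivity
          linarith
  · have h1 : |sin (2 * π * x * t)| ≤ 2 * |x| * (π * |t|) := by
      refine abs_sin_le_abs.trans ?_
      rw [abs_mul, abs_mul, abs_of_pos two_pi_pos]
      linarith
    have h2 : π * |t| * |cschPi t| ≤ 1 := by
      have h3 : π * |t| ≤ |sinh (π * t)| := by
        rw [abs_sinh, abs_mul, abs_of_pos pi_pos]
        exact self_le_sinh_iff.mpr (by have := pi_pos; positivity)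
      rw [cschPi, abs_inv, ← div_eq_mul_inv]
      exact div_le_one_of_le₀ h3 (abs_nonneg _)
    have h4 : 1 ≤ cosh (π / 2) * sechPi t := by
      rw [sechPi, ← div_eq_mul_inv, one_le_div (cosh_pos _), cosh_le_cosh, abs_mul,
        abs_of_pos pi_pos, abs_of_pos (half_pos pi_pos)]
      have := pi_pos
      nlinarith
    calc |sin (2 * π * x * t)| * |cschPi t| ≤ 2 * |x| * (π * |t|) * |cschPi t| := by gcongr
      _ = 2 * |x| * (π * |t| * |cschPi t|) := by ring
      _ ≤ 2 * |x| * 1 := by gcongr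
      _ ≤ 2 * |x| * (cosh (π / 2) * sechPi t) := by gcongr
      _ ≤ _ := by linarith

theorem integral_sin_mul_cschPi (x : ℝ) :
    ∫ t : ℝ, sin (2 * π * x * t) * cschPi t = tanhPi x := by
  have h := integral_comp_abs (f := fun t => sin (2 * π * x * t) * cschPi t)
  rw [integral_Ioi_sin_mul_cschPi] at h
  rw [mul_div_cancel₀ _ two_ne_zero] at h
  rw [← h]
  refine integral_congr_ae (Filter.Eventually.of_forall fun t => ?_)
  simp only
  rcases abs_choice t with h | h
  · rw [h]
  · rw [h, sin_mul_cschPi_neg]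

end SineIntegrals

/-! ### The Fourier series of the arctangent of the lemniscate sine -/

section ArctanIntegral

open Real MeasureTheory

theorem altCschSum_neg (t : ℝ) : altCschSum (-t) = -altCschSum t := by
  rw [altCschSum, ← (Equiv.neg ℤ).tsum_eq, altCschSum, ← tsum_neg]
  refine tsum_congr fun k => ?_
  rw [Equiv.neg_apply, neg_one_zpow_neg, Int.cast_neg, ← neg_add, cschPi_neg, mul_neg]

theorem altCschSum_one_sub (t : ℝ) : altCschSum (1 - t) = altCschSum t := by
  have h := tsum_neg_one_zpow_mul_add_one cschPi (-t)
  change altCschSum (-t + 1) = -altCschSum (-t) at h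
  rw [neg_add_eq_sub, altCschSum_neg, neg_neg] at h
  exact h

/-- Sines of half-integer frequency are antiperiodic, so folding the line onto [0, 1] produces
exactly the alternating sum `altCschSum`. -/
theorem sin_half_int_add_int (j k : ℤ) (t : ℝ) :
    sin (2 * π * (-(1 / 2) + j) * (t + k)) = (-1) ^ k * sin (2 * π * (-(1 / 2) + j) * t) := by
  have h : 2 * π * (-(1 / 2) + (j : ℝ)) * (t + k) =
      2 * π * (-(1 / 2) + j) * t + (((2 * j - 1) * k : ℤ) : ℝ) * π := by push_cast; ring
  rw [h, sin_add_int_mul_pi]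
  congr 1
  rw [zpow_mul, sub_eq_add_neg, zpow_add₀ (by norm_num), zpow_mul]
  norm_num

theorem sin_half_int_one_sub (j : ℤ) (t : ℝ) :
    sin (2 * π * (-(1 / 2) + j) * (1 - t)) = sin (2 * π * (-(1 / 2) + j) * t) := by
  have h := sin_half_int_add_int j 1 (-t)
  rw [Int.cast_one, mul_neg, sin_neg, zpow_one, show -t + 1 = 1 - t by ring] at h
  rw [h]
  ring

theorem tsum_sin_mul_cschPi (j : ℤ) (t : ℝ) :
    ∑' k : ℤ, sin (2 * π * (-(1 / 2) + j) * (t + k)) * cschPi (t + k) =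
      sin (2 * π * (-(1 / 2) + j) * t) * altCschSum t := by
  rw [altCschSum, ← tsum_mul_left]
  refine tsum_congr fun k => ?_
  rw [sin_half_int_add_int]
  ring

theorem integral_sin_mul_altCschSum (j : ℤ) :
    ∫ t in (0 : ℝ)..1, sin (2 * π * (-(1 / 2) + j) * t) * altCschSum t =
      tanhPi (-(1 / 2) + j) := by
  set f : ℝ → ℝ := fun t => sin (2 * π * (-(1 / 2) + j) * t) * cschPi t with hf
  have hfi : Integrable f := integrable_sin_mul_cschPi _
  have h := hfi.hasSum_intervalIntegral_comp_add_int
  have hn := hfi.norm.hasSum_intervalIntegral_comp_add_int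
  have hi : ∀ n : ℤ, Integrable (fun x => f (x + n)) (volume.restrict (Set.Ioc 0 1)) :=
    fun n => (hfi.comp_add_right (n : ℝ)).integrableOn
  simp only [intervalIntegral.integral_of_le zero_le_one] at h hn ⊢
  have h2 := hasSum_integral_of_summable_integral_norm hi hn.summable
  have h3 := h2.unique h
  rw [hf] at h3
  simp only [tsum_sin_mul_cschPi, integral_sin_mul_cschPi] at h3
  exact h3

theorem tanhPi_half_int_ne_zero (j : ℤ) : tanhPi (-(1 / 2) + j) ≠ 0 := by
  refine div_ne_zero (sinh_pi_mul_ne_zero fun h => ?_) (cosh_pos _).ne'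
  exact int_cast_ne_half j (by linarith)

/-- A non-integrable function has integral 0 by convention, so the nonzero value already computed
implies integrability. -/
theorem intervalIntegrable_sin_mul_altCschSum (j : ℤ) :
    IntervalIntegrable (fun t => sin (2 * π * (-(1 / 2) + j) * t) * altCschSum t) volume 0 1 :=
  intervalIntegral.intervalIntegrable_of_integral_ne_zero
    (by rw [integral_sin_mul_altCschSum]; exact tanhPi_half_int_ne_zero j)

theorem integral_half_sin_mul_altCschSum (j : ℤ) :
    ∫ t in (0 : ℝ)..(1 / 2), sin (2 * π * (-(1 / 2) + j) * t) * altCschSum t =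
      tanhPi (-(1 / 2) + j) / 2 := by
  have h := integral_zero_half_eq
    (f := fun t => sin (2 * π * (-(1 / 2) + j) * t) * altCschSum t)
    (fun t => by simp only [sin_half_int_one_sub, altCschSum_one_sub])
    (intervalIntegrable_sin_mul_altCschSum j)
  rw [integral_sin_mul_altCschSum] at h
  linarith

theorem abs_sin_nat_mul_le (n : ℕ) (x : ℝ) : |sin (n * x)| ≤ n * |sin x| := by
  induction n with
  | zero => simp
  | succ n ih =>
    push_cast
    rw [add_mul, one_mul, sin_add]
    calc |sin (n * x) * cos x + cos (n * x) * sin x|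
        ≤ |sin (n * x)| * |cos x| + |cos (n * x)| * |sin x| := by
          rw [← abs_mul, ← abs_mul]; exact abs_add_le _ _
      _ ≤ n * |sin x| * 1 + 1 * |sin x| := by
          gcongr
          · exact abs_cos_le_one _
          · exact abs_cos_le_one _
      _ = _ := by ring

theorem abs_sin_int_mul_le (n : ℤ) (x : ℝ) : |sin (n * x)| ≤ |(n : ℝ)| * |sin x| := by
  rcases Int.eq_nat_or_neg n with ⟨m, rfl | rfl⟩
  · simpa using abs_sin_nat_mul_le m x
  · simpa using abs_sin_nat_mul_le m x

theorem half_int_ne_zero (j : ℤ) : (-(1 / 2) + j : ℝ) ≠ 0 :=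
  fun h => int_cast_ne_half j (by linarith)

/-- Bounding by |sin πt| instead of 1 keeps the zero at the origin that offsets the pole of
`altCschSum`, while the factor linear in the frequency is absorbed by `arctanCoeff`. -/
theorem abs_sin_half_int_le (j : ℤ) (t : ℝ) :
    |sin (2 * π * (-(1 / 2) + j) * t)| ≤ 2 * |(-(1 / 2) + j : ℝ)| * |sin (π * t)| := by
  have h := abs_sin_int_mul_le (2 * j - 1) (π * t)
  rw [show (2 * π * (-(1 / 2) + j) * t : ℝ) = ((2 * j - 1 : ℤ) : ℝ) * (π * t) by push_cast; ring]
  refine h.trans (le_of_eq ?_)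
  rw [show (((2 * j - 1 : ℤ)) : ℝ) = 2 * (-(1 / 2) + j) by push_cast; ring, abs_mul, abs_two]

/-- The coefficients of the Fourier sine series of the arctangent of the lemniscate sine. -/
noncomputable def arctanCoeff (j : ℤ) : ℝ := sechPi (-(1 / 2) + j) / (2 * (-(1 / 2) + j))

theorem abs_arctanCoeff_mul_sin_le (j : ℤ) (t : ℝ) :
    |arctanCoeff j * sin (2 * π * (-(1 / 2) + j) * t)| ≤
      sechPi (-(1 / 2) + j) * |sin (π * t)| := by
  have h0 := abs_pos.mpr (half_int_ne_zero j)
  rw [arctanCoeff, abs_mul, abs_div, abs_mul, abs_two, abs_of_pos (sechPi_pos _)]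
  calc sechPi (-(1 / 2) + j) / (2 * |(-(1 / 2) + j : ℝ)|) * |sin (2 * π * (-(1 / 2) + j) * t)|
      ≤ sechPi (-(1 / 2) + j) / (2 * |(-(1 / 2) + j : ℝ)|) *
          (2 * |(-(1 / 2) + j : ℝ)| * |sin (π * t)|) := by
        have := sechPi_pos (-(1 / 2) + j)
        gcongr
        exact abs_sin_half_int_le j t
    _ = _ := by
        generalize |(-(1 / 2) + j : ℝ)| = a at *
        field_simp

theorem hasDerivAt_tsum_arctanCoeff (t : ℝ) :
    HasDerivAt (fun t => ∑' j : ℤ, arctanCoeff j * sin (2 * π * (-(1 / 2) + j) * t))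
      (π * altSechSum t) t := by
  have h := hasDerivAt_tsum ((summable_sechPi (-(1 / 2))).mul_left π)
    (g := fun (j : ℤ) t => arctanCoeff j * sin (2 * π * (-(1 / 2) + j) * t))
    (g' := fun (j : ℤ) t => π * (sechPi (-(1 / 2) + j) * cos (2 * π * (-(1 / 2) + j) * t)))
    (fun j y => by
      have h := ((hasDerivAt_id' y).const_mul (2 * π * (-(1 / 2) + (j : ℝ)))).sin
      refine (h.const_mul (arctanCoeff j)).congr_deriv ?_
      have := half_int_ne_zero j
      rw [arctanCoeff]
      generalize (-(1 / 2) + j : ℝ) = a at *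
      field_simp)
    (fun j y => by
      rw [norm_mul, norm_mul, norm_of_nonneg pi_pos.le, norm_of_nonneg (sechPi_pos _).le]
      have := (sechPi_pos (-(1 / 2) + j)).le
      have := pi_pos.le
      gcongr
      exact mul_le_of_le_one_right (by assumption) (abs_cos_le_one _))
    (y₀ := 0) (by simp) t
  refine h.congr_deriv ?_
  rw [altSechSum_eq_tsum_cos, tsum_mul_left]

theorem hasDerivAt_lemniscate (t : ℝ) :
    HasDerivAt (fun t => altSechSum (t - 1 / 2) / altSechSum 0)
      (π * altSechSum t * (1 + (altSechSum (t - 1 / 2) / altSechSum 0) ^ 2)) t := by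
  have hl := altSechSum_zero_pos.ne'
  refine ((hasDerivAt_altSechSum_sub_half t).div_const _).congr_deriv ?_
  rw [altCschSum_half]
  field_simp
  ring

/-- The factor 1 + w² in the differential equation is the denominator in the derivative of arctan,
so only `altSechSum`, with its explicit Fourier series, remains. -/
theorem hasDerivAt_arctan_lemniscate (t : ℝ) :
    HasDerivAt (fun t => arctan (altSechSum (t - 1 / 2) / altSechSum 0)) (π * altSechSum t) t := by
  refine (hasDerivAt_lemniscate t).arctan.congr_deriv ?_
  have : 1 + (altSechSum (t - 1 / 2) / altSechSum 0) ^ 2 ≠ 0 := by positivity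
  field_simp

theorem altSechSum_zero_sub_half : altSechSum (0 - 1 / 2) = 0 := by
  rw [zero_sub, altSechSum_neg, altSechSum_half]

/-- Both sides have the same derivative and vanish at 0. -/
theorem arctan_lemniscate_eq_tsum (t : ℝ) :
    arctan (altSechSum (t - 1 / 2) / altSechSum 0) =
      ∑' j : ℤ, arctanCoeff j * sin (2 * π * (-(1 / 2) + j) * t) := by
  have hd : ∀ t, HasDerivAt ((fun t => arctan (altSechSum (t - 1 / 2) / altSechSum 0)) -
      fun t => ∑' j : ℤ, arctanCoeff j * sin (2 * π * (-(1 / 2) + j) * t)) 0 t := fun t =>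
    ((hasDerivAt_arctan_lemniscate t).sub (hasDerivAt_tsum_arctanCoeff t)).congr_deriv (sub_self _)
  have h := is_const_of_deriv_eq_zero (fun t => (hd t).differentiableAt) (fun t => (hd t).deriv) t 0
  simp only [Pi.sub_apply, altSechSum_zero_sub_half, zero_div, arctan_zero, mul_zero, sin_zero,
    tsum_zero, sub_zero] at h
  linarith

/-- The integral of the arctangent of the lemniscate sine against `altCschSum`. -/
theorem integral_arctan_lemniscate_mul_altCschSum :
    ∫ t in (0 : ℝ)..(1 / 2), arctan (altSechSum (t - 1 / 2) / altSechSum 0) * altCschSum t =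
      ∑' j : ℤ, sechPi (-(1 / 2) + j) * tanhPi (-(1 / 2) + j) / (4 * (-(1 / 2) + j)) := by
  have hle : (0 : ℝ) ≤ 1 / 2 := by norm_num
  have hsub : Set.Ioc (0 : ℝ) (1 / 2) ⊆ Set.Ioc 0 1 := Set.Ioc_subset_Ioc_right (by norm_num)
  have hsi : ∀ j : ℤ, IntegrableOn (fun t => sin (2 * π * (-(1 / 2) + j) * t) * altCschSum t)
      (Set.Ioc 0 (1 / 2)) := fun j =>
    ((intervalIntegrable_iff_integrableOn_Ioc_of_le zero_le_one).mp
      (intervalIntegrable_sin_mul_altCschSum j)).mono_set hsub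
  set F : ℤ → ℝ → ℝ := fun j t => arctanCoeff j * (sin (2 * π * (-(1 / 2) + j) * t) * altCschSum t)
    with hF
  have hFi : ∀ j, IntegrableOn (F j) (Set.Ioc 0 (1 / 2)) := fun j => (hsi j).const_mul _
  -- The dominating function is the absolute value of the integrand for `j = 1`, whose frequency is
  -- 1/2.
  have h1 : IntegrableOn (fun t => |sin (π * t)| * |altCschSum t|) (Set.Ioc 0 (1 / 2)) := by
    refine (hsi 1).norm.congr (Filter.Eventually.of_forall fun t => ?_)
    simp only [norm_mul, norm_eq_abs]
    congr 3
    push_cast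
    ring
  have hbound : ∀ j t, ‖F j t‖ ≤ sechPi (-(1 / 2) + j) * (|sin (π * t)| * |altCschSum t|) :=
    fun j t => by
      rw [hF]
      simp only
      rw [← mul_assoc, norm_mul, ← mul_assoc, norm_eq_abs, norm_eq_abs]
      exact mul_le_mul_of_nonneg_right (abs_arctanCoeff_mul_sin_le j t) (abs_nonneg _)
  have hsn : Summable fun j => ∫ t in Set.Ioc (0 : ℝ) (1 / 2), ‖F j t‖ := by
    refine Summable.of_nonneg_of_le (fun k => integral_nonneg fun _ => norm_nonneg _)
      (fun j => ?_) ((summable_sechPi (-(1 / 2))).mul_right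
        (∫ t in Set.Ioc (0 : ℝ) (1 / 2), |sin (π * t)| * |altCschSum t|))
    rw [← integral_const_mul]
    exact integral_mono (hFi j).norm (h1.const_mul _) (hbound j)
  have h2 := hasSum_integral_of_summable_integral_norm hFi hsn
  rw [intervalIntegral.integral_of_le hle]
  have h3 : ∀ t, ∑' j, F j t =
      arctan (altSechSum (t - 1 / 2) / altSechSum 0) * altCschSum t := fun t => by
    rw [arctan_lemniscate_eq_tsum, ← tsum_mul_right]
    exact tsum_congr fun j => (mul_assoc _ _ _).symm
  simp only [h3] at h2
  rw [← h2.tsum_eq]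
  refine tsum_congr fun j => ?_
  simp only [hF]
  rw [integral_const_mul, ← intervalIntegral.integral_of_le hle, integral_half_sin_mul_altCschSum,
    arctanCoeff]
  have := half_int_ne_zero j
  field_simp
  ring

end ArctanIntegral

/-! ### Euler integrals for the hypergeometric series -/

section HypergeometricIntegral

open Real MeasureTheory

theorem integral_Ioo_rpow_mul_one_sub_rpow {a b : ℝ} (ha : 0 < a) (hb : 0 < b) :
    ∫ x in Set.Ioo (0 : ℝ) 1, x ^ (a - 1) * (1 - x) ^ (b - 1) =
      Gamma a * Gamma b / Gamma (a + b) := by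
  have h := Complex.betaIntegral_eq_Gamma_mul_div (a : ℂ) (b : ℂ) (by simpa) (by simpa)
  rw [← Complex.ofReal_add, Complex.Gamma_ofReal, Complex.Gamma_ofReal, Complex.Gamma_ofReal,
    Complex.betaIntegral, intervalIntegral.integral_of_le zero_le_one,
    integral_Ioc_eq_integral_Ioo] at h
  have h2 : ∫ x in Set.Ioo (0 : ℝ) 1, (x : ℂ) ^ ((a : ℂ) - 1) * (1 - (x : ℂ)) ^ ((b : ℂ) - 1) =
      ((∫ x in Set.Ioo (0 : ℝ) 1, x ^ (a - 1) * (1 - x) ^ (b - 1) : ℝ) : ℂ) := by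
    rw [← integral_complex_ofReal]
    refine setIntegral_congr_fun measurableSet_Ioo fun x hx => ?_
    rw [Complex.ofReal_mul, Complex.ofReal_cpow hx.1.le, Complex.ofReal_cpow (sub_nonneg.mpr hx.2.le)]
    push_cast
    rfl
  rw [h2] at h
  exact_mod_cast h

theorem integrableOn_Ioo_rpow_mul_one_sub_rpow {a b : ℝ} (ha : 0 < a) (hb : 0 < b) :
    IntegrableOn (fun x : ℝ => x ^ (a - 1) * (1 - x) ^ (b - 1)) (Set.Ioo 0 1) :=
  .of_integral_ne_zero (by
    rw [integral_Ioo_rpow_mul_one_sub_rpow ha hb]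
    have := Gamma_pos_of_pos ha
    have := Gamma_pos_of_pos hb
    have := Gamma_pos_of_pos (add_pos ha hb)
    positivity)

theorem ascPochhammer_eval_pos {a : ℝ} (ha : 0 < a) (n : ℕ) : 0 < (ascPochhammer ℝ n).eval a :=
  ascPochhammer_pos n a ha

/-- The ratio of the Pochhammer symbols of `1/2` and `f`. -/
noncomputable def pochhammerRatio (f : ℝ) (n : ℕ) : ℝ :=
  (ascPochhammer ℝ n).eval (1 / 2) / (ascPochhammer ℝ n).eval f

theorem pochhammerRatio_pos {f : ℝ} (hf : 0 < f) (n : ℕ) : 0 < pochhammerRatio f n :=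
  div_pos (ascPochhammer_eval_pos one_half_pos n) (ascPochhammer_eval_pos hf n)

theorem pochhammerRatio_three_halves (n : ℕ) : pochhammerRatio (3 / 2) n = 1 / (2 * n + 1) := by
  induction n with
  | zero => simp [pochhammerRatio]
  | succ n ih =>
    rw [pochhammerRatio, ascPochhammer_succ_eval, ascPochhammer_succ_eval, mul_div_mul_comm]
    change pochhammerRatio (3 / 2) n * _ = _
    rw [ih]
    push_cast
    field_simp
    ring

theorem hypergeometricTerm32_eq (f : ℝ) (n : ℕ) :
    hypergeometricTerm32 (1 / 2) (1 / 2) 1 (3 / 2) f 1 n = pochhammerRatio f n / (2 * n + 1) := by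
  have h1 : (ascPochhammer ℝ n).eval 1 = n.factorial := by
    rw [ascPochhammer_eval_one]
  have h2 := pochhammerRatio_three_halves n
  rw [pochhammerRatio] at h2
  have h3 : (n.factorial : ℝ) ≠ 0 := by positivity
  rw [hypergeometricTerm32, h1, one_pow, pochhammerRatio,
    div_eq_mul_one_div _ (2 * (n : ℝ) + 1), ← h2]
  field_simp

theorem pochhammerRatio_sub_succ {f : ℝ} (hf : 0 < f) (n : ℕ) :
    pochhammerRatio f n - pochhammerRatio f (n + 1) =
      pochhammerRatio f n * ((f - 1 / 2) / (f + n)) := by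
  have h : (f + n : ℝ) ≠ 0 := by positivity
  have h1 : pochhammerRatio f (n + 1) = pochhammerRatio f n * ((1 / 2 + n) / (f + n)) := by
    rw [pochhammerRatio, ascPochhammer_succ_eval, ascPochhammer_succ_eval, mul_div_mul_comm]
    rfl
  rw [h1]
  field_simp
  ring

/-- For f > 1/2 the positive sequence (1/2)ₙ/(f)ₙ decreases, so its differences are summable; the
terms are at most (f + 1)/(f - 1/2) times these differences. -/
theorem summable_pochhammerRatio_div {f : ℝ} (hf : 1 / 2 < f) :
    Summable fun n : ℕ => pochhammerRatio f n / (2 * n + 1) := by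
  have hf0 : 0 < f := by linarith
  have hpos := pochhammerRatio_pos hf0
  have h1 : Summable fun n : ℕ => pochhammerRatio f n * ((f - 1 / 2) / (f + n)) := by
    refine summable_of_sum_range_le (c := pochhammerRatio f 0) (fun n => ?_) fun n => ?_
    · have := hpos n
      have : 0 < f - 1 / 2 := by linarith
      positivity
    · simp_rw [← pochhammerRatio_sub_succ hf0]
      rw [Finset.sum_range_sub']
      linarith [hpos n]
  refine Summable.of_nonneg_of_le (fun n => ?_) (fun n => ?_) (h1.mul_left ((f + 1) / (f - 1 / 2)))
  · have := hpos n
    positivity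
  · have hp := hpos n
    have h2 : 0 < f - 1 / 2 := by linarith
    have h3 : (0 : ℝ) < f + n := by positivity
    have h4 : (0 : ℝ) ≤ n := n.cast_nonneg
    rw [show (f + 1) / (f - 1 / 2) * (pochhammerRatio f n * ((f - 1 / 2) / (f + n))) =
      pochhammerRatio f n * ((f + 1) / (f + n)) by
        generalize f - 1 / 2 = d at *
        field_simp, div_eq_mul_one_div]
    refine mul_le_mul_of_nonneg_left ?_ hp.le
    rw [div_le_div_iff₀ (by positivity) h3]
    nlinarith

theorem summable_hypergeometricTerm32 {f : ℝ} (hf : 1 / 2 < f) :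
    Summable (hypergeometricTerm32 (1 / 2) (1 / 2) 1 (3 / 2) f 1) :=
  (summable_pochhammerRatio_div hf).congr fun n => (hypergeometricTerm32_eq f n).symm

theorem pochhammerRatio_eq_integral {f : ℝ} (hf : 1 / 2 < f) (n : ℕ) :
    ∫ y in Set.Ioo (0 : ℝ) 1, y ^ (f - 1 / 2 - 1) * (1 - y) ^ (n + 1 / 2 - 1 : ℝ) =
      √π * Gamma (f - 1 / 2) / Gamma f * pochhammerRatio f n := by
  have hf0 : 0 < f := by linarith
  rw [integral_Ioo_rpow_mul_one_sub_rpow (by linarith) (by positivity), pochhammerRatio,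
    ascPochhammer_eval_eq_Gamma_div one_half_pos, ascPochhammer_eval_eq_Gamma_div hf0,
    Gamma_one_half_eq, add_comm (1 / 2 : ℝ) n,
    show f - 1 / 2 + (n + 1 / 2 : ℝ) = f + n by ring]
  have h1 := (Gamma_pos_of_pos hf0).ne'
  have h2 := (Gamma_pos_of_pos (show 0 < f + n by positivity)).ne'
  have h3 := (sqrt_pos.mpr pi_pos).ne'
  field_simp

/-- The area hyperbolic tangent of `√(1 - y)`. -/
noncomputable def artanhSqrtOneSub (y : ℝ) : ℝ := log (1 + √(1 - y)) - log y / 2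

/-- The series artanh r = ∑ r^(2n+1)/(2n + 1) at r = √(1 - y), divided by r². -/
theorem hasSum_artanhSqrtOneSub {y : ℝ} (hy : y ∈ Set.Ioo (0 : ℝ) 1) :
    HasSum (fun n : ℕ => (1 - y) ^ (n + 1 / 2 - 1 : ℝ) / (2 * n + 1))
      (artanhSqrtOneSub y / (1 - y)) := by
  have h1y : 0 < 1 - y := sub_pos.mpr hy.2
  set r := √(1 - y) with hr
  have hr0 : 0 < r := sqrt_pos.mpr h1y
  have hr2 : r ^ 2 = 1 - y := sq_sqrt h1y.le
  have hr1 : r < 1 := by nlinarith [hy.1]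
  have h := (hasSum_log_sub_log_of_abs_lt_one (x := r) (by rwa [abs_of_pos hr0])).mul_left
    (1 / (2 * (1 - y)))
  have hlog : log (1 - r) = log y - log (1 + r) := by
    rw [← log_div hy.1.ne' (by positivity)]
    congr 1
    rw [eq_div_iff (by positivity)]
    linear_combination -hr2
  have hval : 1 / (2 * (1 - y)) * (log (1 + r) - log (1 - r)) = artanhSqrtOneSub y / (1 - y) := by
    rw [hlog, artanhSqrtOneSub, ← hr]
    field_simp
    ring
  rw [hval] at h
  refine (congrArg (HasSum · _) (funext fun n => ?_)).mpr h
  have hpow : (1 - y) ^ (n + 1 / 2 - 1 : ℝ) = r ^ (2 * n + 1) / (1 - y) := by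
    rw [rpow_sub_one h1y.ne', rpow_add h1y, rpow_natCast, ← sqrt_eq_rpow, ← hr, pow_succ, pow_mul,
      hr2]
  rw [hpow]
  field_simp

/-- The ratio (1/2)ₙ/(f)ₙ is a beta integral and the rest of the coefficient is 1/(2n + 1). All
terms are nonnegative, so sum and integral interchange; positivity of the value then gives
integrability of the limit. -/
theorem hypergeometric32_eq_integral {f : ℝ} (hf : 1 / 2 < f) :
    IntegrableOn (fun y => y ^ (f - 1 / 2 - 1) * (artanhSqrtOneSub y / (1 - y))) (Set.Ioo 0 1) ∧
    ∫ y in Set.Ioo (0 : ℝ) 1, y ^ (f - 1 / 2 - 1) * (artanhSqrtOneSub y / (1 - y)) =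
      √π * Gamma (f - 1 / 2) / Gamma f * hypergeometric32 (1 / 2) (1 / 2) 1 (3 / 2) f 1 := by
  have hf0 : 0 < f := by linarith
  set K := √π * Gamma (f - 1 / 2) / Gamma f with hK
  have hK0 : 0 < K := by
    have := Gamma_pos_of_pos hf0
    have := Gamma_pos_of_pos (show 0 < f - 1 / 2 by linarith)
    have := pi_pos
    positivity
  set F : ℕ → ℝ → ℝ := fun n y =>
    y ^ (f - 1 / 2 - 1) * (1 - y) ^ (n + 1 / 2 - 1 : ℝ) / (2 * n + 1) with hF
  have hFi : ∀ n, IntegrableOn (F n) (Set.Ioo 0 1) := fun n =>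
    (integrableOn_Ioo_rpow_mul_one_sub_rpow (by linarith) (by positivity)).div_const _
  have hint : ∀ n, ∫ y in Set.Ioo (0 : ℝ) 1, F n y =
      K * hypergeometricTerm32 (1 / 2) (1 / 2) 1 (3 / 2) f 1 n := fun n => by
    simp only [hF]
    rw [integral_div, pochhammerRatio_eq_integral hf, hypergeometricTerm32_eq]
    ring
  have hnorm : ∀ n, ∫ y in Set.Ioo (0 : ℝ) 1, ‖F n y‖ = ∫ y in Set.Ioo (0 : ℝ) 1, F n y :=
    fun n => setIntegral_congr_fun measurableSet_Ioo fun y hy => by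
      refine norm_of_nonneg ?_
      have := rpow_nonneg hy.1.le (f - 1 / 2 - 1)
      have := rpow_nonneg (sub_nonneg.mpr hy.2.le) (n + 1 / 2 - 1 : ℝ)
      positivity
  have hs := (summable_hypergeometricTerm32 hf).mul_left K
  have h := hasSum_integral_of_summable_integral_norm hFi
    (hs.congr fun n => by rw [hnorm, hint])
  simp only [hint] at h
  have h2 := h.tsum_eq
  rw [tsum_mul_left] at h2
  have h3 : ∫ y in Set.Ioo (0 : ℝ) 1, ∑' n, F n y =
      ∫ y in Set.Ioo (0 : ℝ) 1, y ^ (f - 1 / 2 - 1) * (artanhSqrtOneSub y / (1 - y)) :=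
    setIntegral_congr_fun measurableSet_Ioo fun y hy => by
      simp only [hF]
      rw [← ((hasSum_artanhSqrtOneSub hy).mul_left (y ^ (f - 1 / 2 - 1))).tsum_eq]
      exact tsum_congr fun n => mul_div_assoc _ _ _
  have hval : ∫ y in Set.Ioo (0 : ℝ) 1, y ^ (f - 1 / 2 - 1) * (artanhSqrtOneSub y / (1 - y)) =
      K * hypergeometric32 (1 / 2) (1 / 2) 1 (3 / 2) f 1 := by
    rw [← h3, ← h2, hypergeometric32]
  have hpos : 0 < hypergeometric32 (1 / 2) (1 / 2) 1 (3 / 2) f 1 := by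
    refine (summable_hypergeometricTerm32 hf).tsum_pos (fun n => ?_) 0 ?_ <;>
    rw [hypergeometricTerm32_eq]
    · have := pochhammerRatio_pos hf0 n
      positivity
    · have := pochhammerRatio_pos hf0 0
      positivity
  exact ⟨.of_integral_ne_zero (by rw [hval]; positivity), hval⟩

theorem Gamma_quarter_mul_Gamma_three_quarters : Gamma (1 / 4) * Gamma (3 / 4) = π * √2 := by
  have h := Gamma_mul_Gamma_one_sub (1 / 4)
  rw [show (1 - 1 / 4 : ℝ) = 3 / 4 by norm_num, show π * (1 / 4) = π / 4 by ring,
    sin_pi_div_four] at h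
  rw [h]
  have h2 : √2 * √2 = 2 := mul_self_sqrt zero_le_two
  have : √2 ≠ 0 := by positivity
  field_simp
  linarith

/-- The combination of hypergeometric values is a single integral. -/
theorem hypergeometric_combination_eq_integral :
    √π * Gamma (1 / 4) ^ 2 / (32 * √2) * hypergeometric32 (1 / 2) (1 / 2) 1 (3 / 2) (3 / 4) 1 -
      √π * Gamma (3 / 4) ^ 2 / (8 * √2) * hypergeometric32 (1 / 2) (1 / 2) 1 (3 / 2) (5 / 4) 1 =
    π / 32 * ∫ y in Set.Ioo (0 : ℝ) 1, artanhSqrtOneSub y *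
      ((y ^ (-(3 / 4) : ℝ) - y ^ (-(1 / 4) : ℝ)) / (1 - y)) := by
  obtain ⟨i1, e1⟩ := hypergeometric32_eq_integral (f := 3 / 4) (by norm_num)
  obtain ⟨i2, e2⟩ := hypergeometric32_eq_integral (f := 5 / 4) (by norm_num)
  rw [show (3 / 4 - 1 / 2 - 1 : ℝ) = -(3 / 4) by norm_num] at i1
  rw [show (3 / 4 - 1 / 2 - 1 : ℝ) = -(3 / 4) by norm_num,
    show (3 / 4 - 1 / 2 : ℝ) = 1 / 4 by norm_num] at e1
  rw [show (5 / 4 - 1 / 2 - 1 : ℝ) = -(1 / 4) by norm_num] at i2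
  rw [show (5 / 4 - 1 / 2 - 1 : ℝ) = -(1 / 4) by norm_num,
    show (5 / 4 - 1 / 2 : ℝ) = 3 / 4 by norm_num, show (5 / 4 : ℝ) = 1 / 4 + 1 by norm_num,
    Gamma_add_one (by norm_num)] at e2
  have h := integral_sub i1 i2
  rw [e1, e2] at h
  have h1 : ∫ y in Set.Ioo (0 : ℝ) 1, artanhSqrtOneSub y *
      ((y ^ (-(3 / 4) : ℝ) - y ^ (-(1 / 4) : ℝ)) / (1 - y)) =
      ∫ y in Set.Ioo (0 : ℝ) 1, (y ^ (-(3 / 4) : ℝ) * (artanhSqrtOneSub y / (1 - y)) -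
        y ^ (-(1 / 4) : ℝ) * (artanhSqrtOneSub y / (1 - y))) := by
    congr 1
    funext y
    ring
  rw [h1, h, show (1 / 4 + 1 : ℝ) = 5 / 4 by norm_num]
  have hG := Gamma_quarter_mul_Gamma_three_quarters
  have h4 : Gamma (1 / 4) ≠ 0 := (Gamma_pos_of_pos (by norm_num)).ne'
  have h34 : Gamma (3 / 4) ≠ 0 := (Gamma_pos_of_pos (by norm_num)).ne'
  -- The reflection formula is what brings the two Gamma prefactors to the common value π/32.
  have hpi : π = Gamma (1 / 4) * Gamma (3 / 4) / √2 := by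
    rw [hG]; field_simp
  generalize hypergeometric32 (1 / 2) (1 / 2) 1 (3 / 2) (3 / 4) 1 = H₁ at *
  generalize hypergeometric32 (1 / 2) (1 / 2) 1 (3 / 2) (5 / 4) 1 = H₂ at *
  generalize √π = q at *
  rw [hpi]
  generalize Gamma (1 / 4) = g at *
  generalize Gamma (3 / 4) = g' at *
  field_simp
  ring

end HypergeometricIntegral

/-! ### Integration by parts and the substitution y = w⁴ -/

section LemniscateSubstitution

open Real MeasureTheory Filter Topology

theorem arctan_le_of_nonneg {x : ℝ} (hx : 0 ≤ x) : arctan x ≤ x := by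
  rcases lt_or_ge x (π / 2) with h | h
  · calc arctan x ≤ arctan (tan x) := arctan_strictMono.monotone (le_tan hx h)
      _ = x := arctan_tan (by linarith [pi_pos]) h
  · exact (arctan_lt_pi_div_two x).le.trans h

theorem hasDerivAt_artanhSqrtOneSub {y : ℝ} (hy : y ∈ Set.Ioo (0 : ℝ) 1) :
    HasDerivAt artanhSqrtOneSub (-(1 / (2 * (y * √(1 - y))))) y := by
  have h1y : 0 < 1 - y := sub_pos.mpr hy.2
  have hr0 : 0 < √(1 - y) := sqrt_pos.mpr h1y
  have hr2 : √(1 - y) ^ 2 = 1 - y := sq_sqrt h1y.le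
  have h := ((((hasDerivAt_id' y).const_sub 1).sqrt h1y.ne').const_add 1).log (by positivity)
  refine (h.sub ((hasDerivAt_log hy.1.ne').div_const 2)).congr_deriv ?_
  have hy0 := hy.1.ne'
  generalize √(1 - y) = r at *
  field_simp
  linear_combination -hr2

/-- With w = y^(1/4) the kernel (w⁻³ - w⁻¹)/(1 - w⁴) collapses to w⁻³/(1 + w²). This is where the
particular combination of the two series matters. -/
theorem hasDerivAt_four_mul_arctan_rpow {y : ℝ} (hy : y ∈ Set.Ioo (0 : ℝ) 1) :
    HasDerivAt (fun y : ℝ => 4 * arctan (y ^ (1 / 4 : ℝ)))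
      ((y ^ (-(3 / 4) : ℝ) - y ^ (-(1 / 4) : ℝ)) / (1 - y)) y := by
  have h1y : 0 < 1 - y := sub_pos.mpr hy.2
  have h := ((hasDerivAt_rpow_const (p := 1 / 4) (Or.inl hy.1.ne')).arctan).const_mul 4
  refine h.congr_deriv ?_
  set w := y ^ (1 / 4 : ℝ) with hw
  have hw0 : 0 < w := rpow_pos_of_pos hy.1 _
  have hw4 : w ^ 4 = y := by
    rw [hw, ← rpow_natCast, ← rpow_mul hy.1.le]; norm_num
  have e1 : y ^ (-(3 / 4) : ℝ) = (w ^ 3)⁻¹ := by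
    rw [hw, ← rpow_natCast, ← rpow_mul hy.1.le, ← rpow_neg hy.1.le]; norm_num
  have e2 : y ^ (-(1 / 4) : ℝ) = w⁻¹ := by
    rw [hw, ← rpow_neg hy.1.le]
  rw [show (1 / 4 - 1 : ℝ) = -(3 / 4) by norm_num, e1, e2, ← hw4]
  rw [← hw4] at h1y
  have h2 : (1 - w ^ 4) ≠ 0 := h1y.ne'
  field_simp
  ring

theorem continuous_four_mul_arctan_rpow :
    Continuous fun y : ℝ => 4 * arctan (y ^ (1 / 4 : ℝ)) :=
  continuous_const.mul (continuous_arctan.comp (continuous_id.rpow_const fun _ => Or.inr (by norm_num)))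

/-- The logarithmic singularity is beaten by arctan(y^(1/4)) ≤ y^(1/4). -/
theorem tendsto_artanhSqrtOneSub_mul_zero :
    Tendsto (fun y => artanhSqrtOneSub y * (4 * arctan (y ^ (1 / 4 : ℝ)))) (𝓝[>] 0) (𝓝 0) := by
  have hB : Tendsto (fun y : ℝ => 4 * arctan (y ^ (1 / 4 : ℝ))) (𝓝[>] 0) (𝓝 0) := by
    have h := continuous_four_mul_arctan_rpow.tendsto 0
    rw [zero_rpow (by norm_num), arctan_zero, mul_zero] at h
    exact h.mono_left nhdsWithin_le_nhds
  have h1 : Tendsto (fun y : ℝ => log (1 + √(1 - y))) (𝓝[>] 0) (𝓝 (log (1 + √(1 - 0)))) := by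
    have : ContinuousAt (fun y : ℝ => log (1 + √(1 - y))) 0 := by
      refine ContinuousAt.log (by fun_prop) (by positivity)
    exact this.tendsto.mono_left nhdsWithin_le_nhds
  have h2 : Tendsto (fun y : ℝ => log y * (4 * arctan (y ^ (1 / 4 : ℝ)))) (𝓝[>] 0) (𝓝 0) := by
    have h3 := (tendsto_log_mul_rpow_nhdsGT_zero (r := 1 / 4) (by norm_num)).norm.const_mul 4
    rw [norm_zero, mul_zero] at h3
    refine squeeze_zero_norm' ?_ h3
    filter_upwards [self_mem_nhdsWithin] with y hy
    have hy0 : (0 : ℝ) < y := hy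
    have hw : 0 ≤ y ^ (1 / 4 : ℝ) := rpow_nonneg hy0.le _
    rw [norm_mul, norm_mul, norm_mul, norm_of_nonneg hw, norm_of_nonneg (zero_le_four),
      norm_of_nonneg (arctan_nonneg.mpr hw)]
    have := arctan_le_of_nonneg hw
    calc ‖log y‖ * (4 * arctan (y ^ (1 / 4 : ℝ))) ≤ ‖log y‖ * (4 * y ^ (1 / 4 : ℝ)) := by gcongr
      _ = _ := by ring
  have h4 := (h1.mul hB).sub (h2.div_const 2)
  rw [mul_zero, zero_div, sub_zero] at h4
  refine h4.congr fun y => ?_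
  rw [artanhSqrtOneSub]
  ring

theorem tendsto_artanhSqrtOneSub_mul_one :
    Tendsto (fun y => artanhSqrtOneSub y * (4 * arctan (y ^ (1 / 4 : ℝ)))) (𝓝[<] 1) (𝓝 0) := by
  have h : ContinuousAt artanhSqrtOneSub 1 := by
    refine ContinuousAt.sub (ContinuousAt.log (by fun_prop) (by positivity)) ?_
    exact (continuousAt_log one_ne_zero).div_const 2
  have h1 := h.tendsto.mul (continuous_four_mul_arctan_rpow.tendsto 1)
  have h2 : artanhSqrtOneSub 1 = 0 := by simp [artanhSqrtOneSub]
  rw [h2, zero_mul] at h1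
  exact h1.mono_left nhdsWithin_le_nhds

theorem integrableOn_arctan_rpow_div :
    IntegrableOn (fun y : ℝ => 4 * arctan (y ^ (1 / 4 : ℝ)) * (1 / (2 * (y * √(1 - y)))))
      (Set.Ioo 0 1) := by
  have h := integrableOn_Ioo_rpow_mul_one_sub_rpow (a := 1 / 4) (b := 1 / 2) (by norm_num)
    (by norm_num)
  refine (h.const_mul 2).mono' ?_ ?_
  · refine (ContinuousOn.mul continuous_four_mul_arctan_rpow.continuousOn
      (ContinuousOn.div₀ continuousOn_const ?_ fun y hy => ?_)).aestronglyMeasurable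
      measurableSet_Ioo
    · fun_prop
    · have := sqrt_pos.mpr (sub_pos.mpr hy.2)
      have := hy.1
      positivity
  · refine ae_restrict_of_forall_mem measurableSet_Ioo fun y hy => ?_
    have h1y : 0 < 1 - y := sub_pos.mpr hy.2
    have hy0 := hy.1
    have hw : 0 ≤ y ^ (1 / 4 : ℝ) := rpow_nonneg hy0.le _
    have hr0 : 0 < √(1 - y) := sqrt_pos.mpr h1y
    have hat := arctan_nonneg.mpr hw
    rw [norm_of_nonneg (by positivity), rpow_sub_one hy0.ne',
      show (1 / 2 - 1 : ℝ) = -(1 / 2) by norm_num, rpow_neg h1y.le, ← sqrt_eq_rpow]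
    have := arctan_le_of_nonneg hw
    calc 4 * arctan (y ^ (1 / 4 : ℝ)) * (1 / (2 * (y * √(1 - y))))
        ≤ 4 * y ^ (1 / 4 : ℝ) * (1 / (2 * (y * √(1 - y)))) := by gcongr
      _ = _ := by
          field_simp
          norm_num

theorem integral_artanhSqrtOneSub_by_parts :
    ∫ y in Set.Ioo (0 : ℝ) 1, artanhSqrtOneSub y *
      ((y ^ (-(3 / 4) : ℝ) - y ^ (-(1 / 4) : ℝ)) / (1 - y)) =
    ∫ y in Set.Ioo (0 : ℝ) 1, 4 * arctan (y ^ (1 / 4 : ℝ)) * (1 / (2 * (y * √(1 - y)))) := by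
  have i1 : IntegrableOn (fun y => artanhSqrtOneSub y *
      ((y ^ (-(3 / 4) : ℝ) - y ^ (-(1 / 4) : ℝ)) / (1 - y))) (Set.Ioo 0 1) := by
    have h1 := (hypergeometric32_eq_integral (f := 3 / 4) (by norm_num)).1
    have h2 := (hypergeometric32_eq_integral (f := 5 / 4) (by norm_num)).1
    rw [show (3 / 4 - 1 / 2 - 1 : ℝ) = -(3 / 4) by norm_num] at h1
    rw [show (5 / 4 - 1 / 2 - 1 : ℝ) = -(1 / 4) by norm_num] at h2
    refine (h1.sub h2).congr (Filter.Eventually.of_forall fun y => ?_)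
    simp only [Pi.sub_apply]
    ring
  have h := intervalIntegral.integral_eq_sub_of_hasDerivAt_of_tendsto zero_lt_one
    (f := fun y => artanhSqrtOneSub y * (4 * arctan (y ^ (1 / 4 : ℝ))))
    (f' := fun y => artanhSqrtOneSub y * ((y ^ (-(3 / 4) : ℝ) - y ^ (-(1 / 4) : ℝ)) / (1 - y)) -
      4 * arctan (y ^ (1 / 4 : ℝ)) * (1 / (2 * (y * √(1 - y)))))
    (fun y hy => ((hasDerivAt_artanhSqrtOneSub hy).mul
      (hasDerivAt_four_mul_arctan_rpow hy)).congr_deriv (by ring))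
    ((intervalIntegrable_iff_integrableOn_Ioo_of_le zero_le_one).mpr
      (i1.sub integrableOn_arctan_rpow_div))
    tendsto_artanhSqrtOneSub_mul_zero tendsto_artanhSqrtOneSub_mul_one
  rw [intervalIntegral.integral_of_le zero_le_one, integral_Ioc_eq_integral_Ioo,
    integral_sub i1 integrableOn_arctan_rpow_div, sub_zero] at h
  exact sub_eq_zero.mp h

/-- The lemniscate sine, rescaled to map `[0, 1/2]` onto `[0, 1]`. -/
noncomputable def lemniscate (t : ℝ) : ℝ := altSechSum (t - 1 / 2) / altSechSum 0

theorem lemniscate_zero : lemniscate 0 = 0 := by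
  rw [lemniscate, altSechSum_zero_sub_half, zero_div]

theorem lemniscate_half : lemniscate (1 / 2) = 1 := by
  rw [lemniscate, sub_self, div_self altSechSum_zero_pos.ne']

theorem altSechSum_pos {t : ℝ} (ht : t ∈ Set.Ioo (0 : ℝ) (1 / 2)) : 0 < altSechSum t := by
  have := altSechSum_sub_half_pos (t := t + 1 / 2) ⟨by linarith [ht.1], by linarith [ht.2]⟩
  rwa [add_sub_cancel_right] at this

theorem strictMonoOn_lemniscate_pow_four :
    StrictMonoOn (fun t => lemniscate t ^ 4) (Set.Icc 0 (1 / 2)) := by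
  have h : StrictMonoOn lemniscate (Set.Icc 0 (1 / 2)) := by
    refine strictMonoOn_of_deriv_pos (convex_Icc _ _)
      (fun t _ => (hasDerivAt_lemniscate t).continuousAt.continuousWithinAt) fun t ht => ?_
    rw [interior_Icc] at ht
    have h1 : deriv lemniscate t = _ := (hasDerivAt_lemniscate t).deriv
    rw [h1]
    have := altSechSum_pos ht
    have := pi_pos
    positivity
  intro x hx y hy hxy
  have h0 : 0 ≤ lemniscate x := by
    rw [← lemniscate_zero]
    exact h.monotoneOn (Set.left_mem_Icc.mpr (by norm_num)) hx hx.1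
  exact pow_lt_pow_left₀ (h hx hy hxy) h0 (by norm_num)

theorem hasDerivAt_lemniscate_pow_four (t : ℝ) :
    HasDerivAt (fun t => lemniscate t ^ 4)
      (4 * lemniscate t ^ 3 * (π * altSechSum t * (1 + lemniscate t ^ 2))) t := by
  have h := (hasDerivAt_lemniscate t).pow 4
  refine h.congr_deriv ?_
  rw [lemniscate]
  norm_num

theorem image_lemniscate_pow_four :
    (fun t => lemniscate t ^ 4) '' Set.Ioo 0 (1 / 2) = Set.Ioo 0 1 := by
  have hle : (0 : ℝ) ≤ 1 / 2 := by norm_num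
  have h0 : (fun t => lemniscate t ^ 4) 0 = 0 := by simp [lemniscate_zero]
  have h1 : (fun t => lemniscate t ^ 4) (1 / 2) = 1 := by
    simp only [lemniscate_half, one_pow]
  refine Set.Subset.antisymm ?_ ?_
  · rintro _ ⟨t, ht, rfl⟩
    have ht' := Set.Ioo_subset_Icc_self ht
    constructor
    · have := strictMonoOn_lemniscate_pow_four (Set.left_mem_Icc.mpr hle) ht' ht.1
      rwa [h0] at this
    · have := strictMonoOn_lemniscate_pow_four ht' (Set.right_mem_Icc.mpr hle) ht.2
      rwa [h1] at this
  · have h := intermediate_value_Ioo hle (f := fun t => lemniscate t ^ 4)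
      fun t _ => (hasDerivAt_lemniscate_pow_four t).continuousAt.continuousWithinAt
    simpa only [lemniscate_zero, lemniscate_half, one_pow, zero_pow four_ne_zero] using h

/-- From `altSechSum_curve`: λ²(1 - w²) = c²(1 + w²), multiplied by 1 + w². Positivity of c on the
open quarter period selects the root. -/
theorem sqrt_one_sub_lemniscate_pow_four {t : ℝ} (ht : t ∈ Set.Ioo (0 : ℝ) (1 / 2)) :
    √(1 - lemniscate t ^ 4) = altSechSum t * (1 + lemniscate t ^ 2) / altSechSum 0 := by
  have hl := altSechSum_zero_pos
  have hc := altSechSum_pos ht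
  rw [sqrt_eq_iff_mul_self_eq_of_pos (by positivity)]
  have h := altSechSum_curve t
  rw [lemniscate]
  generalize altSechSum (t - 1 / 2) = s at *
  generalize altSechSum t = c at *
  generalize altSechSum 0 = l at *
  field_simp
  linear_combination (s ^ 2 + l ^ 2) * h

/-- Under y = w⁴ the form dy/(y√(1 - y)) becomes 4w′ dt/(w√(1 - w⁴)) = 4πλ dt/w, and λ/w is
`altCschSum` by the constant product and `altCschSum_half`. -/
theorem integral_arctan_rpow_eq :
    ∫ y in Set.Ioo (0 : ℝ) 1, 4 * arctan (y ^ (1 / 4 : ℝ)) * (1 / (2 * (y * √(1 - y)))) =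
      8 * π * ∫ t in (0 : ℝ)..(1 / 2), arctan (lemniscate t) * altCschSum t := by
  have hle : (0 : ℝ) ≤ 1 / 2 := by norm_num
  have h := integral_image_eq_integral_abs_deriv_smul measurableSet_Ioo
    (fun t (_ : t ∈ Set.Ioo (0 : ℝ) (1 / 2)) =>
      (hasDerivAt_lemniscate_pow_four t).hasDerivWithinAt)
    (strictMonoOn_lemniscate_pow_four.injOn.mono Set.Ioo_subset_Icc_self)
    (fun y : ℝ => 4 * arctan (y ^ (1 / 4 : ℝ)) * (1 / (2 * (y * √(1 - y)))))
  rw [image_lemniscate_pow_four] at h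
  rw [h, intervalIntegral.integral_of_le hle, integral_Ioc_eq_integral_Ioo, ← integral_const_mul]
  refine setIntegral_congr_fun measurableSet_Ioo fun t ht => ?_
  have hl := altSechSum_zero_pos
  have hc := altSechSum_pos ht
  have ht1 : t ∈ Set.Ioo (0 : ℝ) 1 := ⟨ht.1, by linarith [ht.2]⟩
  have hs := altSechSum_sub_half_pos ht1
  have hw : 0 < lemniscate t := div_pos hs hl
  have hn := altCschSum_mul_of_mem_Ioo ht1
  have hroot : (lemniscate t ^ 4) ^ (1 / 4 : ℝ) = lemniscate t := by
    rw [← rpow_natCast, ← rpow_mul hw.le]; norm_num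
  have hn' : altCschSum t = altSechSum 0 / lemniscate t := by
    rw [altCschSum_half] at hn
    rw [lemniscate, eq_div_iff (by positivity), ← mul_div_assoc, hn, mul_div_cancel_right₀ _ hl.ne']
  have hpi := pi_pos
  simp only [smul_eq_mul]
  rw [hroot, sqrt_one_sub_lemniscate_pow_four ht, hn', abs_of_pos (by positivity)]
  field_simp
  norm_num

/-- The hypergeometric combination as a hyperbolic series. -/
theorem hypergeometric_combination_eq_tsum :
    √π * Gamma (1 / 4) ^ 2 / (32 * √2) * hypergeometric32 (1 / 2) (1 / 2) 1 (3 / 2) (3 / 4) 1 -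
      √π * Gamma (3 / 4) ^ 2 / (8 * √2) * hypergeometric32 (1 / 2) (1 / 2) 1 (3 / 2) (5 / 4) 1 =
    π ^ 2 / 16 * ∑' j : ℤ, sechPi (-(1 / 2) + j) * tanhPi (-(1 / 2) + j) / (-(1 / 2) + j) := by
  rw [hypergeometric_combination_eq_integral, integral_artanhSqrtOneSub_by_parts,
    integral_arctan_rpow_eq]
  simp only [lemniscate]
  rw [integral_arctan_lemniscate_mul_altCschSum]
  have h : ∀ j : ℤ, sechPi (-(1 / 2) + j) * tanhPi (-(1 / 2) + j) / (4 * (-(1 / 2) + j)) =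
      1 / 4 * (sechPi (-(1 / 2) + j) * tanhPi (-(1 / 2) + j) / (-(1 / 2) + j)) := fun j => by
    rw [mul_comm 4, ← div_div]; ring
  simp_rw [h]
  rw [tsum_mul_left]
  ring

end LemniscateSubstitution

/-! ### The sum over one lattice row by the Lipschitz formula -/

section InnerLatticeSum

open Real

theorem cexp_two_pi_I_mul_quarter (x : ℝ) :
    Complex.exp (2 * π * Complex.I * (⟨1 / 4, x / 4⟩ : ℂ)) =
      ⟨0, exp (-(π * x / 2))⟩ := by
  have h : (2 * π * Complex.I * (⟨1 / 4, x / 4⟩ : ℂ)) = ⟨-(π * x / 2), π / 2⟩ := by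
    apply Complex.ext <;> simp <;> ring
  rw [h]
  apply Complex.ext
  · rw [Complex.exp_re]; simp
  · rw [Complex.exp_im]; simp

theorem im_one_div_sq_quarter_add {x : ℝ} (n : ℤ) :
    (1 / ((⟨1 / 4, x / 4⟩ : ℂ) + n) ^ (1 + 1)).im =
      -32 * x * ((4 * n + 1) / (x ^ 2 + (4 * n + 1) ^ 2) ^ 2) := by
  have h : (4 * n + 1 : ℝ) ≠ 0 := four_mul_add_one_ne_zero n
  have h' : 0 < x ^ 2 + (4 * n + 1 : ℝ) ^ 2 := by positivity
  have e : (⟨1 / 4, x / 4⟩ : ℂ) + n = ⟨(4 * n + 1) / 4, x / 4⟩ := by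
    apply Complex.ext <;> simp
    ring
  have e2 : (⟨(4 * n + 1) / 4, x / 4⟩ : ℂ) ^ (1 + 1) =
      ⟨((4 * n + 1) ^ 2 - x ^ 2) / 16, (4 * n + 1) * x / 8⟩ := by
    apply Complex.ext <;> simp [pow_two] <;> ring
  rw [e, e2, one_div, Complex.inv_im, Complex.normSq_mk]
  have e3 : ((4 * n + 1 : ℝ) ^ 2 - x ^ 2) / 16 * (((4 * n + 1) ^ 2 - x ^ 2) / 16) +
      (4 * n + 1) * x / 8 * ((4 * n + 1) * x / 8) = (x ^ 2 + (4 * n + 1) ^ 2) ^ 2 / 256 := by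
    ring
  rw [e3]
  field_simp
  ring

/-- Here q is purely imaginary, q = i·exp(-πx/2), so ∑ n qⁿ = q/(1 - q)² has an imaginary part
expressible by hyperbolic functions at x/2. -/
theorem im_geometric_sum (x : ℝ) :
    ((⟨0, exp (-(π * x / 2))⟩ : ℂ) / (1 - (⟨0, exp (-(π * x / 2))⟩ : ℂ)) ^ 2).im =
      sechPi (x / 2) * tanhPi (x / 2) / 2 := by
  rw [sechPi, tanhPi, cosh_eq, sinh_eq, ← mul_div_assoc π x 2, exp_neg]
  set E := exp (π * x / 2) with hE
  have hE0 : 0 < E := exp_pos _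
  have e : (1 - (⟨0, E⁻¹⟩ : ℂ)) ^ 2 = ⟨1 - E⁻¹ ^ 2, -2 * E⁻¹⟩ := by
    apply Complex.ext <;> simp [pow_two]
    ring
  have e3 : (1 - E⁻¹ ^ 2) * (1 - E⁻¹ ^ 2) + (-2 * E⁻¹) * (-2 * E⁻¹) = (1 + E⁻¹ ^ 2) ^ 2 := by
    ring
  rw [e, Complex.div_im, Complex.normSq_mk, e3]
  simp only []
  field_simp
  ring

/-- The Lipschitz formula ∑ (z + n)⁻² = -4π² ∑ n qⁿ at z = (1 + ix)/4; its imaginary part isolates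
the numerator 4n + 1. -/
theorem tsum_int_lattice_row_of_pos {x : ℝ} (hx : 0 < x) :
    ∑' n : ℤ, (4 * n + 1 : ℝ) / (x ^ 2 + (4 * n + 1) ^ 2) ^ 2 =
      π ^ 2 / (16 * x) * (sechPi (x / 2) * tanhPi (x / 2)) := by
  have hid := EisensteinSeries.qExpansion_identity (k := 1) le_rfl
    ⟨⟨1 / 4, x / 4⟩, by simpa using hx⟩
  have hs : Summable fun n : ℤ => 1 / ((⟨1 / 4, x / 4⟩ : ℂ) + n) ^ (1 + 1) := by
    refine (EisensteinSeries.linear_right_summable ⟨1 / 4, x / 4⟩ 1 (k := 2) le_rfl).congr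
      fun n => ?_
    rw [Int.cast_one, one_mul, one_div (_ ^ _)]
    rfl
  have hq : ‖(⟨0, exp (-(π * x / 2))⟩ : ℂ)‖ < 1 := by
    have : (⟨0, exp (-(π * x / 2))⟩ : ℂ) = (exp (-(π * x / 2)) : ℝ) * Complex.I := by
      apply Complex.ext <;> simp [-Complex.ofReal_exp]
    rw [this, norm_mul, Complex.norm_I, mul_one, Complex.norm_real, norm_of_nonneg (exp_pos _).le,
      exp_lt_one_iff]
    have : 0 < π * x := by positivity
    linarith
  simp only [pow_one, cexp_two_pi_I_mul_quarter, tsum_coe_mul_geometric_of_norm_lt_one hq] at hid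
  have him := congrArg Complex.im hid
  rw [Complex.im_tsum hs] at him
  simp only [im_one_div_sq_quarter_add] at him
  have hc : (-2 * π * Complex.I : ℂ) ^ (1 + 1) / (Nat.factorial 1 : ℂ) = ((-4 * π ^ 2 : ℝ) : ℂ) := by
    have := Complex.I_sq
    simp only [Nat.factorial_one, Nat.cast_one, div_one]
    push_cast
    linear_combination (4 * (π : ℂ) ^ 2) * this
  rw [hc, Complex.im_ofReal_mul, im_geometric_sum, tsum_mul_left] at him
  field_simp at him ⊢
  linarith

theorem tsum_int_lattice_row {x : ℝ} (hx : x ≠ 0) :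
    ∑' n : ℤ, (4 * n + 1 : ℝ) / (x ^ 2 + (4 * n + 1) ^ 2) ^ 2 =
      π ^ 2 / (16 * x) * (sechPi (x / 2) * tanhPi (x / 2)) := by
  rcases hx.lt_or_gt with h | h
  · have := tsum_int_lattice_row_of_pos (neg_pos.mpr h)
    rw [neg_sq, neg_div, sechPi_neg, tanhPi_neg] at this
    rw [this]
    field_simp
  · exact tsum_int_lattice_row_of_pos h

end InnerLatticeSum

/-! ### Half-integers split into two classes -/

section OddSplit

open Real

/-- Every half-integer is 2i + 1/2 or -(2i + 1/2) for exactly one integer i, and an even function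
takes the same values on both classes. -/
theorem tsum_int_half_of_even {g : ℝ → ℝ} (hg : ∀ x, g (-x) = g x)
    (hs : Summable fun j : ℤ => g (-(1 / 2) + j)) :
    ∑' j : ℤ, g (-(1 / 2) + j) = 2 * ∑' j : ℤ, g (2 * j + 1 / 2) := by
  have he : Function.Injective fun i : ℤ => -(2 * i) := fun a b h => by
    simp only at h; omega
  have ho : Function.Injective fun i : ℤ => 2 * i + 1 := fun a b h => by
    simp only at h; omega
  have hodd : (fun i : ℤ => g (-(1 / 2) + ((2 * i + 1 : ℤ) : ℝ))) =
      fun i : ℤ => g (2 * i + 1 / 2) := by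
    funext i
    congr 1
    push_cast
    ring
  have heven : (fun i : ℤ => g (-(1 / 2) + ((-(2 * i) : ℤ) : ℝ))) =
      fun i : ℤ => g (2 * i + 1 / 2) := by
    funext i
    rw [← hg]
    congr 1
    push_cast
    ring
  have hS := hs.comp_injective ho
  simp only [Function.comp_def, hodd] at hS
  have h1 : HasSum ((fun j : ℤ => g (-(1 / 2) + j)) ∘ fun i : ℤ => 2 * i + 1)
      (∑' j : ℤ, g (2 * j + 1 / 2)) := by
    simp only [Function.comp_def, hodd]
    exact hS.hasSum
  have h2 : HasSum ((fun j : ℤ => g (-(1 / 2) + j)) ∘ fun i : ℤ => -(2 * i))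
      (∑' j : ℤ, g (2 * j + 1 / 2)) := by
    simp only [Function.comp_def, heven]
    exact hS.hasSum
  have hc : IsCompl (Set.range fun i : ℤ => -(2 * i)) (Set.range fun i : ℤ => 2 * i + 1) := by
    rw [← compl_eq_iff_isCompl]
    ext k
    simp only [Set.mem_compl_iff, Set.mem_range, not_exists]
    constructor
    · intro h
      have := h (-(k / 2))
      exact ⟨k / 2, by omega⟩
    · rintro ⟨i, rfl⟩ l
      omega
  rw [two_mul]
  exact (HasSum.add_isCompl (f := fun j : ℤ => g (-(1 / 2) + j)) hc
    (he.hasSum_range_iff.mpr h2) (ho.hasSum_range_iff.mpr h1)).tsum_eq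

end OddSplit

/-! ### The lattice sum as the hyperbolic series -/

section LatticeSum

open Real

theorem abs_tanhPi_le_one (x : ℝ) : |tanhPi x| ≤ 1 := by
  rw [tanhPi, abs_div, abs_of_pos (cosh_pos _), div_le_one (cosh_pos _)]
  exact abs_le.mpr ⟨by have := exp_pos (π * x); linarith [cosh_add_sinh (π * x)],
    (sinh_lt_cosh _).le⟩

theorem summable_sechPi_mul_tanhPi_div :
    Summable fun j : ℤ =>
      sechPi (-(1 / 2) + j) * tanhPi (-(1 / 2) + j) / (-(1 / 2) + j) := by
  refine Summable.of_norm_bounded ((summable_sechPi (-(1 / 2))).mul_left 2) fun j => ?_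
  have hj : 1 / 2 ≤ |(-(1 / 2) + j : ℝ)| := by
    rcases le_or_gt j 0 with h | h
    · have : (j : ℝ) ≤ 0 := by exact_mod_cast h
      rw [abs_of_neg (by linarith)]
      linarith
    · have : (1 : ℝ) ≤ j := by exact_mod_cast h
      rw [abs_of_pos (by linarith)]
      linarith
  rw [norm_div, norm_mul, norm_of_nonneg (sechPi_pos _).le, norm_eq_abs, norm_eq_abs,
    div_le_iff₀ (by linarith)]
  have h0 := sechPi_pos (-(1 / 2) + j)
  calc sechPi (-(1 / 2) + j) * |tanhPi (-(1 / 2) + j)|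
      ≤ sechPi (-(1 / 2) + j) * 1 := by gcongr; exact abs_tanhPi_le_one _
    _ = 2 * sechPi (-(1 / 2) + j) * (1 / 2) := by ring
    _ ≤ _ := by gcongr

/-- Summing rows with x = 4j + 1 samples the even summand only at the half-integers 2j + 1/2;
evenness extends the sum to all half-integers at the cost of a factor 1/2. -/
theorem tsum_latticeTerm :
    4 * ∑' x, latticeTerm x = π ^ 2 / 16 *
      ∑' j : ℤ, sechPi (-(1 / 2) + j) * tanhPi (-(1 / 2) + j) / (-(1 / 2) + j) := by
  have hg := tsum_int_half_of_even (g := fun x => sechPi x * tanhPi x / x)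
    (fun x => by rw [sechPi_neg, tanhPi_neg, mul_neg, neg_div_neg_eq])
    summable_sechPi_mul_tanhPi_div
  have hrow (j : ℤ) : ∑' l : ℤ, latticeTerm (j, l) =
      π ^ 2 / 32 * (sechPi (2 * j + 1 / 2) * tanhPi (2 * j + 1 / 2) / (2 * j + 1 / 2)) := by
    have h0 := four_mul_add_one_ne_zero j
    have h := tsum_int_lattice_row h0
    have e : (4 * j + 1 : ℝ) / 2 = 2 * j + 1 / 2 := by ring
    rw [e] at h
    refine h.trans ?_
    rw [show (4 * j + 1 : ℝ) = 2 * (2 * j + 1 / 2) by ring] at h0 ⊢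
    have h1 := (mul_ne_zero_iff.mp h0).2
    generalize (2 * j + 1 / 2 : ℝ) = y at h1 ⊢
    field_simp
    ring
  rw [hg, summable_latticeTerm.tsum_prod, tsum_congr hrow, tsum_mul_left]
  ring

end LatticeSum

theorem theorem2p5 :
    LSeriesSummable (fun n : ℕ => (curveE32.LFunction n : ℂ)) 2 ∧
    Summable (hypergeometricTerm32 (1 / 2) (1 / 2) 1 (3 / 2) (3 / 4) 1) ∧
    Summable (hypergeometricTerm32 (1 / 2) (1 / 2) 1 (3 / 2) (5 / 4) 1) ∧
    curveE32.LSeries 2 =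
      ((√Real.pi * Real.Gamma (1 / 4) ^ 2 / (32 * √2) *
            hypergeometric32 (1 / 2) (1 / 2) 1 (3 / 2) (3 / 4) 1 -
          √Real.pi * Real.Gamma (3 / 4) ^ 2 / (8 * √2) *
            hypergeometric32 (1 / 2) (1 / 2) 1 (3 / 2) (5 / 4) 1 : ℝ) : ℂ) := by
  refine ⟨lseriesSummable_curveE32, summable_hypergeometricTerm32 (by norm_num),
    summable_hypergeometricTerm32 (by norm_num), ?_⟩
  rw [lseries_curveE32_two, hypergeometric_combination_eq_tsum, tsum_latticeTerm]
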